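/- Let $H$ be the $7$-dimensional Heisenberg group, the simply connected Lie group whose Lie algebra $\mathfrak h$ has a basis $e_1,\dots,e_7$ with dual basis satisfying $de^1=\dots=de^6=0$ and $de^7=\frac{\sqrt6}{6}(e^{12}+e^{34}+e^{56})$; its centre is $\mathfrak z=\langle e_7\rangle$. Left-invariant forms on $H$ are identified with elements of $\Lambda^*\mathfrak h^*$. A left-invariant $\mathrm G_2$ form is a form that can be written $a^{127}+a^{347}+a^{567}+a^{135}-a^{146}-a^{236}-a^{245}$ in some basis $a^1,\dots,a^7$ of $\mathfrak h^*$; it induces the metric and orientation for which this coframe is orthonormal and positive. Let $\varphi_0$ be a left-invariant $\mathrm G_2$ form, with induced metric $g_0$, norm $\|\cdot\|_0$ and Hodge star $\star_0$, which is coclosed: $d\star_0\varphi_0=0$. Put $x_0=e_7/\|e_7\|_0$ and $\eta=g_0(x_0,\cdot)$, so that $\|\eta\|_0=1$ and $\mathrm{Ker}(\eta)=\mathfrak z^{\perp}$; put $\psi_0=\star_0\varphi_0$, $\omega_0=\iota_{x_0}\varphi_0$ and $\delta_0=\frac16\|(d\eta)^3\|_0$. Forms on $\mathrm{Ker}(\eta)$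 are extended by zero on $\mathfrak z$, and for a $6$-form $\alpha$ on $\mathrm{Ker}(\eta)$ put $*_0\alpha=\star_0(\alpha\wedge\eta)$. Consider the Laplacian coflow of left-invariant forms $$\psi'(t)=-\Delta_t\psi(t),\qquad d\psi(t)=0,\qquad \psi(0)=\psi_0,$$ where $\psi(t)=\star_t\varphi(t)$ for a left-invariant $\mathrm G_2$ form $\varphi(t)$, and $\star_t$ and the Hodge Laplacian $\Delta_t=dd^*+d^*d$ are those of the metric and orientation induced by $\varphi(t)$. Then the coflow has a unique maximal solution $\psi$ (every solution on an open interval containing $0$ is a restriction of $\psi$). It is ancient: its interval of existence is $(-\infty,T)$ with $$0<T<\frac{4}{\sqrt[3]{6\,\delta_0^2}}.$$ Moreover there are signs $n_1,n_2,n_3\in\{1,-1\}$, a $g_0$-orthogonal frame $f_1,\dots,f_6$ of $\mathrm{Ker}(\eta)$ with dual frame $f^1,\dots,f^6$, and functions $\lambda_1,\lambda_2,\lambda_3>0$ on $(-\infty,T)$ such that for all $t<T$ $$\psi(t)=\tfrac12\,\omega(t)^2+\widehat\rho(t)\wedge\tfrac1{\varepsilon_t}\,\eta ,\qquad 6\,\varepsilon_t^2=*_0(\omega(t)^3),\quad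 \varepsilon_t>0,$$ $$\omega(t)=\lambda_1(t)f^{12}+\lambda_2(t)f^{34}+\lambda_3(t)f^{56},\qquad \widehat\rho(t)=\sqrt{\lambda_1(t)\lambda_2(t)\lambda_3(t)}\,\bigl(-f^{246}+f^{136}+f^{145}+f^{235}\bigr),$$ $$\lambda_1'=-\frac{\lambda_2\lambda_3+n_2n_3\lambda_1^2}{\lambda_1^2\lambda_2^2\lambda_3^2},\qquad \lambda_2'=-\frac{\lambda_1\lambda_3+n_1n_3\lambda_2^2}{\lambda_1^2\lambda_2^2\lambda_3^2},\qquad \lambda_3'=-\frac{\lambda_1\lambda_2+n_1n_2\lambda_3^2}{\lambda_1^2\lambda_2^2\lambda_3^2},$$ with $\omega(0)=\omega_0$, that is $\lambda_1(0)=\omega_0(f_1,f_2)$, $\lambda_2(0)=\omega_0(f_3,f_4)$, $\lambda_3(0)=\omega_0(f_5,f_6)$. The frame is normalised by $\|f_{2j-1}\|_0^2=\|f_{2j}\|_0^2=\lambda_j(0)$ for $j=1,2,3$ and $d\eta=(\lambda_1(0)\lambda_2(0)\lambda_3(0))^{-1/2}\,(n_1f^{12}+n_2f^{34}+n_3f^{56})$.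 -/

import Mathlib

/-! ### Exterior algebra of the dual of a real vector space -/

/-- `Λ V = ⨁ₖ Λᵏ V*`: the algebra of alternating forms on `V`; the product is the wedge product. -/
abbrev Forms (V : Type*) [AddCommGroup V] [Module ℝ V] : Type _ :=
  ExteriorAlgebra ℝ (Module.Dual ℝ V)

/-- A covector, viewed as a 1-form. -/
noncomputable abbrev oneForm {V : Type*} [AddCommGroup V] [Module ℝ V] (a : Module.Dual ℝ V) :
    Forms V :=
  ExteriorAlgebra.ι ℝ a

/-- The interior product `α ↦ ι_v α`: the antiderivation of degree `-1` with
`ι_v a = a v` on 1-forms. -/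
noncomputable def interiorProd {V : Type*} [AddCommGroup V] [Module ℝ V] (v : V) :
    Forms V →ₗ[ℝ] Forms V :=
  CliffordAlgebra.contractLeft (Module.Dual.eval ℝ V v)

/-- The coframe `e¹, …, e⁷` dual to a frame `b`, as 1-forms (indices are `0, …, 6` in code). -/
noncomputable def coframe {V : Type*} [AddCommGroup V] [Module ℝ V] (b : Module.Basis (Fin 7) ℝ V)
    (i : Fin 7) : Forms V :=
  oneForm (b.coord i)

/-! ### Metric, norm and Hodge star for which a frame `b` is orthonormal and positively oriented -/

/-- The inner product on `V` for which `b` is orthonormal. -/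
noncomputable def frameMetric {V : Type*} [AddCommGroup V] [Module ℝ V]
    (b : Module.Basis (Fin 7) ℝ V) (x y : V) : ℝ :=
  ∑ i, b.coord i x * b.coord i y

/-- The metric dual (`♯`) of a covector. -/
noncomputable def sharp {V : Type*} [AddCommGroup V] [Module ℝ V] (b : Module.Basis (Fin 7) ℝ V) :
    Module.Dual ℝ V →ₗ[ℝ] V where
  toFun a := ∑ i, a (b i) • b i
  map_add' x y := by simp [add_smul, Finset.sum_add_distrib]
  map_smul' c x := by simp [mul_smul, Finset.smul_sum]

/-- Contraction by a form: `a₁ ∧ ⋯ ∧ aₖ` acts as `ι_{♯aₖ} ∘ ⋯ ∘ ι_{♯a₁}`. -/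
noncomputable def contraction {V : Type*} [AddCommGroup V] [Module ℝ V]
    (b : Module.Basis (Fin 7) ℝ V) : Forms V →ₐ[ℝ] (Module.End ℝ (Forms V))ᵐᵒᵖ :=
  ExteriorAlgebra.lift ℝ
    ⟨(MulOpposite.opLinearEquiv ℝ).toLinearMap ∘ₗ
        (CliffordAlgebra.contractLeft (Q := (0 : QuadraticForm ℝ (Module.Dual ℝ V))) ∘ₗ
          Module.Dual.eval ℝ V) ∘ₗ sharp b, fun a => by
      apply MulOpposite.unop_injective
      refine LinearMap.ext fun x => ?_
      exact CliffordAlgebra.contractLeft_contractLeft (Q := (0 : QuadraticForm ℝ (Module.Dual ℝ V)))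
        (d := Module.Dual.eval ℝ V (sharp b a)) x⟩

/-- The volume form `e¹ ∧ ⋯ ∧ e⁷`. -/
noncomputable def vol {V : Type*} [AddCommGroup V] [Module ℝ V] (b : Module.Basis (Fin 7) ℝ V) :
    Forms V :=
  coframe b 0 * coframe b 1 * coframe b 2 * coframe b 3 * coframe b 4 * coframe b 5 * coframe b 6

/-- The Hodge star, normalised by `α ∧ ⋆β = ⟨α, β⟩ vol`; for instance
`⋆(e¹ ∧ ⋯ ∧ eᵏ) = eᵏ⁺¹ ∧ ⋯ ∧ e⁷`. -/
noncomputable def hodge {V : Type*} [AddCommGroup V] [Module ℝ V] (b : Module.Basis (Fin 7) ℝ V)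
    (α : Forms V) : Forms V :=
  (contraction b α).unop (vol b)

/-- The inner product of forms: the monomials `e^{i₁} ∧ ⋯ ∧ e^{iₖ}`, `i₁ < ⋯ < iₖ`, are
orthonormal. -/
noncomputable def formInner {V : Type*} [AddCommGroup V] [Module ℝ V]
    (b : Module.Basis (Fin 7) ℝ V) (α β : Forms V) : ℝ :=
  ExteriorAlgebra.algebraMapInv ((contraction b α).unop β)

/-- The norm of a form. -/
noncomputable def formNorm {V : Type*} [AddCommGroup V] [Module ℝ V]
    (b : Module.Basis (Fin 7) ℝ V) (α : Forms V) : ℝ :=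
  Real.sqrt (formInner b α α)

/-! ### Linear `G₂`-structures -/

/-- The model `G₂` form
`e¹²⁷ + e³⁴⁷ + e⁵⁶⁷ + e¹³⁵ - e¹⁴⁶ - e²³⁶ - e²⁴⁵` in the coframe dual to `b`. -/
noncomputable def modelG2 {V : Type*} [AddCommGroup V] [Module ℝ V]
    (b : Module.Basis (Fin 7) ℝ V) : Forms V :=
  let e := coframe b
  e 0 * e 1 * e 6 + e 2 * e 3 * e 6 + e 4 * e 5 * e 6
    + e 0 * e 2 * e 4 - e 0 * e 3 * e 5 - e 1 * e 2 * e 5 - e 1 * e 3 * e 4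

/-- `b` is a `G₂`-frame of `φ`. A form `φ` is a `G₂` form iff it has such a frame. The induced
metric and orientation are those for which its `G₂`-frames are orthonormal and positive; they do
not depend on the `G₂`-frame, since two of them differ by an element of `G₂ ⊆ SO(7)`. Hence
`frameMetric b`, `formNorm b` and `hodge b` are the metric, norm and Hodge star of `φ`. -/
def IsG2Frame {V : Type*} [AddCommGroup V] [Module ℝ V] (φ : Forms V)
    (b : Module.Basis (Fin 7) ℝ V) : Prop :=
  φ = modelG2 b

/-! ### The exterior derivative of left-invariant forms -/

/-- The Chevalley–Eilenberg differential of the Lie algebra `L`, i.e. the exterior derivative on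
left-invariant forms: the antiderivation of degree `1` with `(da)(x, y) = -a([x, y])` on 1-forms,
written in the basis `B` as
`dα = ∑ₖ deᵏ ∧ ι_{eₖ} α`, with `deᵏ = -½ ∑ᵢⱼ eᵏ([eᵢ, eⱼ]) eⁱ ∧ eʲ`. -/
noncomputable def ceDifferential {L : Type*} [LieRing L] [LieAlgebra ℝ L]
    (B : Module.Basis (Fin 7) ℝ L) (α : Forms L) : Forms L :=
  ∑ k, ((-(1 / 2) : ℝ) • ∑ i, ∑ j, B.coord k ⁅B i, B j⁆ • (coframe B i * coframe B j)) *
    interiorProd (B k) α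

/-! ### The seven-dimensional Heisenberg algebra -/

/-- The Lie algebra of the seven-dimensional Heisenberg group. -/
def Heisenberg : Type := Fin 7 → ℝ

noncomputable instance : AddCommGroup Heisenberg := inferInstanceAs (AddCommGroup (Fin 7 → ℝ))

noncomputable instance : Module ℝ Heisenberg := inferInstanceAs (Module ℝ (Fin 7 → ℝ))

namespace Heisenberg

/-- The standard basis `e₁, …, e₇`. -/
noncomputable def stdBasis : Module.Basis (Fin 7) ℝ Heisenberg :=
  (Pi.basisFun ℝ (Fin 7) : Module.Basis (Fin 7) ℝ (Fin 7 → ℝ))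

/-- The vector `e₇`, which spans the centre `𝔷 = [𝔥, 𝔥]`. -/
noncomputable def center : Heisenberg := stdBasis 6

/-- The coefficient of `e₇` in the bracket. -/
noncomputable def bracketCoeff (x y : Heisenberg) : ℝ :=
  -(Real.sqrt 6 / 6) *
    ((x 0 * y 1 - x 1 * y 0) + (x 2 * y 3 - x 3 * y 2) + (x 4 * y 5 - x 5 * y 4))

theorem add_coe (x y : Heisenberg) (i : Fin 7) : (x + y) i = x i + y i := rfl

theorem smul_coe (c : ℝ) (x : Heisenberg) (i : Fin 7) : (c • x) i = c * x i := rfl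

theorem center_coe (i : Fin 7) : center i = if i = 6 then 1 else 0 := by
  show (Pi.basisFun ℝ (Fin 7)) 6 i = _
  simp [Pi.single_apply]

/-- The bracket `[e₁, e₂] = [e₃, e₄] = [e₅, e₆] = -(√6/6) e₇`, dual to
`de⁷ = (√6/6)(e¹² + e³⁴ + e⁵⁶)`. -/
noncomputable instance : Bracket Heisenberg Heisenberg :=
  ⟨fun x y => bracketCoeff x y • center⟩

theorem bracket_def (x y : Heisenberg) : ⁅x, y⁆ = bracketCoeff x y • center := rfl

theorem bracketCoeff_bracket_left (x y z : Heisenberg) : bracketCoeff ⁅x, y⁆ z = 0 := by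
  simp [bracketCoeff, bracket_def, smul_coe, center_coe]

theorem bracketCoeff_bracket_right (x y z : Heisenberg) : bracketCoeff x ⁅y, z⁆ = 0 := by
  simp [bracketCoeff, bracket_def, smul_coe, center_coe]

noncomputable instance : LieRing Heisenberg where
  add_lie x y z := by
    simp only [bracket_def, ← add_smul]
    congr 1
    simp only [bracketCoeff, add_coe]
    ring
  lie_add x y z := by
    simp only [bracket_def, ← add_smul]
    congr 1
    simp only [bracketCoeff, add_coe]
    ring
  lie_self x := by
    have h : bracketCoeff x x = 0 := by
      simp only [bracketCoeff]
      ring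
    rw [bracket_def, h, zero_smul]
  leibniz_lie x y z := by
    simp only [bracket_def _ ⁅_, _⁆, bracket_def ⁅_, _⁆ _, bracketCoeff_bracket_left,
      bracketCoeff_bracket_right, zero_smul, add_zero]

noncomputable instance : LieAlgebra ℝ Heisenberg where
  lie_smul c x y := by
    simp only [bracket_def, smul_smul]
    congr 1
    simp only [bracketCoeff, smul_coe]
    ring

/-- The exterior derivative on left-invariant forms of the Heisenberg group. -/
noncomputable def d (α : Forms Heisenberg) : Forms Heisenberg :=
  ceDifferential stdBasis α

/-- The codifferential: `d*α = (-1)ᵏ ⋆d⋆α` on `k`-forms (dimension seven). -/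
noncomputable def codiff (b : Module.Basis (Fin 7) ℝ Heisenberg) (α : Forms Heisenberg) :
    Forms Heisenberg :=
  hodge b (d (hodge b (CliffordAlgebra.involute α)))

/-- The Hodge Laplacian `Δ = d d* + d* d`. -/
noncomputable def laplacian (b : Module.Basis (Fin 7) ℝ Heisenberg) (α : Forms Heisenberg) :
    Forms Heisenberg :=
  d (codiff b α) + codiff b (d α)

/-- `ψ` is a left-invariant solution on `J` of the Laplacian coflow
`ψ' = -Δ_t ψ`, `dψ = 0`, `ψ(0) = ψ₀`, where `ψ(t) = ⋆_t φ(t)` for a `G₂` form `φ(t)`, and `⋆_t`,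
`Δ_t` are those of the metric of `φ(t)`. Since the space of forms is finite-dimensional, the time
derivative is taken through all linear functionals `ℓ`. -/
structure IsLaplacianCoflow (ψ₀ : Forms Heisenberg) (J : Set ℝ) (ψ : ℝ → Forms Heisenberg) :
    Prop where
  initial : ψ 0 = ψ₀
  solves : ∀ t ∈ J, ∃ (φ : Forms Heisenberg) (b : Module.Basis (Fin 7) ℝ Heisenberg),
    IsG2Frame φ b ∧ ψ t = hodge b φ ∧ d (ψ t) = 0 ∧
      ∀ ℓ : Module.Dual ℝ (Forms Heisenberg),
        HasDerivAt (fun s => ℓ (ψ s)) (ℓ (-laplacian b (ψ t))) t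

/-- `ψ` is the unique maximal solution, and its maximal interval of existence is `J`. -/
structure IsMaximalLaplacianCoflow (ψ₀ : Forms Heisenberg) (J : Set ℝ)
    (ψ : ℝ → Forms Heisenberg) : Prop where
  coflow : IsLaplacianCoflow ψ₀ J ψ
  maximal : ∀ (J' : Set ℝ) (ψ' : ℝ → Forms Heisenberg), IsOpen J' → J'.OrdConnected → 0 ∈ J' →
    IsLaplacianCoflow ψ₀ J' ψ' → J' ⊆ J ∧ Set.EqOn ψ' ψ J'

/-! ### The unit form `η` -/

/-- The unit vector `x₀ = e₇ / ‖e₇‖` of the centre. -/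
noncomputable def unitCenter (b : Module.Basis (Fin 7) ℝ Heisenberg) : Heisenberg :=
  (Real.sqrt (frameMetric b center center))⁻¹ • center

/-- The unit covector `η = g(x₀, ·)`, whose kernel is the orthogonal complement of the centre. -/
noncomputable def eta (b : Module.Basis (Fin 7) ℝ Heisenberg) : Module.Dual ℝ Heisenberg :=
  ∑ i, b.coord i (unitCenter b) • b.coord i

/-! ### Sanity lemmas: `d` is the antiderivation given by the structure equations -/

theorem stdBasis_coord (i : Fin 7) (x : Heisenberg) : stdBasis.coord i x = x i := by
  exact Pi.basisFun_repr (R := ℝ) (η := Fin 7) x i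

theorem stdBasis_coe (i j : Fin 7) : stdBasis i j = if j = i then 1 else 0 := by
  show (Pi.basisFun ℝ (Fin 7)) i j = _
  simp [Pi.single_apply]

/-- The 2-form `de⁷ = (√6/6)(e¹² + e³⁴ + e⁵⁶)`. -/
noncomputable def de7 : Forms Heisenberg :=
  let e := coframe stdBasis
  (Real.sqrt 6 / 6) • (e 0 * e 1 + e 2 * e 3 + e 4 * e 5)

theorem coframe_anticomm (b : Module.Basis (Fin 7) ℝ Heisenberg) (i j : Fin 7) :
    coframe b i * coframe b j = -(coframe b j * coframe b i) :=
  eq_neg_of_add_eq_zero_left (ExteriorAlgebra.ι_add_mul_swap _ _)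

theorem d_eq (α : Forms Heisenberg) : d α = de7 * interiorProd center α := by
  have h : ∀ k i j : Fin 7, stdBasis.coord k ⁅stdBasis i, stdBasis j⁆ =
      if k = 6 then bracketCoeff (stdBasis i) (stdBasis j) else 0 := by
    intro k i j
    rw [stdBasis_coord, bracket_def, smul_coe, center_coe]
    simp
  rw [d, ceDifferential, Finset.sum_eq_single 6]
  · congr 1
    simp only [h, if_true, Fin.sum_univ_seven, bracketCoeff, stdBasis_coe]
    simp [de7, coframe_anticomm stdBasis 1 0, coframe_anticomm stdBasis 3 2,
      coframe_anticomm stdBasis 5 4]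
    module
  · intro k _ hk
    simp [h, hk]
  · simp

/-- `de¹ = ⋯ = de⁶ = 0` and `de⁷ = (√6/6)(e¹² + e³⁴ + e⁵⁶)`. -/
theorem d_coframe (i : Fin 7) : d (coframe stdBasis i) = if i = 6 then de7 else 0 := by
  rw [d_eq, coframe, interiorProd, CliffordAlgebra.contractLeft_ι, Module.Dual.eval_apply,
    stdBasis_coord, center_coe]
  split <;> simp

end Heisenberg

/-! Every left-invariant form satisfies dα = de⁷ ∧ ι_{e₇}α, so a G₂ structure enters its own
Laplacian only through the length of e₇ and the position of the fixed 2-form de⁷ relative to the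
induced SU(3) structure (ω, ρ̂) on 𝔷^⊥. A G₂ rotation puts e₇ along the last frame vector, with e₇ =
r e and ψ = ½ω² + ρ̂ ∧ η. Closedness of ψ then says de⁷ ∧ ρ̂ = 0, that is, de⁷ has type (1,1), and
SU(3) diagonalises it (`exists_isDiagonalFrame`). The eigenvalues νⱼ are nonzero because the radical
of the bracket is the centre. In such a frame -Δψ = r²(de⁷ ∧ de⁷ - (ν₁+ν₂+ν₃) ω ∧ de⁷), a diagonal
4-form on 𝔷^⊥.

Existence. Rescaling the three planes of a diagonal frame, and the central covector so that ρ̂ ∧ η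
stays fixed, gives a family of diagonal structures; inside it the coflow is the system for λ₁, λ₂,
λ₃ (`isLaplacianCoflow_diagonalPsi`). For V = λ₁λ₂λ₃ one has V' = -½(Σ(λᵢλⱼ)² + (n₁λ₂λ₃ + n₂λ₁λ₃ +
n₃λ₁λ₂)²)/V². With AM-GM, V^{5/3} decreases at rate at least 5/2, so the solution stops by time
(2/5)V(0)^{5/3}, which is below the stated bound. Backwards, V is bounded below, hence each 1/λⱼ
grows at most linearly; the λⱼ stay away from 0, their derivatives are bounded, and the solution
cannot stop at a finite negative time (`exists_ancient_diagonal_solution`).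

Uniqueness. Another solution may, a priori, be diagonal in a different frame at each time. Two
quantities are conserved along any solution: ι_{e₇}ψ, which fixes ρ̂ up to scale, and ψ ∧ ι_vρ̂,
which then fixes η up to scale. Hence only the 15 coefficients of ½ω² move. The Pfaffian recovers r,
ω and the trace of de⁷ from them well enough to write the coflow as an autonomous C¹ equation
(`exists_reducedField`, `IsLaplacianCoflow.exists_solvesOn`), and uniqueness is that of
Picard–Lindelöf. A solution defined at T would give the λⱼ positive limits there, contrary to the
maximality of the diagonal solution (`isMaximalLaplacianCoflow_diagonalPsi`). -/

set_option linter.unusedSimpArgs false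

/-! ### Exterior calculus in a frame: reordering of monomials, contractions, Hodge star. -/

section FrameAlgebra

variable {V : Type*} [AddCommGroup V] [Module ℝ V] (b : Module.Basis (Fin 7) ℝ V)

theorem coframe_mul_swap {i j : Fin 7} (_h : i < j) :
    coframe b j * coframe b i = -(coframe b i * coframe b j) :=
  eq_neg_of_add_eq_zero_left (ExteriorAlgebra.ι_add_mul_swap _ _)

theorem coframe_mul_self (i : Fin 7) : coframe b i * coframe b i = 0 :=
  ExteriorAlgebra.ι_sq_zero _

theorem coframe_mul_swap_assoc {i j : Fin 7} (h : i < j) (x : Forms V) :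
    coframe b j * (coframe b i * x) = -(coframe b i * (coframe b j * x)) := by
  rw [← mul_assoc, coframe_mul_swap b h, neg_mul, mul_assoc]

theorem coframe_mul_self_assoc (i : Fin 7) (x : Forms V) :
    coframe b i * (coframe b i * x) = 0 := by
  rw [← mul_assoc, coframe_mul_self, zero_mul]

theorem interiorProd_coframe_mul (v : V) (i : Fin 7) (x : Forms V) :
    interiorProd v (coframe b i * x) = b.coord i v • x - coframe b i * interiorProd v x :=
  CliffordAlgebra.contractLeft_ι_mul _ _ _

theorem interiorProd_coframe (v : V) (i : Fin 7) :
    interiorProd v (coframe b i) = algebraMap ℝ (Forms V) (b.coord i v) :=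
  CliffordAlgebra.contractLeft_ι _ _ _

theorem interiorProd_algebraMap (v : V) (r : ℝ) :
    interiorProd v (algebraMap ℝ (Forms V) r) = 0 :=
  CliffordAlgebra.contractLeft_algebraMap _ _ _

theorem interiorProd_one (v : V) : interiorProd v (1 : Forms V) = 0 :=
  CliffordAlgebra.contractLeft_one _ _

theorem coord_basis (i j : Fin 7) : b.coord i (b j) = if j = i then 1 else 0 := by
  simp [Finsupp.single_apply]

theorem sharp_coord (i : Fin 7) : sharp b (b.coord i) = b i := by
  simp [sharp, Finsupp.single_apply]

theorem contraction_coframe (i : Fin 7) (x : Forms V) :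
    (contraction b (coframe b i)).unop x = interiorProd (b i) x := by
  have : contraction b (coframe b i) = _ := ExteriorAlgebra.lift_ι_apply ℝ _ _ _
  rw [this]
  simp only [LinearMap.comp_apply, sharp_coord]
  rfl

theorem contraction_mul_apply (x y z : Forms V) :
    (contraction b (x * y)).unop z = (contraction b y).unop ((contraction b x).unop z) := by
  rw [map_mul]; rfl

theorem hodge_modelG2 : hodge b (modelG2 b) =
    coframe b 2 * coframe b 3 * coframe b 4 * coframe b 5
    + coframe b 0 * coframe b 1 * coframe b 4 * coframe b 5
    + coframe b 0 * coframe b 1 * coframe b 2 * coframe b 3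
    + (-(coframe b 1 * coframe b 3 * coframe b 5) + coframe b 0 * coframe b 2 * coframe b 5
      + coframe b 0 * coframe b 3 * coframe b 4 + coframe b 1 * coframe b 2 * coframe b 4) * coframe b 6 := by
  simp only [hodge, modelG2, vol, map_add, map_sub, contraction_mul_apply, contraction_coframe, mul_assoc,
    MulOpposite.unop_add, MulOpposite.unop_sub, LinearMap.add_apply, LinearMap.sub_apply, map_neg, neg_smul,
    interiorProd_coframe_mul, interiorProd_coframe, interiorProd_algebraMap, interiorProd_one, coord_basis, Fin.reduceEq, if_true, if_false,
    one_smul, zero_smul, zero_sub, sub_zero, mul_neg, mul_zero, neg_zero, map_zero, mul_sub, mul_one, sub_self, zero_add, add_zero,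
    map_one, add_mul, neg_mul, neg_neg,
    coframe_mul_swap, coframe_mul_swap_assoc, Fin.reduceLT]
  abel

end FrameAlgebra

/-! ### Double plane rotations lying in G₂. -/

section Rotations

variable {V : Type*} [AddCommGroup V] [Module ℝ V] (b b' : Module.Basis (Fin 7) ℝ V)

theorem exists_basis_of_dual {ι : Type*} [Fintype ι] [DecidableEq ι] (b : Module.Basis ι ℝ V)
    (e : ι → V) (a : ι → Module.Dual ℝ V) (h : ∀ i j, a i (e j) = if i = j then 1 else 0) :
    ∃ b' : Module.Basis ι ℝ V, (∀ i, b' i = e i) ∧ ∀ i, b'.coord i = a i := by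
  have hli : LinearIndependent ℝ e := by
    rw [Fintype.linearIndependent_iff]
    intro g hg i
    have := congrArg (a i) hg
    simpa [h] using this
  have : Module.Finite ℝ V := Module.Finite.of_basis b
  let b' := basisOfLinearIndependentOfCardEqFinrank' e hli (Module.finrank_eq_card_basis b).symm
  have he : ∀ i, b' i = e i := fun i => by simp [b']
  refine ⟨b', he, fun i => b'.ext fun j => ?_⟩
  rw [he j, h i j, ← he j]
  simp [Finsupp.single_apply, eq_comm]

/-- `b'` is obtained from `b` by rotating the planes `(i, j)` and `(k, l)` by the same angle, with
cosine `c` and sine `s`. -/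
structure IsDoubleRotation (i j k l : Fin 7) (c s : ℝ) : Prop where
  unit : c ^ 2 + s ^ 2 = 1
  basis : ∀ m, b' m = if m = i then c • b i + s • b j else if m = j then -s • b i + c • b j
    else if m = k then c • b k + s • b l else if m = l then -s • b k + c • b l else b m
  coord : ∀ m x, b'.coord m x = if m = i then c * b.coord i x + s * b.coord j x
    else if m = j then -s * b.coord i x + c * b.coord j x
    else if m = k then c * b.coord k x + s * b.coord l x
    else if m = l then -s * b.coord k x + c * b.coord l x else b.coord m x
  coframe : ∀ m, coframe b' m = if m = i then c • coframe b i + s • coframe b j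
    else if m = j then -s • coframe b i + c • coframe b j
    else if m = k then c • coframe b k + s • coframe b l
    else if m = l then -s • coframe b k + c • coframe b l else coframe b m

theorem exists_isDoubleRotation {i j k l : Fin 7} (hd : [i, j, k, l].Nodup) {c s : ℝ}
    (h : c ^ 2 + s ^ 2 = 1) : ∃ b', IsDoubleRotation b b' i j k l c s := by
  simp only [List.nodup_cons, List.mem_cons, List.not_mem_nil, or_false, not_or] at hd
  obtain ⟨⟨h1, h2, h3⟩, ⟨h4, h5⟩, h6, -⟩ := hd
  obtain ⟨b', he, ha⟩ := exists_basis_of_dual b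
    (fun m => if m = i then c • b i + s • b j else if m = j then -s • b i + c • b j
      else if m = k then c • b k + s • b l else if m = l then -s • b k + c • b l else b m)
    (fun m => if m = i then c • b.coord i + s • b.coord j
      else if m = j then -s • b.coord i + c • b.coord j
      else if m = k then c • b.coord k + s • b.coord l
      else if m = l then -s • b.coord k + c • b.coord l else b.coord m) (by
    intro m n
    have e1 : c * c + s * s = 1 := by linarith
    have e2 : s * s + c * c = 1 := by linarith
    have e3 : -(c * s) + s * c = 0 := by ring
    have e4 : -(s * c) + c * s = 0 := by ring
    split_ifs <;> subst_vars <;>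
      simp_all [Finsupp.single_apply, eq_comm])
  refine ⟨b', h, he, fun m x => ?_, fun m => ?_⟩
  · rw [ha]; split_ifs <;> simp
  · rw [coframe, ha]; split_ifs <;> simp [coframe, oneForm]

/-- The frames `b` and `b'` induce the same `G₂` form, metric and orientation. -/
structure SameG2 : Prop where
  model : modelG2 b' = modelG2 b
  vol : vol b' = vol b
  sharp : sharp b' = sharp b
  metric : frameMetric b' = frameMetric b

variable {b b'}

theorem SameG2.trans {b'' : Module.Basis (Fin 7) ℝ V} (h : SameG2 b b') (h' : SameG2 b' b'') :
    SameG2 b b'' :=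
  ⟨h'.1.trans h.1, h'.2.trans h.2, h'.3.trans h.3, h'.4.trans h.4⟩

theorem SameG2.contraction (h : SameG2 b b') : contraction b' = contraction b := by
  simp only [_root_.contraction, h.sharp]

theorem SameG2.hodge (h : SameG2 b b') : hodge b' = hodge b := by
  funext α
  simp only [_root_.hodge, h.contraction, h.vol]

/-- The metric determines the musical isomorphism through g(♯a, y) = a(y), whatever orthonormal
frame is used to write it. -/
theorem sharp_eq_of_frameMetric_eq (h : frameMetric b' = frameMetric b) : sharp b' = sharp b := by
  have key : ∀ (b : Module.Basis (Fin 7) ℝ V) (a : Module.Dual ℝ V) (y : V),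
      frameMetric b (sharp b a) y = a y := by
    intro b a y
    have hy : a y = ∑ i, b.repr y i * a (b i) := by
      conv_lhs => rw [← b.sum_repr y]
      simp only [map_sum, map_smul, smul_eq_mul]
    rw [hy]
    simp [frameMetric, sharp, Finsupp.single_apply, mul_comm]
  refine LinearMap.ext fun a => b.repr.injective (Finsupp.ext fun i => ?_)
  have h1 := key b' a (b i)
  have h2 := key b a (b i)
  rw [h] at h1
  simpa [frameMetric, Finsupp.single_apply] using h1.trans h2.symm

set_option maxHeartbeats 1000000 in
-- For the cross product of `modelG2`, each listed quadruple satisfies bᵢ × bⱼ + bₖ × bₗ = 0. This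
-- is the condition for eⁱʲ + eᵏˡ to lie in the Lie algebra 𝔤₂, so the two planes may be turned
-- together by any angle. These seven one-parameter groups are all that the normal forms below need.
theorem IsDoubleRotation.sameG2 {i j k l : Fin 7} {c s : ℝ}
    (hr : IsDoubleRotation b b' i j k l c s)
    (ht : (i, j, k, l) ∈ [((0, 6, 5, 2) : Fin 7 × Fin 7 × Fin 7 × Fin 7), (1, 6, 3, 5),
      (2, 3, 1, 0), (4, 5, 1, 0), (2, 4, 3, 5), (5, 6, 1, 3), (0, 2, 1, 3)]) : SameG2 b b' := by
  have h := hr.unit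
  suffices hs : modelG2 b' = modelG2 b ∧ _root_.vol b' = _root_.vol b ∧
      frameMetric b' = frameMetric b from
    ⟨hs.1, hs.2.1, sharp_eq_of_frameMetric_eq hs.2.2, hs.2.2⟩
  simp only [List.mem_cons, Prod.mk.injEq, List.not_mem_nil, or_false] at ht
  rcases ht with ⟨rfl, rfl, rfl, rfl⟩ | ⟨rfl, rfl, rfl, rfl⟩ | ⟨rfl, rfl, rfl, rfl⟩ |
    ⟨rfl, rfl, rfl, rfl⟩ | ⟨rfl, rfl, rfl, rfl⟩ | ⟨rfl, rfl, rfl, rfl⟩ | ⟨rfl, rfl, rfl, rfl⟩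
  all_goals
    refine ⟨?_, ?_, ?_⟩
    · simp only [modelG2, hr.coframe, Fin.reduceEq, if_true, if_false]
      simp only [add_mul, mul_add, smul_mul_assoc, mul_smul_comm, mul_assoc, coframe_mul_swap,
        coframe_mul_swap_assoc, coframe_mul_self, coframe_mul_self_assoc, Fin.reduceLT, smul_neg,
        smul_zero, mul_neg, neg_mul, neg_neg, mul_zero, zero_mul, add_zero, zero_add, smul_add]
      match_scalars <;> first | ring1 | linear_combination h | linear_combination -h
    · simp only [_root_.vol, hr.coframe, Fin.reduceEq, if_true, if_false]
      simp only [add_mul, mul_add, smul_mul_assoc, mul_smul_comm, mul_assoc, coframe_mul_swap,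
        coframe_mul_swap_assoc, coframe_mul_self, coframe_mul_self_assoc, Fin.reduceLT, smul_neg,
        smul_zero, mul_neg, neg_mul, neg_neg, mul_zero, zero_mul, add_zero, zero_add, smul_add]
      match_scalars
      linear_combination (c ^ 2 + s ^ 2 + 1) * h
    · funext x y
      simp only [frameMetric, Fin.sum_univ_seven, hr.coord, Fin.reduceEq, if_true, if_false]
      generalize b.coord = B
      first
      | linear_combination (B 0 x * B 0 y + B 6 x * B 6 y + B 5 x * B 5 y + B 2 x * B 2 y) * h
      | linear_combination (B 1 x * B 1 y + B 6 x * B 6 y + B 3 x * B 3 y + B 5 x * B 5 y) * h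
      | linear_combination (B 2 x * B 2 y + B 3 x * B 3 y + B 1 x * B 1 y + B 0 x * B 0 y) * h
      | linear_combination (B 4 x * B 4 y + B 5 x * B 5 y + B 1 x * B 1 y + B 0 x * B 0 y) * h
      | linear_combination (B 2 x * B 2 y + B 4 x * B 4 y + B 3 x * B 3 y + B 5 x * B 5 y) * h

end Rotations

/-! ### Moving a given vector onto the last frame vector. -/

section Transitivity

variable {V : Type*} [AddCommGroup V] [Module ℝ V] {b : Module.Basis (Fin 7) ℝ V}

theorem exists_rotation_left_eq_zero (x y : ℝ) :
    ∃ c s : ℝ, c ^ 2 + s ^ 2 = 1 ∧ c * x + s * y = 0 ∧ 0 ≤ -s * x + c * y := by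
  by_cases h : x ^ 2 + y ^ 2 = 0
  · have hx : x = 0 := by nlinarith [sq_nonneg x, sq_nonneg y]
    have hy : y = 0 := by nlinarith [sq_nonneg x, sq_nonneg y]
    exact ⟨1, 0, by simp, by simp [hx], by simp [hy]⟩
  · have h0 : 0 < x ^ 2 + y ^ 2 := lt_of_le_of_ne (by positivity) (Ne.symm h)
    have hr := Real.sqrt_pos.2 h0
    have hs := Real.sq_sqrt h0.le
    set r := Real.sqrt (x ^ 2 + y ^ 2)
    refine ⟨y / r, -x / r, ?_, by ring, ?_⟩
    · field_simp; linarith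
    · have : -(-x / r) * x + y / r * y = (x ^ 2 + y ^ 2) / r := by ring
      rw [this]; positivity

theorem exists_rotation_right_eq_zero (x y : ℝ) :
    ∃ c s : ℝ, c ^ 2 + s ^ 2 = 1 ∧ -s * x + c * y = 0 ∧ 0 ≤ c * x + s * y := by
  obtain ⟨c, s, h, h1, h2⟩ := exists_rotation_left_eq_zero y x
  exact ⟨c, -s, by linarith [neg_sq s], by linarith, by linarith⟩

/-- `G₂` acts transitively on the rays of `V`. -/
theorem exists_sameG2_eq_smul {x : V} (hx : x ≠ 0) :
    ∃ (b' : Module.Basis (Fin 7) ℝ V) (r : ℝ), SameG2 b b' ∧ 0 < r ∧ x = r • b' 6 := by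
  have step : ∀ (b : Module.Basis (Fin 7) ℝ V) (i j k l : Fin 7), [i, j, k, l].Nodup →
      (i, j, k, l) ∈ [((0, 6, 5, 2) : Fin 7 × Fin 7 × Fin 7 × Fin 7), (1, 6, 3, 5),
      (2, 3, 1, 0), (4, 5, 1, 0), (2, 4, 3, 5), (5, 6, 1, 3), (0, 2, 1, 3)] →
      (∃ b' c s, SameG2 b b' ∧ IsDoubleRotation b b' i j k l c s ∧
        b'.coord i x = 0 ∧ 0 ≤ b'.coord j x) := by
    intro b i j k l hd ht
    obtain ⟨c, s, h, h1, h2⟩ := exists_rotation_left_eq_zero (b.coord i x) (b.coord j x)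
    obtain ⟨b', hb⟩ := exists_isDoubleRotation b hd h
    refine ⟨b', c, s, hb.sameG2 ht, hb, ?_, ?_⟩
    · rw [hb.coord, if_pos rfl, h1]
    · rw [hb.coord, if_pos rfl, if_neg (by aesop)]; exact h2
  -- Here the angle is chosen from the second plane of the double rotation: it kills coordinate 3,
  -- while coordinates 2 and 4, already zero when this is applied, stay zero.
  have step' : ∀ (b : Module.Basis (Fin 7) ℝ V),
      (∃ b' c s, SameG2 b b' ∧ IsDoubleRotation b b' 2 4 3 5 c s ∧ b'.coord 3 x = 0) := by
    intro b
    obtain ⟨c, s, h, h1, h2⟩ := exists_rotation_left_eq_zero (b.coord 3 x) (b.coord 5 x)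
    obtain ⟨b', hb⟩ := exists_isDoubleRotation (i := 2) (j := 4) (k := 3) (l := 5) b (by decide) h
    refine ⟨b', c, s, hb.sameG2 (by decide), hb, ?_⟩
    rw [hb.coord]; simpa using h1
  -- The coordinates are killed in the order 0, 1, 2, 4, 3, 5. The order is such that each rotation
  -- mixes a vanished coordinate only with another vanished one.
  obtain ⟨b1, c1, s1, g1, r1, z1, -⟩ := step b 0 6 5 2 (by decide) (by decide)
  obtain ⟨b2, c2, s2, g2, r2, z2, -⟩ := step b1 1 6 3 5 (by decide) (by decide)
  have z20 : b2.coord 0 x = 0 := by rw [r2.coord]; simpa using z1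
  obtain ⟨b3, c3, s3, g3, r3, z3, -⟩ := step b2 2 3 1 0 (by decide) (by decide)
  have z30 : b3.coord 0 x = 0 := by
    simp only [r3.coord, Fin.reduceEq, if_true, if_false, z20, z2, mul_zero, add_zero]
  have z31 : b3.coord 1 x = 0 := by
    simp only [r3.coord, Fin.reduceEq, if_true, if_false, z20, z2, mul_zero, add_zero]
  obtain ⟨b4, c4, s4, g4, r4, z4, -⟩ := step b3 4 5 1 0 (by decide) (by decide)
  have z40 : b4.coord 0 x = 0 := by
    simp only [r4.coord, Fin.reduceEq, if_true, if_false, z30, z31, z3, mul_zero, add_zero]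
  have z41 : b4.coord 1 x = 0 := by
    simp only [r4.coord, Fin.reduceEq, if_true, if_false, z30, z31, z3, mul_zero, add_zero]
  have z42 : b4.coord 2 x = 0 := by
    simp only [r4.coord, Fin.reduceEq, if_true, if_false, z30, z31, z3, mul_zero, add_zero]
  obtain ⟨b5, c5, s5, g5, r5, z5⟩ := step' b4
  have z50 : b5.coord 0 x = 0 := by
    simp only [r5.coord, Fin.reduceEq, if_true, if_false, z40, z41, z42, z4, mul_zero, add_zero]
  have z51 : b5.coord 1 x = 0 := by
    simp only [r5.coord, Fin.reduceEq, if_true, if_false, z40, z41, z42, z4, mul_zero, add_zero]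
  have z52 : b5.coord 2 x = 0 := by
    simp only [r5.coord, Fin.reduceEq, if_true, if_false, z40, z41, z42, z4, mul_zero, add_zero]
  have z54 : b5.coord 4 x = 0 := by
    simp only [r5.coord, Fin.reduceEq, if_true, if_false, z40, z41, z42, z4, mul_zero, add_zero]
  obtain ⟨b6, c6, s6, g6, r6, z6, hpos⟩ := step b5 5 6 1 3 (by decide) (by decide)
  have z60 : b6.coord 0 x = 0 := by
    simp only [r6.coord, Fin.reduceEq, if_true, if_false, z50, z51, z52, z54, z5, mul_zero, add_zero]
  have z61 : b6.coord 1 x = 0 := by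
    simp only [r6.coord, Fin.reduceEq, if_true, if_false, z50, z51, z52, z54, z5, mul_zero, add_zero]
  have z62 : b6.coord 2 x = 0 := by
    simp only [r6.coord, Fin.reduceEq, if_true, if_false, z50, z51, z52, z54, z5, mul_zero, add_zero]
  have z63 : b6.coord 3 x = 0 := by
    simp only [r6.coord, Fin.reduceEq, if_true, if_false, z50, z51, z52, z54, z5, mul_zero, add_zero]
  have z64 : b6.coord 4 x = 0 := by
    simp only [r6.coord, Fin.reduceEq, if_true, if_false, z50, z51, z52, z54, z5, mul_zero, add_zero]
  have hxr : x = b6.coord 6 x • b6 6 := by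
    refine (b6.sum_repr x).symm.trans ?_
    simp only [← Module.Basis.coord_apply, Fin.sum_univ_seven, z60, z61, z62, z63, z64, z6,
      zero_smul, zero_add]
  refine ⟨b6, b6.coord 6 x, ((((g1.trans g2).trans g3).trans g4).trans g5).trans g6,
    lt_of_le_of_ne hpos fun h => hx ?_, hxr⟩
  rw [hxr, ← h, zero_smul]

end Transitivity

/-! ### The bracket form in an arbitrary frame, and the meaning of coclosedness. -/

namespace Heisenberg

theorem center_ne_zero : center ≠ 0 := fun h => by
  have := congrFun h 6
  rw [center_coe] at this
  simp at this
  exact one_ne_zero this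

/-- The coefficient of the bracket as a bilinear form; it is minus the 2-form `de⁷`. -/
noncomputable def bracketForm : Heisenberg →ₗ[ℝ] Heisenberg →ₗ[ℝ] ℝ :=
  LinearMap.mk₂ ℝ bracketCoeff
    (fun x x' y => by simp only [bracketCoeff, add_coe]; ring)
    (fun r x y => by simp only [bracketCoeff, smul_coe, smul_eq_mul]; ring)
    (fun x y y' => by simp only [bracketCoeff, add_coe]; ring)
    (fun r x y => by simp only [bracketCoeff, smul_coe, smul_eq_mul]; ring)

theorem bracketForm_apply (x y : Heisenberg) : bracketForm x y = bracketCoeff x y := rfl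

theorem bracketForm_swap (x y : Heisenberg) : bracketForm x y = -bracketForm y x := by
  simp only [bracketForm_apply, bracketCoeff]; ring

theorem bracketForm_self (x : Heisenberg) : bracketForm x x = 0 := by
  linarith [bracketForm_swap x x]

theorem bracketForm_center_left (x : Heisenberg) : bracketForm center x = 0 := by
  simp [bracketForm_apply, bracketCoeff, center_coe]

theorem bracketForm_center_right (x : Heisenberg) : bracketForm x center = 0 := by
  rw [bracketForm_swap, bracketForm_center_left, neg_zero]

/-- The radical of the bracket is no larger than the centre; this is what makes the eigenvalues of
de⁷ nonzero. -/
theorem eq_smul_center_of_bracketForm_eq_zero {x : Heisenberg} (h : bracketForm x = 0) :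
    x = x 6 • center := by
  have hs : Real.sqrt 6 ≠ 0 := by positivity
  have key : ∀ j, bracketCoeff x (stdBasis j) = 0 := fun j => LinearMap.congr_fun h (stdBasis j)
  funext i
  show _ = (x 6 • center) i
  rw [smul_coe, center_coe]
  have h0 := key 0
  have h1 := key 1
  have h2 := key 2
  have h3 := key 3
  have h4 := key 4
  have h5 := key 5
  simp only [bracketCoeff, stdBasis_coe] at h0 h1 h2 h3 h4 h5
  fin_cases i <;> simp_all

variable (b : Module.Basis (Fin 7) ℝ Heisenberg)

theorem coframe_stdBasis_eq_sum (i : Fin 7) :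
    coframe stdBasis i = ∑ j, (b j) i • coframe b j := by
  have h : stdBasis.coord i = ∑ j, (b j) i • b.coord j := b.ext fun k => by
    rw [stdBasis_coord]
    simp [Finsupp.single_apply]
  simp [coframe, oneForm, h]

theorem de7_eq_sum : de7 = ∑ i, ∑ j, (-(1 / 2) * bracketForm (b i) (b j)) •
    (coframe b i * coframe b j) := by
  have h : ∀ p q : Fin 7, coframe stdBasis p * coframe stdBasis q =
      ∑ i, ∑ j, ((1 / 2) * ((b i) p * (b j) q - (b i) q * (b j) p)) •
        (coframe b i * coframe b j) := by
    intro p q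
    have h1 : coframe stdBasis p * coframe stdBasis q =
      ∑ i, ∑ j, ((b i) p * (b j) q) • (coframe b i * coframe b j) := by
      rw [coframe_stdBasis_eq_sum b p, coframe_stdBasis_eq_sum b q, Finset.sum_mul]
      simp only [Finset.mul_sum, smul_mul_assoc, mul_smul_comm, smul_smul]
      refine Finset.sum_congr rfl fun i _ => Finset.sum_congr rfl fun j _ => ?_
      rw [mul_comm ((b j) q)]
    -- The same product with the summation indices exchanged; averaging the two expansions
    -- antisymmetrises the coefficients.
    have h2 : coframe stdBasis p * coframe stdBasis q =
      ∑ i, ∑ j, (-((b i) q * (b j) p)) • (coframe b i * coframe b j) := by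
      rw [h1, Finset.sum_comm]
      refine Finset.sum_congr rfl fun i _ => Finset.sum_congr rfl fun j _ => ?_
      rw [coframe_anticomm b j i, smul_neg, neg_smul, mul_comm ((b i) q)]
    have : coframe stdBasis p * coframe stdBasis q = (1 / 2 : ℝ) •
      (coframe stdBasis p * coframe stdBasis q + coframe stdBasis p * coframe stdBasis q) := by
      module
    rw [this]
    nth_rw 1 [h1]
    rw [h2]
    simp only [← Finset.sum_add_distrib, Finset.smul_sum, ← add_smul, smul_smul]
    refine Finset.sum_congr rfl fun i _ => Finset.sum_congr rfl fun j _ => ?_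
    congr 1
  simp only [de7, h, ← Finset.sum_add_distrib, Finset.smul_sum, ← add_smul, smul_smul]
  refine Finset.sum_congr rfl fun i _ => Finset.sum_congr rfl fun j _ => ?_
  rw [bracketForm_apply, bracketCoeff]
  congr 1
  ring

end Heisenberg

/-- Contracting with the five vectors dual to one monomial isolates its coefficient. It is used to
read off components of de⁷ ∧ ρ̂. -/
theorem eq_zero_of_fiveForm_eq_zero {V : Type*} [AddCommGroup V] [Module ℝ V]
    (b : Module.Basis (Fin 7) ℝ V) {c₀ c₁ c₂ c₃ c₄ c₅ : ℝ}
    (h : c₀ • (coframe b 1 * coframe b 2 * coframe b 3 * coframe b 4 * coframe b 5)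
      + c₁ • (coframe b 0 * coframe b 2 * coframe b 3 * coframe b 4 * coframe b 5)
      + c₂ • (coframe b 0 * coframe b 1 * coframe b 3 * coframe b 4 * coframe b 5)
      + c₃ • (coframe b 0 * coframe b 1 * coframe b 2 * coframe b 4 * coframe b 5)
      + c₄ • (coframe b 0 * coframe b 1 * coframe b 2 * coframe b 3 * coframe b 5)
      + c₅ • (coframe b 0 * coframe b 1 * coframe b 2 * coframe b 3 * coframe b 4) = 0) :
    c₀ = 0 ∧ c₁ = 0 ∧ c₂ = 0 ∧ c₃ = 0 ∧ c₄ = 0 ∧ c₅ = 0 := by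
  have key : ∀ i j k l m : Fin 7, interiorProd (b i) (interiorProd (b j) (interiorProd (b k)
      (interiorProd (b l) (interiorProd (b m) _)))) = _ := fun i j k l m => congrArg (fun x =>
        interiorProd (b i) (interiorProd (b j) (interiorProd (b k)
          (interiorProd (b l) (interiorProd (b m) x))))) h
  have k0 := key 5 4 3 2 1
  have k1 := key 5 4 3 2 0
  have k2 := key 5 4 3 1 0
  have k3 := key 5 4 2 1 0
  have k4 := key 5 3 2 1 0
  have k5 := key 4 3 2 1 0
  clear h key
  simp only [map_add, map_neg, map_smul, mul_assoc,
    interiorProd_coframe_mul, interiorProd_coframe, coord_basis, Fin.reduceEq, if_true, if_false,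
    zero_smul, zero_sub, sub_zero, one_smul, map_zero, map_one, interiorProd_one, mul_zero,
    smul_zero, neg_zero, add_zero, zero_add, mul_one, mul_neg, neg_neg, smul_neg,
    smul_eq_zero_iff_left (one_ne_zero (α := Forms V))] at k0 k1 k2 k3 k4 k5
  exact ⟨k0, k1, k2, k3, k4, k5⟩

namespace Heisenberg

variable {b b' : Module.Basis (Fin 7) ℝ Heisenberg} {r : ℝ}

theorem center_coord (hc : center = r • b 6) (i : Fin 7) :
    b.coord i center = if i = 6 then r else 0 := by
  rw [hc, map_smul, coord_basis]
  simp [eq_comm]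

theorem bracketForm_basis_six (hr : r ≠ 0) (hc : center = r • b 6) (x : Heisenberg) :
    bracketForm x (b 6) = 0 := by
  have := bracketForm_center_right x
  rw [hc, map_smul, smul_eq_mul] at this
  exact (mul_eq_zero.1 this).resolve_left hr

theorem bracketForm_six_basis (hr : r ≠ 0) (hc : center = r • b 6) (x : Heisenberg) :
    bracketForm (b 6) x = 0 := by
  rw [bracketForm_swap, bracketForm_basis_six hr hc, neg_zero]

/-- Only the term ρ̂ ∧ e⁷ of ψ survives contraction with the centre, so dψ is a multiple of de⁷ ∧
ρ̂. -/
theorem d_hodge_modelG2 (hc : center = r • b 6) :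
    d (hodge b (modelG2 b)) = (-r) • (de7 * (-(coframe b 1 * coframe b 3 * coframe b 5)
      + coframe b 0 * coframe b 2 * coframe b 5 + coframe b 0 * coframe b 3 * coframe b 4
      + coframe b 1 * coframe b 2 * coframe b 4)) := by
  rw [d_eq, hodge_modelG2, ← mul_smul_comm]
  congr 1
  simp only [map_add, map_neg, mul_assoc, interiorProd_coframe_mul, interiorProd_coframe,
    center_coord hc, Fin.reduceEq, if_true, if_false, zero_smul, zero_sub, mul_neg, neg_neg,
    map_zero, mul_zero, neg_zero, add_zero, zero_add, Algebra.algebraMap_eq_smul_one,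
    mul_smul_comm, mul_one, add_mul, neg_mul]
  module

set_option maxHeartbeats 1000000 in
/-- Coclosed `G₂` structures: `de⁷` has type `(1, 1)`. -/
theorem bracketForm_of_closed (hr : r ≠ 0) (hc : center = r • b 6)
    (h : d (hodge b (modelG2 b)) = 0) :
    bracketForm (b 0) (b 2) = bracketForm (b 1) (b 3) ∧
    bracketForm (b 0) (b 3) = -bracketForm (b 1) (b 2) ∧
    bracketForm (b 0) (b 4) = bracketForm (b 1) (b 5) ∧
    bracketForm (b 0) (b 5) = -bracketForm (b 1) (b 4) ∧
    bracketForm (b 2) (b 4) = bracketForm (b 3) (b 5) ∧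
    bracketForm (b 2) (b 5) = -bracketForm (b 3) (b 4) := by
  rw [d_hodge_modelG2 hc, neg_smul, neg_eq_zero, smul_eq_zero_iff_right hr, de7_eq_sum b] at h
  simp only [Fin.sum_univ_seven, bracketForm_basis_six hr hc, bracketForm_six_basis hr hc,
    mul_zero, zero_smul, bracketForm_self, add_zero, zero_add, coframe_mul_swap, Fin.reduceLT,
    bracketForm_swap (b 1) (b 0), bracketForm_swap (b 2) (b 0), bracketForm_swap (b 3) (b 0),
    bracketForm_swap (b 4) (b 0), bracketForm_swap (b 5) (b 0), bracketForm_swap (b 2) (b 1),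
    bracketForm_swap (b 3) (b 1), bracketForm_swap (b 4) (b 1), bracketForm_swap (b 5) (b 1),
    bracketForm_swap (b 3) (b 2), bracketForm_swap (b 4) (b 2), bracketForm_swap (b 5) (b 2),
    bracketForm_swap (b 4) (b 3), bracketForm_swap (b 5) (b 3), bracketForm_swap (b 5) (b 4)] at h
  generalize bracketForm = B at h ⊢
  simp only [mul_add, add_mul, neg_mul, mul_neg, smul_mul_assoc, mul_assoc, neg_neg, smul_neg,
    coframe_mul_swap, coframe_mul_swap_assoc, coframe_mul_self, coframe_mul_self_assoc,
    Fin.reduceLT, mul_zero, smul_zero, neg_zero, add_zero, zero_add] at h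
  have h' : (-B (b 2) (b 4) + B (b 3) (b 5)) • (coframe b 1 * coframe b 2 * coframe b 3 * coframe b 4 * coframe b 5)
      + (-B (b 2) (b 5) - B (b 3) (b 4)) • (coframe b 0 * coframe b 2 * coframe b 3 * coframe b 4 * coframe b 5)
      + (B (b 0) (b 4) - B (b 1) (b 5)) • (coframe b 0 * coframe b 1 * coframe b 3 * coframe b 4 * coframe b 5)
      + (B (b 0) (b 5) + B (b 1) (b 4)) • (coframe b 0 * coframe b 1 * coframe b 2 * coframe b 4 * coframe b 5)
      + (-B (b 0) (b 2) + B (b 1) (b 3)) • (coframe b 0 * coframe b 1 * coframe b 2 * coframe b 3 * coframe b 5)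
      + (-B (b 0) (b 3) - B (b 1) (b 2)) • (coframe b 0 * coframe b 1 * coframe b 2 * coframe b 3 * coframe b 4) = 0 := by
    rw [← h]
    simp only [mul_assoc]
    module
  obtain ⟨k0, k1, k2, k3, k4, k5⟩ := eq_zero_of_fiveForm_eq_zero b h'
  exact ⟨by linarith, by linarith, by linarith, by linarith, by linarith, by linarith⟩

end Heisenberg

/-! ### SU(3) frames: the stabiliser of the last vector. -/

section ComplexStructure

variable {V : Type*} [AddCommGroup V] [Module ℝ V] (b b' : Module.Basis (Fin 7) ℝ V)

/-- The complex structure on the span of `b 0, …, b 5`, extended by zero on `b 6`. -/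
noncomputable def complexStructure : V →ₗ[ℝ] V :=
  (b.coord 0).smulRight (b 1) - (b.coord 1).smulRight (b 0) + (b.coord 2).smulRight (b 3)
    - (b.coord 3).smulRight (b 2) + (b.coord 4).smulRight (b 5) - (b.coord 5).smulRight (b 4)

theorem complexStructure_apply (x : V) : complexStructure b x =
    b.coord 0 x • b 1 - b.coord 1 x • b 0 + b.coord 2 x • b 3 - b.coord 3 x • b 2
      + b.coord 4 x • b 5 - b.coord 5 x • b 4 := rfl

/-- The frames `b` and `b'` induce the same `G₂` structure and the same `SU(3)` structure on the
span of the first six vectors. -/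
structure SameSU3 : Prop extends SameG2 b b' where
  six : b' 6 = b 6
  cplx : complexStructure b' = complexStructure b

variable {b b'}

theorem SameSU3.trans {b'' : Module.Basis (Fin 7) ℝ V} (h : SameSU3 b b') (h' : SameSU3 b' b'') :
    SameSU3 b b'' :=
  ⟨h.1.trans h'.1, h'.2.trans h.2, h'.3.trans h.3⟩

theorem IsDoubleRotation.sameSU3 {i j k l : Fin 7} {c s : ℝ}
    (hr : IsDoubleRotation b b' i j k l c s)
    (ht : (i, j, k, l) ∈ [((2, 3, 1, 0) : Fin 7 × Fin 7 × Fin 7 × Fin 7), (4, 5, 1, 0),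
      (2, 4, 3, 5), (0, 2, 1, 3)]) : SameSU3 b b' := by
  have h := hr.unit
  refine ⟨hr.sameG2 (by simp only [List.mem_cons] at ht ⊢; tauto), ?_, ?_⟩
  all_goals
    simp only [List.mem_cons, Prod.mk.injEq, List.not_mem_nil, or_false] at ht
    rcases ht with ⟨rfl, rfl, rfl, rfl⟩ | ⟨rfl, rfl, rfl, rfl⟩ | ⟨rfl, rfl, rfl, rfl⟩ |
      ⟨rfl, rfl, rfl, rfl⟩
  iterate 4 rw [hr.basis]; rfl
  all_goals
    refine LinearMap.ext fun x => ?_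
    simp only [complexStructure_apply, hr.coord, hr.basis, Fin.reduceEq, if_true, if_false]
    generalize b.coord = B
    match_scalars <;> first
    | ring1
    | linear_combination B 0 x * h
    | linear_combination B 1 x * h
    | linear_combination B 2 x * h
    | linear_combination B 3 x * h
    | linear_combination B 4 x * h
    | linear_combination B 5 x * h
    | linear_combination -B 0 x * h
    | linear_combination -B 1 x * h
    | linear_combination -B 2 x * h
    | linear_combination -B 3 x * h
    | linear_combination -B 4 x * h
    | linear_combination -B 5 x * h

/-- `SU(3)` acts transitively on the rays of the span of `b 0, …, b 5`. -/
theorem exists_sameSU3_eq_smul (b : Module.Basis (Fin 7) ℝ V) {x : V} (hx : x ≠ 0)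
    (h6 : b.coord 6 x = 0) :
    ∃ (b' : Module.Basis (Fin 7) ℝ V) (r : ℝ), SameSU3 b b' ∧ 0 < r ∧ x = r • b' 0 := by
  have step : ∀ (b : Module.Basis (Fin 7) ℝ V) (i j k l : Fin 7), [i, j, k, l].Nodup →
      (i, j, k, l) ∈ [((2, 3, 1, 0) : Fin 7 × Fin 7 × Fin 7 × Fin 7), (4, 5, 1, 0),
      (2, 4, 3, 5), (0, 2, 1, 3)] →
      (∃ b' c s, SameSU3 b b' ∧ IsDoubleRotation b b' i j k l c s ∧
        b'.coord j x = 0 ∧ 0 ≤ b'.coord i x) := by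
    intro b i j k l hd ht
    obtain ⟨c, s, h, h1, h2⟩ := exists_rotation_right_eq_zero (b.coord i x) (b.coord j x)
    obtain ⟨b', hb⟩ := exists_isDoubleRotation b hd h
    refine ⟨b', c, s, hb.sameSU3 ht, hb, ?_, ?_⟩
    · rw [hb.coord, if_neg (by aesop), if_pos rfl, h1]
    · rw [hb.coord, if_pos rfl]; exact h2
  have step' : ∀ (b : Module.Basis (Fin 7) ℝ V),
      (∃ b' c s, SameSU3 b b' ∧ IsDoubleRotation b b' 4 5 1 0 c s ∧ b'.coord 1 x = 0) := by
    intro b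
    obtain ⟨c, s, h, h1, h2⟩ := exists_rotation_left_eq_zero (b.coord 1 x) (b.coord 0 x)
    obtain ⟨b', hb⟩ := exists_isDoubleRotation (i := 4) (j := 5) (k := 1) (l := 0) b (by decide) h
    refine ⟨b', c, s, hb.sameSU3 (by decide), hb, ?_⟩
    rw [hb.coord]; simpa using h1
  -- The coordinates are killed in the order 5, 3, 4, 1, 2; coordinate 1 goes through the second
  -- plane of a double rotation whose first plane is already zero.
  obtain ⟨b1, c1, s1, g1, r1, z1, -⟩ := step b 4 5 1 0 (by decide) (by decide)
  have z16 : b1.coord 6 x = 0 := by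
    simp only [r1.coord, Fin.reduceEq, if_true, if_false, h6]
  obtain ⟨b2, c2, s2, g2, r2, z2, -⟩ := step b1 2 3 1 0 (by decide) (by decide)
  have z26 : b2.coord 6 x = 0 := by
    simp only [r2.coord, Fin.reduceEq, if_true, if_false, z16]
  have z25 : b2.coord 5 x = 0 := by
    simp only [r2.coord, Fin.reduceEq, if_true, if_false, z1]
  obtain ⟨b3, c3, s3, g3, r3, z3, -⟩ := step b2 2 4 3 5 (by decide) (by decide)
  have z36 : b3.coord 6 x = 0 := by
    simp only [r3.coord, Fin.reduceEq, if_true, if_false, z26]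
  have z35 : b3.coord 5 x = 0 := by
    simp only [r3.coord, Fin.reduceEq, if_true, if_false, z25, z2, mul_zero, add_zero]
  have z33 : b3.coord 3 x = 0 := by
    simp only [r3.coord, Fin.reduceEq, if_true, if_false, z25, z2, mul_zero, add_zero]
  obtain ⟨b4, c4, s4, g4, r4, z4⟩ := step' b3
  have z46 : b4.coord 6 x = 0 := by
    simp only [r4.coord, Fin.reduceEq, if_true, if_false, z36]
  have z45 : b4.coord 5 x = 0 := by
    simp only [r4.coord, Fin.reduceEq, if_true, if_false, z3, z35, mul_zero, add_zero]
  have z44 : b4.coord 4 x = 0 := by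
    simp only [r4.coord, Fin.reduceEq, if_true, if_false, z3, z35, mul_zero, add_zero]
  have z43 : b4.coord 3 x = 0 := by
    simp only [r4.coord, Fin.reduceEq, if_true, if_false, z33]
  obtain ⟨b5, c5, s5, g5, r5, z5, hpos⟩ := step b4 0 2 1 3 (by decide) (by decide)
  have z56 : b5.coord 6 x = 0 := by
    simp only [r5.coord, Fin.reduceEq, if_true, if_false, z46]
  have z55 : b5.coord 5 x = 0 := by
    simp only [r5.coord, Fin.reduceEq, if_true, if_false, z45]
  have z54 : b5.coord 4 x = 0 := by
    simp only [r5.coord, Fin.reduceEq, if_true, if_false, z44]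
  have z53 : b5.coord 3 x = 0 := by
    simp only [r5.coord, Fin.reduceEq, if_true, if_false, z43, z4, mul_zero, add_zero]
  have z51 : b5.coord 1 x = 0 := by
    simp only [r5.coord, Fin.reduceEq, if_true, if_false, z43, z4, mul_zero, add_zero]
  have hxr : x = b5.coord 0 x • b5 0 := by
    refine (b5.sum_repr x).symm.trans ?_
    simp only [← Module.Basis.coord_apply, Fin.sum_univ_seven, z5, z51, z53, z54, z55, z56,
      zero_smul, add_zero]
  refine ⟨b5, b5.coord 0 x, (((g1.trans g2).trans g3).trans g4).trans g5,
    lt_of_le_of_ne hpos fun h => hx ?_, hxr⟩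
  rw [hxr, ← h, zero_smul]

end ComplexStructure

/-- The Jacobi angle. The equation is p cos 2θ + (q/2) sin 2θ = 0: solve it for a unit vector (cos
2θ, sin 2θ) and halve the argument. -/
theorem exists_rotation_double_angle (p q : ℝ) :
    ∃ c s : ℝ, c ^ 2 + s ^ 2 = 1 ∧ (c ^ 2 - s ^ 2) * p + c * s * q = 0 := by
  obtain ⟨C, S, h, h1, -⟩ := exists_rotation_left_eq_zero p (q / 2)
  have hC : C ≤ 1 := by nlinarith [sq_nonneg S]
  have hC' : -1 ≤ C := by nlinarith [sq_nonneg S]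
  refine ⟨Real.cos (Complex.arg ⟨C, S⟩ / 2), Real.sin (Complex.arg ⟨C, S⟩ / 2),
    Real.cos_sq_add_sin_sq _, ?_⟩
  have hn : ‖(⟨C, S⟩ : ℂ)‖ = 1 := by
    rw [Complex.norm_def, Complex.normSq_mk, show C * C + S * S = 1 by linarith, Real.sqrt_one]
  have h0 : (⟨C, S⟩ : ℂ) ≠ 0 := by
    intro h0; rw [h0] at hn; simp at hn
  have hc := Complex.cos_arg h0
  have hs := Complex.sin_arg (⟨C, S⟩ : ℂ)
  rw [hn, div_one] at hc hs
  set θ := Complex.arg ⟨C, S⟩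
  have e1 : Real.cos θ = Real.cos (θ / 2) ^ 2 - Real.sin (θ / 2) ^ 2 := by
    rw [← Real.cos_two_mul']; ring_nf
  have e2 : Real.sin θ = 2 * Real.sin (θ / 2) * Real.cos (θ / 2) := by
    rw [← Real.sin_two_mul]; ring_nf
  rw [← e1, hc]
  have : Real.cos (θ / 2) * Real.sin (θ / 2) * q = Real.sin θ * (q / 2) := by rw [e2]; ring
  rw [this, hs]
  exact h1

/-! ### Diagonalisation of de⁷ by SU(3). -/

namespace Heisenberg

variable {b b' : Module.Basis (Fin 7) ℝ Heisenberg} {r : ℝ}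

/-- An eigenvector of `de⁷` with respect to the induced hermitian structure. -/
theorem exists_eigenvector (hr : r ≠ 0) (hc : center = r • b 6)
    (h : d (hodge b (modelG2 b)) = 0) :
    ∃ (w : Heisenberg) (μ : ℝ), w ≠ 0 ∧ b.coord 6 w = 0 ∧
      ∀ y, bracketForm y (complexStructure b w) = μ * frameMetric b y w := by
  obtain ⟨h02, h03, h04, h05, h24, h25⟩ := bracketForm_of_closed hr hc h
  have hJ : complexStructure b (b 0) = b 1 ∧ complexStructure b (b 1) = -b 0 ∧
      complexStructure b (b 2) = b 3 ∧ complexStructure b (b 3) = -b 2 ∧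
      complexStructure b (b 4) = b 5 ∧ complexStructure b (b 5) = -b 4 := by
    simp only [complexStructure_apply, coord_basis, Fin.reduceEq, if_true, if_false, one_smul,
      zero_smul, sub_zero, zero_sub, add_zero, zero_add, true_and]
  obtain ⟨j0, j1, j2, j3, j4, j5⟩ := hJ
  -- For a (1,1) form the bilinear form B(·, J·) is symmetric, so the spectral theorem applies on
  -- the first six frame vectors.
  let M : Matrix (Fin 6) (Fin 6) ℝ := fun i j =>
    bracketForm (b i.castSucc) (complexStructure b (b j.castSucc))
  have hM : M.IsHermitian := by
    ext i j
    rw [Matrix.conjTranspose_apply, star_trivial]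
    fin_cases i <;> fin_cases j <;>
    simp [M, bracketForm_self, j0, j1, j2, j3, j4, j5] <;>
    linarith [bracketForm_swap (b 1) (b 0), bracketForm_swap (b 2) (b 0), bracketForm_swap (b 3) (b 0),
    bracketForm_swap (b 4) (b 0), bracketForm_swap (b 5) (b 0), bracketForm_swap (b 2) (b 1),
    bracketForm_swap (b 3) (b 1), bracketForm_swap (b 4) (b 1), bracketForm_swap (b 5) (b 1),
    bracketForm_swap (b 3) (b 2), bracketForm_swap (b 4) (b 2), bracketForm_swap (b 5) (b 2),
    bracketForm_swap (b 4) (b 3), bracketForm_swap (b 5) (b 3), bracketForm_swap (b 5) (b 4),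
    bracketForm_self (b 0), bracketForm_self (b 1)]
  have hv := hM.mulVec_eigenvectorBasis 0
  have hv0 := hM.eigenvectorBasis.orthonormal.ne_zero 0
  set v := hM.eigenvectorBasis 0
  set μ := hM.eigenvalues 0
  have hw6 : b.coord 6 (∑ j : Fin 6, v j • b j.castSucc) = 0 := by
    rw [map_sum]
    refine Finset.sum_eq_zero fun j _ => ?_
    rw [map_smul, coord_basis, if_neg (by fin_cases j <;> decide), smul_zero]
  have hwj : ∀ i : Fin 6, b.coord i.castSucc (∑ j : Fin 6, v j • b j.castSucc) = v i := by
    intro i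
    simp only [map_sum, map_smul, coord_basis, Fin.castSucc_inj]
    simp
  refine ⟨∑ j : Fin 6, v j • b j.castSucc, μ, fun h0 => hv0 ?_, hw6, ?_⟩
  · ext i
    rw [← hwj i, h0]; simp
  · have : bracketForm.flip (complexStructure b (∑ j : Fin 6, v j • b j.castSucc)) =
        μ • ∑ i, b.coord i (∑ j : Fin 6, v j • b j.castSucc) • b.coord i := by
      refine b.ext fun k => ?_
      refine Fin.lastCases ?_ (fun i => ?_) k
      · rw [LinearMap.flip_apply]
        have : (Fin.last 6 : Fin 7) = 6 := rfl
        rw [this, bracketForm_six_basis hr hc]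
        simp only [LinearMap.smul_apply, LinearMap.sum_apply, coord_basis, smul_eq_mul, mul_ite, mul_one, mul_zero, Finset.sum_ite_eq, Finset.mem_univ, if_true, hw6]
      · have hi := congrFun hv i
        simp only [Matrix.mulVec, dotProduct, M, Pi.smul_apply, smul_eq_mul] at hi
        simp only [LinearMap.smul_apply, LinearMap.sum_apply, coord_basis, smul_eq_mul, mul_ite, mul_one, mul_zero, Finset.sum_ite_eq, Finset.mem_univ, if_true, hwj]
        rw [LinearMap.flip_apply, map_sum, map_sum, ← hi]
        refine Finset.sum_congr rfl fun j _ => ?_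
        rw [map_smul, map_smul, smul_eq_mul, mul_comm]
    intro y
    have hy := LinearMap.congr_fun this y
    rw [LinearMap.flip_apply] at hy
    rw [hy]
    simp only [LinearMap.smul_apply, LinearMap.sum_apply, smul_eq_mul, frameMetric, mul_comm]

/-- Normal form of a coclosed left-invariant `G₂` structure on the Heisenberg group. -/
structure IsDiagonalFrame (b : Module.Basis (Fin 7) ℝ Heisenberg) (r ν₁ ν₂ ν₃ : ℝ) : Prop where
  pos : 0 < r
  center : center = r • b 6
  de7 : de7 = ν₁ • (coframe b 0 * coframe b 1) + ν₂ • (coframe b 2 * coframe b 3)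
    + ν₃ • (coframe b 4 * coframe b 5)
  ne_zero : ν₁ ≠ 0 ∧ ν₂ ≠ 0 ∧ ν₃ ≠ 0

theorem isDiagonalFrame_of_bracketForm (hr : 0 < r) (hc : Heisenberg.center = r • b 6)
    (h02 : bracketForm (b 0) (b 2) = 0) (h03 : bracketForm (b 0) (b 3) = 0)
    (h04 : bracketForm (b 0) (b 4) = 0) (h05 : bracketForm (b 0) (b 5) = 0)
    (h12 : bracketForm (b 1) (b 2) = 0) (h13 : bracketForm (b 1) (b 3) = 0)
    (h14 : bracketForm (b 1) (b 4) = 0) (h15 : bracketForm (b 1) (b 5) = 0)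
    (h24 : bracketForm (b 2) (b 4) = 0) (h25 : bracketForm (b 2) (b 5) = 0)
    (h34 : bracketForm (b 3) (b 4) = 0) (h35 : bracketForm (b 3) (b 5) = 0) :
    IsDiagonalFrame b r (-bracketForm (b 0) (b 1)) (-bracketForm (b 2) (b 3))
      (-bracketForm (b 4) (b 5)) := by
  have hswap : ∀ {x y : Heisenberg}, bracketForm x y = 0 → bracketForm y x = 0 := fun {x y} h => by
    rw [bracketForm_swap, h, neg_zero]
  -- A vanishing eigenvalue would put the frame vector bᵢ in the radical of the bracket, hence in
  -- the centre, which is spanned by b₆.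
  have hne : ∀ i : Fin 7, i ≠ 6 → ∀ j, (∀ k, k ≠ j → bracketForm (b i) (b k) = 0) →
      -bracketForm (b i) (b j) ≠ 0 := by
    intro i hi j hj h0
    have hz : bracketForm (b i) = 0 := b.ext fun k => by
      by_cases hk : k = j
      · rw [hk, LinearMap.zero_apply]; linarith
      · exact hj k hk
    have := congrArg (b.coord i) (eq_smul_center_of_bracketForm_eq_zero hz)
    rw [map_smul, center_coord hc, if_neg hi, coord_basis, if_pos rfl] at this
    simp at this
  refine ⟨hr, hc, ?_, hne 0 (by decide) 1 ?_, hne 2 (by decide) 3 ?_, hne 4 (by decide) 5 ?_⟩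
  · rw [de7_eq_sum b]
    simp only [Fin.sum_univ_seven, bracketForm_basis_six hr.ne' hc, bracketForm_six_basis hr.ne' hc,
      mul_zero, zero_smul, bracketForm_self, add_zero, zero_add, coframe_mul_swap, Fin.reduceLT,
      h02, h03, h04, h05, h12, h13, h14, h15, h24, h25, h34, h35, hswap h02, hswap h03, hswap h04,
      hswap h05, hswap h12, hswap h13, hswap h14, hswap h15, hswap h24, hswap h25, hswap h34,
      hswap h35, bracketForm_swap (b 1) (b 0), bracketForm_swap (b 3) (b 2),
      bracketForm_swap (b 5) (b 4)]
    module
  · intro k hk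
    fin_cases k <;> first
    | exact absurd rfl hk
    | exact bracketForm_self _
    | exact bracketForm_basis_six hr.ne' hc _
    | exact h02
    | exact h03
    | exact h04
    | exact h05
  · intro k hk
    fin_cases k <;> first
    | exact absurd rfl hk
    | exact bracketForm_self _
    | exact bracketForm_basis_six hr.ne' hc _
    | exact hswap h02
    | exact hswap h12
    | exact h24
    | exact h25
  · intro k hk
    fin_cases k <;> first
    | exact absurd rfl hk
    | exact bracketForm_self _
    | exact bracketForm_basis_six hr.ne' hc _
    | exact hswap h04
    | exact hswap h14
    | exact hswap h24
    | exact hswap h34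

/-- Every coclosed left-invariant `G₂` structure on the Heisenberg group has a diagonal frame. -/
theorem exists_isDiagonalFrame (b : Module.Basis (Fin 7) ℝ Heisenberg)
    (h : d (hodge b (modelG2 b)) = 0) :
    ∃ (b' : Module.Basis (Fin 7) ℝ Heisenberg) (r ν₁ ν₂ ν₃ : ℝ), SameG2 b b' ∧
      IsDiagonalFrame b' r ν₁ ν₂ ν₃ := by
  obtain ⟨b1, r, g1, hr, hc1⟩ := exists_sameG2_eq_smul (b := b) center_ne_zero
  have hcl : ∀ {b' : Module.Basis (Fin 7) ℝ Heisenberg}, SameG2 b b' →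
      d (hodge b' (modelG2 b')) = 0 := fun g => by rw [g.hodge, g.model, h]
  obtain ⟨w, μ, hw0, hw6, hw⟩ := exists_eigenvector hr.ne' hc1 (hcl g1)
  obtain ⟨b2, ρ, g2, hρ, hwρ⟩ := exists_sameSU3_eq_smul b1 hw0 hw6
  have hc2 : center = r • b2 6 := by rw [g2.six, hc1]
  -- The eigenvector now lies along b₀, so the eigenvalue equation makes J b₀ = b₁ orthogonal, for
  -- the bracket form, to everything but b₀. The (1,1) relations then split off the whole plane (b₀,
  -- b₁).
  have hb2 : ∀ j : Fin 7, j ≠ 0 → bracketForm (b2 j) (b2 1) = 0 := by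
    intro j hj
    have h1 := hw (b2 j)
    rw [← g2.cplx, ← g2.metric, hwρ] at h1
    have e1 : complexStructure b2 (ρ • b2 0) = ρ • b2 1 := by
      simp only [complexStructure_apply, map_smul, coord_basis, Fin.reduceEq, if_true, if_false,
        smul_eq_mul, mul_one, mul_zero, zero_smul, sub_zero, add_zero, one_smul]
    have e2 : frameMetric b2 (b2 j) (ρ • b2 0) = 0 := by
      simp only [frameMetric, map_smul, coord_basis, smul_eq_mul]
      refine Finset.sum_eq_zero fun i _ => ?_
      split_ifs <;> simp_all
    rw [e1, e2, map_smul, mul_zero, smul_eq_mul] at h1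
    exact (mul_eq_zero.1 h1).resolve_left hρ.ne'
  have hb2' : ∀ j : Fin 7, j ≠ 0 → bracketForm (b2 1) (b2 j) = 0 := fun j hj => by
    rw [bracketForm_swap, hb2 j hj, neg_zero]
  obtain ⟨k02, k03, k04, k05, k24, k25⟩ :=
    bracketForm_of_closed hr.ne' hc2 (hcl (g1.trans g2.toSameG2))
  have k12 := hb2' 2 (by decide)
  have k13 := hb2' 3 (by decide)
  have k14 := hb2' 4 (by decide)
  have k15 := hb2' 5 (by decide)
  rw [k13] at k02
  rw [k12, neg_zero] at k03
  rw [k15] at k04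
  rw [k14, neg_zero] at k05
  -- A 2 × 2 hermitian matrix remains. Its off-diagonal entry is complex, with parts B(b₂, b₄) and
  -- B(b₂, b₅) up to sign. A phase rotation of the plane (b₂, b₃) removes the first part.
  obtain ⟨c, s, hcs, hz, -⟩ := exists_rotation_left_eq_zero (bracketForm (b2 2) (b2 4))
    (bracketForm (b2 3) (b2 4))
  obtain ⟨b3, r3⟩ := exists_isDoubleRotation (i := 2) (j := 3) (k := 1) (l := 0) b2 (by decide) hcs
  have g3 := r3.sameSU3 (by decide)
  have hc3 : center = r • b3 6 := by rw [g3.six, hc2]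
  have l24 : bracketForm (b3 2) (b3 4) = 0 := by
    simpa only [r3.basis, Fin.reduceEq, if_true, if_false, map_add, map_smul, LinearMap.add_apply,
      LinearMap.smul_apply, smul_eq_mul] using hz
  have l0 : ∀ j : Fin 7, (2 ≤ j ∧ j ≤ 5) → bracketForm (b3 0) (b3 j) = 0 ∧
      bracketForm (b3 1) (b3 j) = 0 := by
    intro j hj
    fin_cases j <;> simp at hj <;>
    simp [r3.basis, k02, k03, k04, k05, k12, k13, k14, k15]
  obtain ⟨-, -, -, -, l35, l25⟩ :=
    bracketForm_of_closed hr.ne' hc3 (hcl ((g1.trans g2.toSameG2).trans g3.toSameG2))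
  rw [l24] at l35
  -- A Jacobi rotation removes the second part. It does not bring back the first, since B(b₂, b₄) is
  -- invariant under rotations of the plane (b₂, b₄).
  obtain ⟨c', s', hcs', hz'⟩ := exists_rotation_double_angle (bracketForm (b3 2) (b3 5))
    (bracketForm (b3 4) (b3 5) - bracketForm (b3 2) (b3 3))
  obtain ⟨b4, r4⟩ := exists_isDoubleRotation (i := 2) (j := 4) (k := 3) (l := 5) b3 (by decide) hcs'
  have g4 := r4.sameSU3 (by decide)
  have hc4 : center = r • b4 6 := by rw [g4.six, hc3]
  have m0 : ∀ j : Fin 7, (2 ≤ j ∧ j ≤ 5) → bracketForm (b4 0) (b4 j) = 0 ∧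
      bracketForm (b4 1) (b4 j) = 0 := by
    intro j hj
    have l02 := l0 2 (by decide)
    have l03 := l0 3 (by decide)
    have l04 := l0 4 (by decide)
    have l05 := l0 5 (by decide)
    fin_cases j <;> simp at hj <;>
    simp [r4.basis, l02, l03, l04, l05]
  have m24 : bracketForm (b4 2) (b4 4) = 0 := by
    simp [r4.basis, bracketForm_self, l24, bracketForm_swap (b3 4) (b3 2)]
  have m25 : bracketForm (b4 2) (b4 5) = 0 := by
    simp only [r4.basis, Fin.reduceEq, if_true, if_false, map_add, map_smul, LinearMap.add_apply,
      LinearMap.smul_apply, smul_eq_mul]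
    linear_combination hz' + s' ^ 2 * (l25 - bracketForm_swap (b3 3) (b3 4))
  obtain ⟨-, -, -, -, m35, m34⟩ := bracketForm_of_closed hr.ne' hc4
    (hcl (((g1.trans g2.toSameG2).trans g3.toSameG2).trans g4.toSameG2))
  rw [m24] at m35
  rw [m25] at m34
  exact ⟨b4, r, _, _, _, ((g1.trans g2.toSameG2).trans g3.toSameG2).trans g4.toSameG2,
    isDiagonalFrame_of_bracketForm hr hc4 (m0 2 (by decide)).1 (m0 3 (by decide)).1
    (m0 4 (by decide)).1 (m0 5 (by decide)).1 (m0 2 (by decide)).2 (m0 3 (by decide)).2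
    (m0 4 (by decide)).2 (m0 5 (by decide)).2 m24 m25 (by linarith) m35.symm⟩

end Heisenberg

/-! ### The Laplacian of a diagonal structure. -/

section

variable {V : Type*} [AddCommGroup V] [Module ℝ V] (b : Module.Basis (Fin 7) ℝ V)

theorem involute_coframe (i : Fin 7) :
    CliffordAlgebra.involute (Q := (0 : QuadraticForm ℝ (Module.Dual ℝ V))) (coframe b i) =
      -coframe b i :=
  CliffordAlgebra.involute_ι _

theorem involute_hodge_modelG2 :
    CliffordAlgebra.involute (Q := (0 : QuadraticForm ℝ (Module.Dual ℝ V)))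
      (hodge b (modelG2 b)) = hodge b (modelG2 b) := by
  rw [hodge_modelG2]
  simp only [map_add, map_neg, map_mul, involute_coframe, neg_mul_neg, neg_mul, mul_neg, neg_neg,
    add_mul, neg_add]

theorem hodge_hodge_modelG2 : hodge b (hodge b (modelG2 b)) = modelG2 b := by
  rw [hodge_modelG2]
  simp only [hodge, modelG2, vol, map_add, map_sub, contraction_mul_apply, contraction_coframe,
    mul_assoc, MulOpposite.unop_add, MulOpposite.unop_sub, LinearMap.add_apply, LinearMap.sub_apply,
    map_neg, MulOpposite.unop_neg, LinearMap.neg_apply,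
    interiorProd_coframe_mul, interiorProd_coframe, interiorProd_algebraMap, interiorProd_one,
    coord_basis, Fin.reduceEq, if_true, if_false, one_smul, zero_smul, zero_sub, sub_zero, mul_neg,
    mul_zero, neg_zero, map_zero, mul_sub, mul_one, sub_self, zero_add, add_zero, map_one, add_mul,
    neg_mul, neg_neg]
  abel

theorem hodge_zero : hodge b (0 : Forms V) = 0 := by simp [hodge]

end

namespace Heisenberg

variable {b b' : Module.Basis (Fin 7) ℝ Heisenberg} {r ν₁ ν₂ ν₃ : ℝ}

theorem codiff_zero (b : Module.Basis (Fin 7) ℝ Heisenberg) : codiff b 0 = 0 := by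
  rw [codiff, map_zero, hodge_zero, d_eq, map_zero, mul_zero, hodge_zero]

theorem IsDiagonalFrame.d_hodge_modelG2 (h : IsDiagonalFrame b r ν₁ ν₂ ν₃) :
    d (hodge b (modelG2 b)) = 0 := by
  rw [Heisenberg.d_hodge_modelG2 h.center, h.de7]
  simp only [mul_add, add_mul, neg_mul, mul_neg, smul_mul_assoc, mul_assoc, neg_neg, smul_neg,
    coframe_mul_swap, coframe_mul_swap_assoc, coframe_mul_self, coframe_mul_self_assoc,
    Fin.reduceLT, mul_zero, smul_zero, neg_zero, add_zero, zero_add]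

theorem IsDiagonalFrame.codiff_hodge_modelG2 (h : IsDiagonalFrame b r ν₁ ν₂ ν₃) :
    codiff b (hodge b (modelG2 b)) =
      r • ((ν₂ + ν₃) • (coframe b 0 * coframe b 1 * coframe b 6)
        + (ν₁ + ν₃) • (coframe b 2 * coframe b 3 * coframe b 6)
        + (ν₁ + ν₂) • (coframe b 4 * coframe b 5 * coframe b 6)) := by
  -- Since ⋆ψ = φ and ψ has even degree, d*ψ = ⋆dφ, and dφ = r de⁷ ∧ ω.
  have h1 : d (modelG2 b) = (r * (ν₁ + ν₂)) • (coframe b 0 * coframe b 1 * coframe b 2 * coframe b 3)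
      + (r * (ν₁ + ν₃)) • (coframe b 0 * coframe b 1 * coframe b 4 * coframe b 5)
      + (r * (ν₂ + ν₃)) • (coframe b 2 * coframe b 3 * coframe b 4 * coframe b 5) := by
    rw [d_eq, h.de7]
    simp only [modelG2, map_add, map_sub, mul_assoc, interiorProd_coframe_mul, interiorProd_coframe,
      center_coord h.center, Fin.reduceEq, if_true, if_false, zero_smul, zero_sub, mul_neg, neg_neg,
      map_zero, mul_zero, neg_zero, add_zero, zero_add, sub_zero, Algebra.algebraMap_eq_smul_one,
      mul_smul_comm, mul_one, add_mul, neg_mul, smul_mul_assoc, mul_add]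
    simp only [coframe_mul_swap, coframe_mul_swap_assoc, coframe_mul_self, coframe_mul_self_assoc,
      Fin.reduceLT, mul_zero, smul_zero, neg_zero, add_zero, zero_add, mul_neg, neg_neg]
    module
  rw [codiff, involute_hodge_modelG2, hodge_hodge_modelG2, h1]
  simp only [hodge, vol, map_add, map_smul, contraction_mul_apply, contraction_coframe,
    mul_assoc, MulOpposite.unop_add, MulOpposite.unop_smul, LinearMap.add_apply,
    LinearMap.smul_apply, map_neg,
    interiorProd_coframe_mul, interiorProd_coframe, interiorProd_algebraMap, interiorProd_one,
    coord_basis, Fin.reduceEq, if_true, if_false, one_smul, zero_smul, zero_sub, sub_zero, mul_neg,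
    mul_zero, neg_zero, map_zero, mul_sub, mul_one, sub_self, zero_add, add_zero, map_one, add_mul,
    neg_mul, neg_neg]
  module

theorem IsDiagonalFrame.laplacian_hodge_modelG2 (h : IsDiagonalFrame b r ν₁ ν₂ ν₃) :
    laplacian b (hodge b (modelG2 b)) = r ^ 2 •
      ((ν₂ ^ 2 + ν₃ ^ 2 + ν₁ * (ν₂ + ν₃)) •
          (coframe b 2 * coframe b 3 * coframe b 4 * coframe b 5)
        + (ν₁ ^ 2 + ν₃ ^ 2 + ν₂ * (ν₁ + ν₃)) •
          (coframe b 0 * coframe b 1 * coframe b 4 * coframe b 5)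
        + (ν₁ ^ 2 + ν₂ ^ 2 + ν₃ * (ν₁ + ν₂)) •
          (coframe b 0 * coframe b 1 * coframe b 2 * coframe b 3)) := by
  rw [laplacian, h.d_hodge_modelG2, codiff_zero, add_zero, h.codiff_hodge_modelG2, d_eq, h.de7]
  simp only [map_add, map_smul, mul_assoc, interiorProd_coframe_mul, interiorProd_coframe,
    center_coord h.center, Fin.reduceEq, if_true, if_false, zero_smul, zero_sub, mul_neg, neg_neg,
    map_zero, mul_zero, neg_zero, add_zero, zero_add, sub_zero, Algebra.algebraMap_eq_smul_one,
    mul_smul_comm, mul_one, add_mul, neg_mul, smul_mul_assoc, mul_add, smul_add]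
  simp only [coframe_mul_swap, coframe_mul_swap_assoc, coframe_mul_self, coframe_mul_self_assoc,
    Fin.reduceLT, mul_zero, smul_zero, neg_zero, add_zero, zero_add, mul_neg, neg_neg]
  module

end Heisenberg

/-! ### Pfaffian algebra of 2-forms in six dimensions. -/

section TwoForms

variable {V : Type*} [AddCommGroup V] [Module ℝ V] (b : Module.Basis (Fin 7) ℝ V)

/-- The 2-form with the 15 coefficients `w` in the lexicographically ordered monomials
`e⁰¹, e⁰², …, e⁴⁵`. -/
noncomputable def twoForm (w : Fin 15 → ℝ) : Forms V :=
  w 0 • (coframe b 0 * coframe b 1) + w 1 • (coframe b 0 * coframe b 2) + w 2 • (coframe b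
    0 * coframe b 3) + w 3 • (coframe b 0 * coframe b 4) + w 4 • (coframe b 0 * coframe b 5)
    + w 5 • (coframe b 1 * coframe b 2) + w 6 • (coframe b 1 * coframe b 3) + w 7 • (coframe
    b 1 * coframe b 4) + w 8 • (coframe b 1 * coframe b 5) + w 9 • (coframe b 2 * coframe b
    3) + w 10 • (coframe b 2 * coframe b 4) + w 11 • (coframe b 2 * coframe b 5) + w 12 •
    (coframe b 3 * coframe b 4) + w 13 • (coframe b 3 * coframe b 5) + w 14 • (coframe b 4 *
    coframe b 5)

/-- The 4-form `σ` on the span of the first six vectors with `σ ∧ eⁱʲ = sᵢⱼ e⁰¹²³⁴⁵`. -/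
noncomputable def fourForm : (Fin 15 → ℝ) →ₗ[ℝ] Forms V where
  toFun s := (s 0) • (coframe b 2 * coframe b 3 * coframe b 4 * coframe b 5) + (-s 1) • (coframe b 1
    * coframe b 3 * coframe b 4 * coframe b 5) + (s 2) • (coframe b 1 * coframe b 2 *
    coframe b 4 * coframe b 5) + (-s 3) • (coframe b 1 * coframe b 2 * coframe b 3 * coframe
    b 5) + (s 4) • (coframe b 1 * coframe b 2 * coframe b 3 * coframe b 4) + (s 5) •
    (coframe b 0 * coframe b 3 * coframe b 4 * coframe b 5) + (-s 6) • (coframe b 0 *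
    coframe b 2 * coframe b 4 * coframe b 5) + (s 7) • (coframe b 0 * coframe b 2 * coframe
    b 3 * coframe b 5) + (-s 8) • (coframe b 0 * coframe b 2 * coframe b 3 * coframe b 4) +
    (s 9) • (coframe b 0 * coframe b 1 * coframe b 4 * coframe b 5) + (-s 10) • (coframe b 0
    * coframe b 1 * coframe b 3 * coframe b 5) + (s 11) • (coframe b 0 * coframe b 1 *
    coframe b 3 * coframe b 4) + (s 12) • (coframe b 0 * coframe b 1 * coframe b 2 * coframe
    b 5) + (-s 13) • (coframe b 0 * coframe b 1 * coframe b 2 * coframe b 4) + (s 14) •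
    (coframe b 0 * coframe b 1 * coframe b 2 * coframe b 3)
  map_add' s s' := by simp only [Pi.add_apply]; module
  map_smul' c s := by simp only [Pi.smul_apply, smul_eq_mul, RingHom.id_apply]; module

theorem fourForm_apply (s : Fin 15 → ℝ) : fourForm b s =
    (s 0) • (coframe b 2 * coframe b 3 * coframe b 4 * coframe b 5) + (-s 1) • (coframe b 1
    * coframe b 3 * coframe b 4 * coframe b 5) + (s 2) • (coframe b 1 * coframe b 2 *
    coframe b 4 * coframe b 5) + (-s 3) • (coframe b 1 * coframe b 2 * coframe b 3 * coframe
    b 5) + (s 4) • (coframe b 1 * coframe b 2 * coframe b 3 * coframe b 4) + (s 5) •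
    (coframe b 0 * coframe b 3 * coframe b 4 * coframe b 5) + (-s 6) • (coframe b 0 *
    coframe b 2 * coframe b 4 * coframe b 5) + (s 7) • (coframe b 0 * coframe b 2 * coframe
    b 3 * coframe b 5) + (-s 8) • (coframe b 0 * coframe b 2 * coframe b 3 * coframe b 4) +
    (s 9) • (coframe b 0 * coframe b 1 * coframe b 4 * coframe b 5) + (-s 10) • (coframe b 0
    * coframe b 1 * coframe b 3 * coframe b 5) + (s 11) • (coframe b 0 * coframe b 1 *
    coframe b 3 * coframe b 4) + (s 12) • (coframe b 0 * coframe b 1 * coframe b 2 * coframe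
    b 5) + (-s 13) • (coframe b 0 * coframe b 1 * coframe b 2 * coframe b 4) + (s 14) •
    (coframe b 0 * coframe b 1 * coframe b 2 * coframe b 3) := rfl

/-- The volume form of the span of the first six vectors. -/
noncomputable def vol6 : Forms V :=
  coframe b 0 * coframe b 1 * coframe b 2 * coframe b 3 * coframe b 4 * coframe b 5

/-- The Pfaffian adjugate: `½ ω² = fourForm (pfAdj w)` for `ω = twoForm w`. -/
def pfAdj (w : Fin 15 → ℝ) : Fin 15 → ℝ :=
  ![w 9 * w 14 - w 10 * w 13 + w 11 * w 12,
    -(w 6 * w 14 - w 7 * w 13 + w 8 * w 12),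
    w 5 * w 14 - w 7 * w 11 + w 8 * w 10,
    -(w 5 * w 13 - w 6 * w 11 + w 8 * w 9),
    w 5 * w 12 - w 6 * w 10 + w 7 * w 9,
    w 2 * w 14 - w 3 * w 13 + w 4 * w 12,
    -(w 1 * w 14 - w 3 * w 11 + w 4 * w 10),
    w 1 * w 13 - w 2 * w 11 + w 4 * w 9,
    -(w 1 * w 12 - w 2 * w 10 + w 3 * w 9),
    w 0 * w 14 - w 3 * w 8 + w 4 * w 7,
    -(w 0 * w 13 - w 2 * w 8 + w 4 * w 6),
    w 0 * w 12 - w 2 * w 7 + w 3 * w 6,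
    w 0 * w 11 - w 1 * w 8 + w 4 * w 5,
    -(w 0 * w 10 - w 1 * w 7 + w 3 * w 5),
    w 0 * w 9 - w 1 * w 6 + w 2 * w 5]

/-- The polarisation of `pfAdj`. -/
def pfPolar (w u : Fin 15 → ℝ) : Fin 15 → ℝ :=
  ![w 9 * u 14 + u 9 * w 14 - w 10 * u 13 - u 10 * w 13 + w 11 * u 12 + u 11 * w 12,     -(w
    6 * u 14 + u 6 * w 14 - w 7 * u 13 - u 7 * w 13 + w 8 * u 12 + u 8 * w 12),     w 5 * u
    14 + u 5 * w 14 - w 7 * u 11 - u 7 * w 11 + w 8 * u 10 + u 8 * w 10,     -(w 5 * u 13 +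
    u 5 * w 13 - w 6 * u 11 - u 6 * w 11 + w 8 * u 9 + u 8 * w 9),     w 5 * u 12 + u 5 * w
    12 - w 6 * u 10 - u 6 * w 10 + w 7 * u 9 + u 7 * w 9,     w 2 * u 14 + u 2 * w 14 - w 3
    * u 13 - u 3 * w 13 + w 4 * u 12 + u 4 * w 12,     -(w 1 * u 14 + u 1 * w 14 - w 3 * u
    11 - u 3 * w 11 + w 4 * u 10 + u 4 * w 10),     w 1 * u 13 + u 1 * w 13 - w 2 * u 11 - u
    2 * w 11 + w 4 * u 9 + u 4 * w 9,     -(w 1 * u 12 + u 1 * w 12 - w 2 * u 10 - u 2 * w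
    10 + w 3 * u 9 + u 3 * w 9),     w 0 * u 14 + u 0 * w 14 - w 3 * u 8 - u 3 * w 8 + w 4 *
    u 7 + u 4 * w 7,     -(w 0 * u 13 + u 0 * w 13 - w 2 * u 8 - u 2 * w 8 + w 4 * u 6 + u 4
    * w 6),     w 0 * u 12 + u 0 * w 12 - w 2 * u 7 - u 2 * w 7 + w 3 * u 6 + u 3 * w 6,
    w 0 * u 11 + u 0 * w 11 - w 1 * u 8 - u 1 * w 8 + w 4 * u 5 + u 4 * w 5,     -(w 0 * u
    10 + u 0 * w 10 - w 1 * u 7 - u 1 * w 7 + w 3 * u 5 + u 3 * w 5),     w 0 * u 9 + u 0 *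
    w 9 - w 1 * u 6 - u 1 * w 6 + w 2 * u 5 + u 2 * w 5]

/-- The Pfaffian. -/
def pf (w : Fin 15 → ℝ) : ℝ :=
  w 0 * (w 9 * w 14 - w 10 * w 13 + w 11 * w 12) + w 1 * (-(w 6 * w 14 - w 7 * w 13 + w 8
    * w 12)) + w 2 * (w 5 * w 14 - w 7 * w 11 + w 8 * w 10) + w 3 * (-(w 5 * w 13 - w 6 * w
    11 + w 8 * w 9)) + w 4 * (w 5 * w 12 - w 6 * w 10 + w 7 * w 9)

/-- The analogue of adj(adj A) = det(A)ⁿ⁻² A. With `pf_pfAdj` it recovers ω from the coefficients of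
½ω² up to sign when the Pfaffian is nonzero. -/
theorem pfAdj_pfAdj (w : Fin 15 → ℝ) : pfAdj (pfAdj w) = pf w • w := by
  funext i
  fin_cases i <;>
  simp only [pfAdj, pf, Pi.smul_apply, smul_eq_mul] <;>
  simp <;> ring

theorem pf_pfAdj (w : Fin 15 → ℝ) : pf (pfAdj w) = pf w ^ 2 := by
  simp only [pfAdj, pf]
  simp
  ring

theorem twoForm_mul_twoForm (w u : Fin 15 → ℝ) :
    twoForm b w * twoForm b u = fourForm b (pfPolar w u) := by
  simp only [twoForm, fourForm_apply, pfPolar]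
  simp only [add_mul, mul_add, smul_mul_assoc, mul_smul_comm, mul_assoc, coframe_mul_swap,
    coframe_mul_swap_assoc, coframe_mul_self, coframe_mul_self_assoc, Fin.reduceLT, smul_neg,
    smul_zero, mul_neg, neg_mul, neg_neg, mul_zero, zero_mul, add_zero, zero_add]
  simp only [Matrix.cons_val]
  module

theorem fourForm_mul_twoForm (s w : Fin 15 → ℝ) :
    fourForm b s * twoForm b w = (∑ i, s i * w i) • vol6 b := by
  simp only [twoForm, fourForm_apply, vol6]
  simp only [add_mul, mul_add, smul_mul_assoc, mul_smul_comm, mul_assoc, coframe_mul_swap,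
    coframe_mul_swap_assoc, coframe_mul_self, coframe_mul_self_assoc, Fin.reduceLT, smul_neg,
    smul_zero, mul_neg, neg_mul, neg_neg, mul_zero, zero_mul, add_zero, zero_add]
  have h : ∑ i, s i * w i = s 0 * w 0 + s 1 * w 1 + s 2 * w 2 + s 3 * w 3 + s 4 * w 4 + s 5 * w 5
      + s 6 * w 6 + s 7 * w 7 + s 8 * w 8 + s 9 * w 9 + s 10 * w 10 + s 11 * w 11 + s 12 * w 12
      + s 13 * w 13 + s 14 * w 14 := by
    simp only [Fin.sum_univ_castSucc, Fin.sum_univ_zero, zero_add]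
    rfl
  rw [h]
  module

end TwoForms

section TwoForms

variable {V : Type*} [AddCommGroup V] [Module ℝ V] (b : Module.Basis (Fin 7) ℝ V)

theorem pfPolar_self (w : Fin 15 → ℝ) : pfPolar w w = (2 : ℝ) • pfAdj w := by
  funext i
  fin_cases i <;>
  simp only [pfAdj, pfPolar, Pi.smul_apply, smul_eq_mul] <;>
  simp <;> ring

theorem pfPolar_smul_left (c : ℝ) (w u : Fin 15 → ℝ) : pfPolar (c • w) u = c • pfPolar w u := by
  funext i
  fin_cases i <;>
  simp only [pfPolar, Pi.smul_apply, smul_eq_mul] <;>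
  simp <;> ring

theorem sum_pfAdj_mul (w : Fin 15 → ℝ) : ∑ i, pfAdj w i * w i = 3 * pf w := by
  simp only [Fin.sum_univ_castSucc, Fin.sum_univ_zero, zero_add, pfAdj, pf, Fin.reduceCastSucc,
    Fin.reduceLast, Matrix.cons_val]
  ring

theorem twoForm_add (w u : Fin 15 → ℝ) : twoForm b (w + u) = twoForm b w + twoForm b u := by
  simp only [twoForm, Pi.add_apply]; module

theorem twoForm_sq (w : Fin 15 → ℝ) : twoForm b w ^ 2 = (2 : ℝ) • fourForm b (pfAdj w) := by
  rw [sq, twoForm_mul_twoForm, pfPolar_self, map_smul]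

theorem twoForm_cube (w : Fin 15 → ℝ) : twoForm b w ^ 3 = (6 * pf w) • vol6 b := by
  rw [pow_succ, twoForm_sq, smul_mul_assoc, fourForm_mul_twoForm, sum_pfAdj_mul]
  module

theorem smul_vol6_eq_zero {c : ℝ} (h : c • vol6 b = 0) : c = 0 := by
  have h2 : interiorProd (b 5) (interiorProd (b 4) (interiorProd (b 3) (interiorProd (b 2)
      (interiorProd (b 1) (interiorProd (b 0) (c • vol6 b)))))) = 0 := by
    rw [h]; simp only [map_zero]
  simp only [vol6, map_add, map_neg, map_smul, mul_assoc, interiorProd_coframe_mul,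
    interiorProd_coframe, coord_basis, Fin.reduceEq, if_true, if_false, zero_smul, zero_sub,
    sub_zero, one_smul, map_zero, mul_zero, neg_zero, map_one] at h2
  simpa [Algebra.smul_def] using h2

/-- The wedge pairing of 4-forms with 2-forms is diagonal in these coefficients, so pairing with a
monomial extracts one of them. -/
theorem fourForm_injective : Function.Injective (fourForm b) := by
  refine (injective_iff_map_eq_zero _).2 fun s hs => funext fun i => ?_
  have h := fourForm_mul_twoForm b s (Pi.single i 1)
  rw [hs, zero_mul] at h
  simpa [Pi.single_apply] using smul_vol6_eq_zero b h.symm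

theorem exists_fourForm_leftInverse :
    ∃ S : Forms V →ₗ[ℝ] (Fin 15 → ℝ), ∀ s, S (fourForm b s) = s := by
  obtain ⟨S, hS⟩ := LinearMap.exists_leftInverse_of_injective (fourForm b)
    (LinearMap.ker_eq_bot.2 (fourForm_injective b))
  exact ⟨S, fun s => LinearMap.congr_fun hS s⟩

/-- The coefficients of the wedge product of two 1-forms on the span of the first six vectors. -/
def wedgeCoeff (x y : Fin 7 → ℝ) : Fin 15 → ℝ :=
  ![x 0 * y 1 - x 1 * y 0, x 0 * y 2 - x 2 * y 0, x 0 * y 3 - x 3 * y 0, x 0 * y 4 - x 4 * y 0,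
    x 0 * y 5 - x 5 * y 0, x 1 * y 2 - x 2 * y 1, x 1 * y 3 - x 3 * y 1, x 1 * y 4 - x 4 * y 1,
    x 1 * y 5 - x 5 * y 1, x 2 * y 3 - x 3 * y 2, x 2 * y 4 - x 4 * y 2, x 2 * y 5 - x 5 * y 2,
    x 3 * y 4 - x 4 * y 3, x 3 * y 5 - x 5 * y 3, x 4 * y 5 - x 5 * y 4]

theorem oneForm_eq_sum (θ : Module.Dual ℝ V) : oneForm θ = ∑ i, θ (b i) • coframe b i := by
  conv_lhs => rw [← b.sum_dual_apply_smul_coord θ]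
  simp only [oneForm, map_sum, map_smul, coframe]

theorem oneForm_mul_oneForm {x y : Module.Dual ℝ V} (hx : x (b 6) = 0) (hy : y (b 6) = 0) :
    oneForm x * oneForm y = twoForm b (wedgeCoeff (fun i => x (b i)) fun i => y (b i)) := by
  rw [oneForm_eq_sum b x, oneForm_eq_sum b y]
  simp only [Fin.sum_univ_seven, hx, hy, zero_smul, add_zero, twoForm, wedgeCoeff, add_mul, mul_add,
    smul_mul_assoc, mul_smul_comm, coframe_mul_swap, coframe_mul_self, Fin.reduceLT, smul_neg,
    smul_zero, zero_add]
  simp only [Matrix.cons_val]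
  module

end TwoForms

/-! ### Identities for ω, ρ̂ and the complex structure. -/

section SU3

variable {V : Type*} [AddCommGroup V] [Module ℝ V] (b : Module.Basis (Fin 7) ℝ V)

/-- The fundamental 2-form of the `SU(3)` structure on the span of the first six vectors. -/
noncomputable def kaehlerForm : Forms V :=
  coframe b 0 * coframe b 1 + coframe b 2 * coframe b 3 + coframe b 4 * coframe b 5

/-- The imaginary part of the complex volume form of the `SU(3)` structure on the span of the first
six vectors. -/
noncomputable def rhoHat : Forms V :=
  -(coframe b 1 * coframe b 3 * coframe b 5) + coframe b 0 * coframe b 2 * coframe b 5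
    + coframe b 0 * coframe b 3 * coframe b 4 + coframe b 1 * coframe b 2 * coframe b 4

theorem kaehlerForm_sq : kaehlerForm b ^ 2 = (2 : ℝ) •
    (coframe b 2 * coframe b 3 * coframe b 4 * coframe b 5
      + coframe b 0 * coframe b 1 * coframe b 4 * coframe b 5
      + coframe b 0 * coframe b 1 * coframe b 2 * coframe b 3) := by
  rw [sq, kaehlerForm]
  simp only [add_mul, mul_add, mul_assoc, coframe_mul_swap, coframe_mul_swap_assoc,
    coframe_mul_self, coframe_mul_self_assoc, Fin.reduceLT, mul_neg, neg_mul, neg_neg, mul_zero,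
    zero_mul, add_zero, zero_add, neg_zero]
  module

theorem hodge_modelG2_eq : hodge b (modelG2 b) =
    (1 / 2 : ℝ) • kaehlerForm b ^ 2 + rhoHat b * coframe b 6 := by
  rw [hodge_modelG2, kaehlerForm_sq, rhoHat]
  module

/-- By type: a diagonal 4-form is (2,2), ι_vρ̂ is (2,0) + (0,2), and there is nothing of type (4,2)
or (2,4) in complex dimension three. Hence ψ ∧ ι_vρ̂ does not see ½ω², and the Laplacian contributes
nothing to it. -/
theorem diagonalFourForm_mul_interiorProd_rhoHat (c₁ c₂ c₃ : ℝ) (v : V) :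
    (c₁ • (coframe b 2 * coframe b 3 * coframe b 4 * coframe b 5)
      + c₂ • (coframe b 0 * coframe b 1 * coframe b 4 * coframe b 5)
      + c₃ • (coframe b 0 * coframe b 1 * coframe b 2 * coframe b 3))
      * interiorProd v (rhoHat b) = 0 := by
  simp only [rhoHat, map_add, map_neg, map_smul, mul_assoc, interiorProd_coframe_mul,
    interiorProd_coframe, Algebra.algebraMap_eq_smul_one, mul_one]
  simp only [add_mul, mul_add, sub_mul, mul_sub, smul_sub, smul_mul_assoc, mul_smul_comm, mul_assoc,
    coframe_mul_swap, coframe_mul_swap_assoc, coframe_mul_self, coframe_mul_self_assoc,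
    Fin.reduceLT, smul_neg, smul_zero, mul_neg, neg_mul, neg_neg, mul_zero, zero_mul, mul_one,
    add_zero, zero_add, sub_zero, neg_zero]

/-- Hitchin's observation that ρ̂ and a volume form determine J. It is how equality of 3-forms is
turned into information on frames. -/
theorem rhoHat_mul_oneForm_mul_interiorProd {θ : Module.Dual ℝ V} (hθ : θ (b 6) = 0) (v : V) :
    rhoHat b * oneForm θ * interiorProd v (rhoHat b) =
      (2 * θ (complexStructure b v)) • vol6 b := by
  rw [oneForm_eq_sum b θ, complexStructure_apply]
  simp only [rhoHat, map_add, map_sub, map_neg, map_smul, mul_assoc, interiorProd_coframe_mul,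
    interiorProd_coframe, Algebra.algebraMap_eq_smul_one, mul_one, Fin.sum_univ_seven, hθ, zero_smul,
    add_zero, vol6, smul_eq_mul]
  simp only [add_mul, mul_add, sub_mul, mul_sub, smul_sub, smul_mul_assoc, mul_smul_comm, mul_assoc,
    coframe_mul_swap, coframe_mul_swap_assoc, coframe_mul_self, coframe_mul_self_assoc,
    Fin.reduceLT, smul_neg, smul_zero, mul_neg, neg_mul, neg_neg, mul_zero, zero_mul, mul_one,
    add_zero, zero_add, sub_zero, neg_zero]
  module

theorem coord_complexStructure_complexStructure {i : Fin 7} (hi : i ≠ 6) (v : V) :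
    b.coord i (complexStructure b (complexStructure b v)) = -b.coord i v := by
  simp only [complexStructure_apply, map_add, map_sub, map_smul, coord_basis, smul_eq_mul]
  fin_cases i <;> simp_all

theorem complexStructure_complexStructure (v : V) :
    complexStructure b (complexStructure b v) = -v + b.coord 6 v • b 6 := by
  refine b.ext_elem fun i => ?_
  show b.coord i _ = b.coord i _
  by_cases hi : i = 6
  · subst hi
    simp only [complexStructure_apply, map_add, map_sub, map_smul, coord_basis, smul_eq_mul, map_neg]
    simp
  · rw [coord_complexStructure_complexStructure b hi, map_add, map_smul, coord_basis,
      if_neg (Ne.symm hi), map_neg, smul_zero, add_zero]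

end SU3

/-! ### Comparison of two diagonal frames with proportional ρ̂. -/

namespace Heisenberg

variable {a E : Module.Basis (Fin 7) ℝ Heisenberg} {r₀ m₁ m₂ m₃ r ν₁ ν₂ ν₃ : ℝ}

theorem interiorProd_center_hodge_modelG2 (hc : center = r • E 6) :
    interiorProd center (hodge E (modelG2 E)) = (-r) • rhoHat E := by
  rw [hodge_modelG2, rhoHat]
  simp only [map_add, map_neg, mul_assoc, interiorProd_coframe_mul, interiorProd_coframe,
    center_coord hc, Fin.reduceEq, if_true, if_false, zero_smul, zero_sub, mul_neg, neg_neg,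
    map_zero, mul_zero, neg_zero, add_zero, zero_add, Algebra.algebraMap_eq_smul_one,
    mul_smul_comm, mul_one, add_mul, neg_mul]
  module

theorem center_frame (hr : 0 < r) (hc : center = r • E 6) : E 6 = r⁻¹ • center := by
  rw [hc, smul_smul, inv_mul_cancel₀ hr.ne', one_smul]

theorem hodge_modelG2_mul_interiorProd (v : Heisenberg) :
    hodge E (modelG2 E) * interiorProd v (rhoHat E) =
      rhoHat E * coframe E 6 * interiorProd v (rhoHat E) := by
  rw [hodge_modelG2_eq, add_mul, kaehlerForm_sq]
  have := diagonalFourForm_mul_interiorProd_rhoHat E 1 1 1 v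
  simp only [one_smul] at this
  rw [smul_mul_assoc, smul_mul_assoc, this, smul_zero, smul_zero, zero_add]

/-- Two diagonal frames inducing the same closed 3-form `ι_{e₇}ψ` and the same products
`ψ ∧ ι_v ι_{e₇} ψ` have proportional central covectors. -/
theorem coframe_six_eq (hr₀ : 0 < r₀) (hr : 0 < r) (ha : center = r₀ • a 6) (hE : center = r • E 6)
    (hρ : rhoHat E = (r₀ / r) • rhoHat a)
    (hψ : ∀ v, hodge E (modelG2 E) * interiorProd v (rhoHat a) =
      hodge a (modelG2 a) * interiorProd v (rhoHat a)) :
    E.coord 6 = (r / r₀) • a.coord 6 := by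
  -- The scale makes θ vanish on the centre. The hypotheses give ρ̂ ∧ θ ∧ ι_vρ̂ = 0, hence θ ∘ J =
  -- 0, and J is invertible on the first six vectors.
  set θ : Module.Dual ℝ Heisenberg := (r₀ / r) • E.coord 6 - a.coord 6 with hθdef
  have h6 : θ (a 6) = 0 := by
    rw [center_frame hr₀ ha, map_smul, hθdef, LinearMap.sub_apply, LinearMap.smul_apply,
      center_coord hE, center_coord ha, if_pos rfl, if_pos rfl]
    simp [hr.ne']
  have hform : oneForm θ = (r₀ / r) • coframe E 6 - coframe a 6 := by
    simp only [hθdef, oneForm, map_sub, map_smul, coframe]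
  have key : ∀ v, θ (complexStructure a v) = 0 := by
    intro v
    have hE' : hodge E (modelG2 E) * interiorProd v (rhoHat a) =
        (r₀ / r) • (rhoHat a * coframe E 6 * interiorProd v (rhoHat a)) := by
      have hρ' : rhoHat a = (r / r₀) • rhoHat E := by
        rw [hρ, smul_smul, div_mul_div_cancel₀ hr₀.ne', div_self hr.ne', one_smul]
      rw [← smul_mul_assoc, ← smul_mul_assoc, ← hρ]
      conv_lhs => rw [hρ', map_smul, mul_smul_comm, hodge_modelG2_mul_interiorProd]
      conv_rhs => rw [hρ', map_smul, mul_smul_comm]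
    have h := rhoHat_mul_oneForm_mul_interiorProd a h6 v
    rw [hform, mul_sub, sub_mul, mul_smul_comm, smul_mul_assoc, ← hE', hψ,
      hodge_modelG2_mul_interiorProd, sub_self] at h
    have := smul_vol6_eq_zero a h.symm
    linarith
  have hθ : θ = 0 := by
    refine a.ext fun i => ?_
    rw [LinearMap.zero_apply]
    by_cases hi : i = 6
    · rw [hi, h6]
    · have h := key (complexStructure a (a i))
      rw [complexStructure_complexStructure, coord_basis, if_neg hi, zero_smul, add_zero,
        map_neg] at h
      linarith
  have h : (r₀ / r) • E.coord 6 = a.coord 6 := sub_eq_zero.1 hθ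
  rw [← h, smul_smul, div_mul_div_cancel₀ hr₀.ne', div_self hr.ne', one_smul]

/-- The coefficients of the 2-form `x e⁰¹ + y e²³ + z e⁴⁵`. -/
def diagCoeff (x y z : ℝ) : Fin 15 → ℝ := ![x, 0, 0, 0, 0, 0, 0, 0, 0, y, 0, 0, 0, 0, z]

theorem IsDiagonalFrame.de7_eq_twoForm (h : IsDiagonalFrame a r ν₁ ν₂ ν₃) :
    Heisenberg.de7 = twoForm a (diagCoeff ν₁ ν₂ ν₃) := by
  rw [h.de7]
  simp [twoForm, diagCoeff]

theorem IsDiagonalFrame.de7_cube (h : IsDiagonalFrame a r ν₁ ν₂ ν₃) :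
    Heisenberg.de7 ^ 3 = (6 * (ν₁ * ν₂ * ν₃)) • vol6 a := by
  rw [h.de7_eq_twoForm, twoForm_cube]
  simp [pf, diagCoeff, mul_assoc]

/-- The 6-form (de⁷)³ does not depend on the frame, so it compares the two volume forms. -/
theorem IsDiagonalFrame.vol6_eq (ha : IsDiagonalFrame a r₀ m₁ m₂ m₃)
    (hE : IsDiagonalFrame E r ν₁ ν₂ ν₃) :
    vol6 E = (m₁ * m₂ * m₃ / (ν₁ * ν₂ * ν₃)) • vol6 a := by
  obtain ⟨h1, h2, h3⟩ := hE.ne_zero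
  have h := hE.de7_cube.symm.trans ha.de7_cube
  rw [mul_smul (6 : ℝ) (ν₁ * ν₂ * ν₃), mul_smul (6 : ℝ) (m₁ * m₂ * m₃)] at h
  have h' : (ν₁ * ν₂ * ν₃) • vol6 E = (m₁ * m₂ * m₃) • vol6 a :=
    smul_right_injective (Forms Heisenberg) (by norm_num : (6 : ℝ) ≠ 0) h
  have h0 : ν₁ * ν₂ * ν₃ ≠ 0 := by positivity
  rw [div_eq_inv_mul, mul_smul, ← h', smul_smul, inv_mul_cancel₀ h0, one_smul]

/-- Modulo the centre, J_E is (r₀/r)²/k times J_a. Both square to -1, so that factor is ±1. The sign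
is left open, as the argument does not exclude J_E = -J_a; hence the absolute value. -/
theorem sq_eq_of_rhoHat {k : ℝ} (hr₀ : 0 < r₀) (hr : 0 < r) (hk : k ≠ 0)
    (ha : center = r₀ • a 6) (hE : center = r • E 6)
    (hρ : rhoHat E = (r₀ / r) • rhoHat a) (hvol : vol6 E = k • vol6 a) :
    r ^ 2 * |k| = r₀ ^ 2 := by
  have key : ∀ θ : Module.Dual ℝ Heisenberg, θ center = 0 → ∀ v,
      θ (complexStructure E v) = (r₀ / r) ^ 2 / k * θ (complexStructure a v) := by
    intro θ hθ v
    have h6a : θ (a 6) = 0 := by rw [center_frame hr₀ ha, map_smul, hθ, smul_zero]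
    have h6E : θ (E 6) = 0 := by rw [center_frame hr hE, map_smul, hθ, smul_zero]
    have h1 := rhoHat_mul_oneForm_mul_interiorProd a h6a v
    have h2 := rhoHat_mul_oneForm_mul_interiorProd E h6E v
    rw [hρ, hvol, map_smul, mul_smul_comm, smul_mul_assoc, smul_mul_assoc, h1] at h2
    rw [smul_smul, smul_smul, smul_smul, ← sub_eq_zero, ← sub_smul] at h2
    have := smul_vol6_eq_zero a h2
    rw [div_mul_eq_mul_div, eq_div_iff hk]
    linarith
  have hα : a.coord 0 center = 0 := by rw [center_coord ha]; simp
  have hβ : (a.coord 0 ∘ₗ complexStructure a) center = 0 := by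
    rw [LinearMap.comp_apply, complexStructure_apply]
    simp only [center_coord ha]
    simp
  -- Evaluating a⁰ on J_E² a₀ in two stages: the comparison is available only for covectors killing
  -- the centre, which both a⁰ and a⁰ ∘ J_a do.
  have h1 := key _ hα (complexStructure E (a 0))
  have h2 := key _ hβ (a 0)
  simp only [LinearMap.comp_apply] at h2
  rw [h2, complexStructure_complexStructure, complexStructure_complexStructure, map_add, map_smul,
    center_frame hr hE, map_smul, hα, map_add, map_smul, coord_basis a 0 6, map_neg, coord_basis]
    at h1
  simp only [if_true, Fin.reduceEq, if_false, smul_eq_mul, mul_zero, add_zero] at h1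
  have h3 : ((r₀ / r) ^ 2 / k) ^ 2 = 1 := by linarith
  rw [div_pow, div_eq_one_iff_eq (by positivity), sq_eq_sq_iff_abs_eq_abs, abs_of_pos (by positivity),
    div_pow, div_eq_iff (by positivity)] at h3
  linarith

end Heisenberg

/-! ### The coflow as a vector field on the coefficients of ½ω². -/

namespace Heisenberg

variable {a E : Module.Basis (Fin 7) ℝ Heisenberg} {r₀ m₁ m₂ m₃ r ν₁ ν₂ ν₃ : ℝ}

/-- The Laplacian of `ψ = ⋆φ`, in invariant terms. -/
theorem IsDiagonalFrame.neg_laplacian_eq (h : IsDiagonalFrame E r ν₁ ν₂ ν₃) :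
    -laplacian E (hodge E (modelG2 E)) = r ^ 2 •
      (Heisenberg.de7 * Heisenberg.de7 - (ν₁ + ν₂ + ν₃) • (kaehlerForm E * Heisenberg.de7)) := by
  rw [h.laplacian_hodge_modelG2, h.de7, kaehlerForm]
  simp only [add_mul, mul_add, smul_mul_assoc, mul_smul_comm, mul_assoc, coframe_mul_swap,
    coframe_mul_swap_assoc, coframe_mul_self, coframe_mul_self_assoc, Fin.reduceLT, mul_neg,
    neg_mul, neg_neg, mul_zero, zero_mul, smul_zero, add_zero, zero_add, neg_zero]
  module

theorem IsDiagonalFrame.de7_mul_kaehlerForm_sq (h : IsDiagonalFrame E r ν₁ ν₂ ν₃) :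
    kaehlerForm E ^ 2 * Heisenberg.de7 = (2 * (ν₁ + ν₂ + ν₃)) • vol6 E := by
  rw [h.de7, kaehlerForm_sq, vol6]
  simp only [add_mul, mul_add, smul_mul_assoc, mul_smul_comm, mul_assoc, coframe_mul_swap,
    coframe_mul_swap_assoc, coframe_mul_self, coframe_mul_self_assoc, Fin.reduceLT, mul_neg,
    neg_mul, neg_neg, mul_zero, zero_mul, smul_zero, add_zero, zero_add, neg_zero]
  module

theorem kaehlerForm_cube {V : Type*} [AddCommGroup V] [Module ℝ V]
    (b : Module.Basis (Fin 7) ℝ V) : kaehlerForm b ^ 3 = (6 : ℝ) • vol6 b := by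
  have h : kaehlerForm b = twoForm b (diagCoeff 1 1 1) := by simp [twoForm, diagCoeff, kaehlerForm]
  rw [h, twoForm_cube]
  simp [pf, diagCoeff]

theorem exists_kaehlerForm_eq_twoForm (hr₀ : 0 < r₀) (ha : center = r₀ • a 6)
    (hE : center = r • E 6) : ∃ w, kaehlerForm E = twoForm a w := by
  have h : ∀ i : Fin 7, i ≠ 6 → E.coord i (a 6) = 0 := fun i hi => by
    rw [center_frame hr₀ ha, map_smul, center_coord hE, if_neg hi, smul_zero]
  rw [kaehlerForm]
  simp only [coframe]
  rw [oneForm_mul_oneForm a (h 0 (by decide)) (h 1 (by decide)),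
    oneForm_mul_oneForm a (h 2 (by decide)) (h 3 (by decide)),
    oneForm_mul_oneForm a (h 4 (by decide)) (h 5 (by decide)), ← twoForm_add, ← twoForm_add]
  exact ⟨_, rfl⟩

/-- The Laplacian coflow, written as a vector field on the coefficients of `½ ω²`. -/
noncomputable def reducedField (r₀ : ℝ) (μ s : Fin 15 → ℝ) : Fin 15 → ℝ :=
  (r₀ ^ 2 / Real.sqrt (pf s)) •
    ((2 : ℝ) • pfAdj μ - ((∑ i, s i * μ i) / pf s) • pfPolar (pfAdj s) μ)

/-- Let w be the coefficients of ω in the fixed frame, s = `pfAdj w` and k = `pf w`. Then `pf s` =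
k², r² = r₀²/|k|, the trace ν₁+ν₂+ν₃ is ⟨s, μ⟩/k, and ω has coefficients `pfAdj s`/k. The trace
multiplies ω, so the undetermined sign of k cancels and -Δψ is a function of s alone. -/
theorem exists_reducedField (ha : IsDiagonalFrame a r₀ m₁ m₂ m₃)
    (hE : IsDiagonalFrame E r ν₁ ν₂ ν₃) (hρ : rhoHat E = (r₀ / r) • rhoHat a)
    (h6 : E.coord 6 = (r / r₀) • a.coord 6) :
    ∃ s, 0 < pf s ∧ hodge E (modelG2 E) = fourForm a s + rhoHat a * coframe a 6 ∧
      -laplacian E (hodge E (modelG2 E)) =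
        fourForm a (reducedField r₀ (diagCoeff m₁ m₂ m₃) s) := by
  obtain ⟨hm₁, hm₂, hm₃⟩ := ha.ne_zero
  obtain ⟨hν₁, hν₂, hν₃⟩ := hE.ne_zero
  have hr := hE.pos
  have hr₀ := ha.pos
  set μ := diagCoeff m₁ m₂ m₃
  obtain ⟨w, hw⟩ := exists_kaehlerForm_eq_twoForm hr₀ ha.center hE.center
  have hvol := ha.vol6_eq hE
  set k := m₁ * m₂ * m₃ / (ν₁ * ν₂ * ν₃) with hk
  have hk0 : k ≠ 0 := by positivity
  have hpf : pf w = k := by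
    have h := kaehlerForm_cube E
    rw [hw, twoForm_cube, hvol, smul_smul, ← sub_eq_zero, ← sub_smul] at h
    linarith [smul_vol6_eq_zero a h]
  have hpf' : pf (pfAdj w) = k ^ 2 := by rw [pf_pfAdj, hpf]
  have hsqrt : Real.sqrt (pf (pfAdj w)) = |k| := by rw [hpf', Real.sqrt_sq_eq_abs]
  have hrk := sq_eq_of_rhoHat hr₀ hr hk0 ha.center hE.center hρ hvol
  have hsum : ∑ i, pfAdj w i * μ i = k * (ν₁ + ν₂ + ν₃) := by
    have h := hE.de7_mul_kaehlerForm_sq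
    rw [hw, twoForm_sq, ha.de7_eq_twoForm, smul_mul_assoc, fourForm_mul_twoForm, hvol, smul_smul,
      smul_smul, ← sub_eq_zero, ← sub_smul] at h
    linarith [smul_vol6_eq_zero a h]
  refine ⟨pfAdj w, by rw [hpf']; positivity, ?_, ?_⟩
  · have hc : coframe E 6 = (r / r₀) • coframe a 6 := by
      simp only [coframe, h6, oneForm, map_smul]
    rw [hodge_modelG2_eq, hw, twoForm_sq, hρ, hc, smul_smul, smul_mul_smul_comm,
      div_mul_div_cancel₀ hr.ne', div_self hr₀.ne']
    norm_num
  · rw [hE.neg_laplacian_eq, hw, ha.de7_eq_twoForm, twoForm_mul_twoForm, twoForm_mul_twoForm,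
      pfPolar_self, reducedField, hsqrt, hsum, hpf', pfAdj_pfAdj, hpf, pfPolar_smul_left,
      ← map_smul, ← map_sub, ← map_smul]
    have h1 : r₀ ^ 2 / |k| = r ^ 2 := by rw [div_eq_iff (by positivity), hrk]
    rw [h1, smul_smul]
    congr 4
    field_simp

end Heisenberg

/-! ### Maximal solutions of autonomous C¹ equations. -/

section MaximalSolution

open Set Filter Topology Metric

variable {E : Type*} [NormedAddCommGroup E] [NormedSpace ℝ E] {f : E → E} {U : Set E}

/-- `x` solves `x' = f(x)` on `J`, with values in `U`. -/
def SolvesOn (f : E → E) (U : Set E) (J : Set ℝ) (x : ℝ → E) : Prop :=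
  ∀ t ∈ J, x t ∈ U ∧ HasDerivAt x (f (x t)) t

theorem SolvesOn.mono {J J' : Set ℝ} {x : ℝ → E} (h : SolvesOn f U J x) (hJ : J' ⊆ J) :
    SolvesOn f U J' x := fun t ht => h t (hJ ht)

theorem SolvesOn.congr {J : Set ℝ} {x y : ℝ → E} (h : SolvesOn f U J x) (hJ : IsOpen J)
    (hxy : EqOn y x J) : SolvesOn f U J y := fun t ht => by
  rw [hxy ht]
  exact ⟨(h t ht).1, (h t ht).2.congr_of_eventuallyEq (hxy.eventuallyEq_of_mem (hJ.mem_nhds ht))⟩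

/-- The set of times near which the two solutions agree is open, by local uniqueness, and closed in
J, by continuity. -/
theorem SolvesOn.eqOn {J : Set ℝ} {x y : ℝ → E} (hf : ∀ p ∈ U, ContDiffAt ℝ 1 f p)
    (hJ : IsOpen J) (hJc : IsPreconnected J) (hx : SolvesOn f U J x) (hy : SolvesOn f U J y)
    {t₀ : ℝ} (ht₀ : t₀ ∈ J) (h₀ : x t₀ = y t₀) : EqOn x y J := by
  have hloc : ∀ t ∈ J, x t = y t → x =ᶠ[𝓝 t] y := by
    intro t ht hxy
    obtain ⟨K, s, hs, hl⟩ := (hf (x t) (hx t ht).1).exists_lipschitzOnWith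
    refine ODE_solution_unique_of_eventually (v := fun _ => f) (s := fun _ => s) (K := K)
      (Eventually.of_forall fun _ => hl) ?_ ?_ hxy
    · filter_upwards [hJ.mem_nhds ht, (hx t ht).2.continuousAt.preimage_mem_nhds hs] with u hu hus
      exact ⟨(hx u hu).2, hus⟩
    · rw [hxy] at hs
      filter_upwards [hJ.mem_nhds ht, (hy t ht).2.continuousAt.preimage_mem_nhds hs] with u hu hus
      exact ⟨(hy u hu).2, hus⟩
  have hsub : J ⊆ {t | x =ᶠ[𝓝 t] y} := by
    refine hJc.subset_of_closure_inter_subset ?_ ⟨t₀, ht₀, hloc t₀ ht₀ h₀⟩ ?_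
    · exact isOpen_iff_mem_nhds.2 fun t ht => ht.eventually_nhds
    · rintro t ⟨htc, ht⟩
      refine hloc t ht ?_
      have hfr : ∃ᶠ u in 𝓝 t, x u = y u :=
        (mem_closure_iff_frequently.1 htc).mono fun u hu => hu.self_of_nhds
      by_contra hne
      have := ((hx t ht).2.continuousAt.ne_iff_eventually_ne (hy t ht).2.continuousAt).1 hne
      exact hfr this
  exact fun t ht => (hsub ht).self_of_nhds

/-- The point is that ε is the same for all initial values in a ball and all initial times: this
lets a solution be continued past an endpoint at which it has a limit. -/
theorem exists_local_solution [CompleteSpace E] (hU : IsOpen U)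
    (hf : ∀ p ∈ U, ContDiffAt ℝ 1 f p) {p : E} (hp : p ∈ U) :
    ∃ r > (0 : ℝ), ∃ ε > (0 : ℝ), ∀ q ∈ closedBall p r, ∀ t₀ : ℝ, ∃ α : ℝ → E, α t₀ = q ∧
      SolvesOn f U (Ioo (t₀ - ε) (t₀ + ε)) α := by
  obtain ⟨ε, hε, a, r, L, K, hr, hpl⟩ := IsPicardLindelof.of_contDiffAt_one (hf p hp)
  obtain ⟨R, hR, hRU⟩ := nhds_basis_closedBall.mem_iff.1 (hU.mem_nhds hp)
  have hra : (r : ℝ) ≤ a := by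
    have := (hpl 0).mul_max_le
    have h2 : 0 ≤ (L : ℝ) * max ((0 + ε) - 0) (0 - (0 - ε)) :=
      mul_nonneg L.2 (le_max_of_le_left (by linarith))
    linarith
  have ha0 : 0 < a := lt_of_lt_of_le hr hra
  -- The Picard–Lindelöf radius is cut down so that the solution remains in a ball contained in U.
  set a' : NNReal := min a ⟨R, hR.le⟩ with ha'
  have ha'0 : 0 < a' := lt_min ha0 hR
  have hh : a' / 2 < a' := NNReal.half_lt_self ha'0.ne'
  obtain ⟨ε', hε', hpl'⟩ := (hpl 0).exists_shrink_radius hε (min_le_left _ _) hh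
  refine ⟨(a' / 2 : NNReal), by positivity, ε', hε', fun q hq t₀ => ?_⟩
  obtain ⟨α, hα⟩ := ODE.FunSpace.exists_isFixedPt_next hpl' hq
  have hmem : ∀ t, α.compProj t ∈ U := fun t =>
    hRU (closedBall_subset_closedBall (show ((a' : NNReal) : ℝ) ≤ R from
      NNReal.coe_le_coe.2 (min_le_right a ⟨R, hR.le⟩)) (α.compProj_mem_closedBall hpl'.mul_max_le))
  have hder : ∀ t ∈ Icc (0 - ε') (0 + ε'),
      HasDerivWithinAt α.compProj (f (α.compProj t)) (Icc (0 - ε') (0 + ε')) t := by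
    intro t ht
    apply ODE.hasDerivWithinAt_picard_Icc (f := fun _ => f) (u := closedBall p a')
      (⟨by linarith, by linarith⟩ : (0 : ℝ) ∈ Icc (0 - ε') (0 + ε')) hpl'.continuousOn_uncurry
      α.continuous_compProj.continuousOn (fun _ _ => α.compProj_mem_closedBall hpl'.mul_max_le)
      q ht |>.congr_of_mem _ ht
    intro t' ht'
    nth_rw 1 [← hα]
    rw [ODE.FunSpace.compProj_of_mem ht', ODE.FunSpace.next_apply]
  refine ⟨fun t => α.compProj (t - t₀), ?_, fun t ht => ⟨hmem _, ?_⟩⟩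
  · have : α.compProj (((⟨0, by simp [hε'.le]⟩ : Icc (0 - ε') (0 + ε')) : ℝ)) = q := by
      rw [ODE.FunSpace.compProj_val, ← hα, ODE.FunSpace.next_apply₀]
    simpa using this
  · have ht' : t - t₀ ∈ Ioo (0 - ε') (0 + ε') := ⟨by linarith [ht.1], by linarith [ht.2]⟩
    have := (hder _ (Ioo_subset_Icc_self ht')).hasDerivAt (Icc_mem_nhds ht'.1 ht'.2)
    exact this.comp_sub_const t t₀

theorem SolvesOn.union {J I : Set ℝ} {x y : ℝ → E} (hJ : IsOpen J) (hI : IsOpen I)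
    (hx : SolvesOn f U J x) (hy : SolvesOn f U I y) (hxy : EqOn x y (J ∩ I)) :
    ∃ z, EqOn z x J ∧ SolvesOn f U (J ∪ I) z := by
  classical
  have hzx : EqOn (fun t => if t ∈ J then x t else y t) x J := fun t ht => by simp [ht]
  have hzy : EqOn (fun t => if t ∈ J then x t else y t) y I := fun t ht => by
    by_cases h : t ∈ J
    · simpa [h] using hxy ⟨h, ht⟩
    · simp [h]
  refine ⟨fun t => if t ∈ J then x t else y t, hzx, ?_⟩
  rintro t (ht | ht)
  · exact hx.congr hJ hzx t ht
  · exact hy.congr hI hzy t ht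

/-- A maximal solution of an autonomous `C¹` equation; it has no limit in `U` at the ends of its
interval of existence. -/
theorem exists_maximal_solution [CompleteSpace E] (hU : IsOpen U)
    (hf : ∀ p ∈ U, ContDiffAt ℝ 1 f p) {p : E} (hp : p ∈ U) :
    ∃ (J : Set ℝ) (x : ℝ → E), IsOpen J ∧ J.OrdConnected ∧ 0 ∈ J ∧ x 0 = p ∧ SolvesOn f U J x ∧
      ∀ T ∉ J, T ∈ closure J → ∀ q ∈ U, ¬ Tendsto x (𝓝[J] T) (𝓝 q) := by
  classical
  let Good : Set ℝ → (ℝ → E) → Prop := fun J x =>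
    IsOpen J ∧ J.OrdConnected ∧ 0 ∈ J ∧ x 0 = p ∧ SolvesOn f U J x
  have hagree : ∀ {J x J' x'}, Good J x → Good J' x' → EqOn x x' (J ∩ J') := by
    rintro J x J' x' ⟨h1, h2, h3, h4, h5⟩ ⟨h1', h2', h3', h4', h5'⟩
    exact SolvesOn.eqOn hf (h1.inter h1') (h2.inter h2').isPreconnected (h5.mono inter_subset_left)
      (h5'.mono inter_subset_right) ⟨h3, h3'⟩ (h4.trans h4'.symm)
  -- The union of the domains of all solutions; they agree on overlaps, so x is well defined.
  let J : Set ℝ := {t | ∃ J' x', Good J' x' ∧ t ∈ J'}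
  let x : ℝ → E := fun t => if h : ∃ J' x', Good J' x' ∧ t ∈ J' then h.choose_spec.choose t else p
  have hx : ∀ {J' x'}, Good J' x' → EqOn x x' J' := by
    intro J' x' hg t ht
    have h : ∃ J' x', Good J' x' ∧ t ∈ J' := ⟨J', x', hg, ht⟩
    have hs := h.choose_spec.choose_spec
    simp only [x, dif_pos h]
    exact hagree hs.1 hg ⟨hs.2, ht⟩
  have hsub : ∀ {J' x'}, Good J' x' → J' ⊆ J := fun hg t ht => ⟨_, _, hg, ht⟩
  have hsol : SolvesOn f U J x := by
    rintro t ⟨J', x', hg, ht⟩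
    exact hg.2.2.2.2.congr hg.1 (hx hg) t ht
  have hJo : IsOpen J := isOpen_iff_mem_nhds.2 fun t ⟨J', x', hg, ht⟩ =>
    mem_of_superset (hg.1.mem_nhds ht) (hsub hg)
  have hJc : J.OrdConnected := by
    have : J = ⋃₀ {J' | ∃ x', Good J' x'} := by
      ext t; simp only [J, mem_ofPred_eq, mem_sUnion]
      exact ⟨fun ⟨J', x', h, ht⟩ => ⟨J', ⟨x', h⟩, ht⟩, fun ⟨J', ⟨x', h⟩, ht⟩ => ⟨J', x', h, ht⟩⟩
    rw [this]
    refine (isPreconnected_sUnion 0 _ ?_ ?_).ordConnected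
    · rintro s ⟨_, h⟩; exact h.2.2.1
    · rintro s ⟨_, h⟩; exact h.2.1.isPreconnected
  obtain ⟨r, hr, ε, hε, hloc⟩ := exists_local_solution hU hf hp
  obtain ⟨α, hα0, hα⟩ := hloc p (mem_closedBall_self hr.le) 0
  have hg0 : Good (Ioo (0 - ε) (0 + ε)) α :=
    ⟨isOpen_Ioo, ordConnected_Ioo, ⟨by linarith, by linarith⟩, hα0, hα⟩
  have h0 : (0 : ℝ) ∈ J := hsub hg0 hg0.2.2.1
  have hx0 : x 0 = p := (hx hg0 hg0.2.2.1).trans hα0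
  refine ⟨J, x, hJo, hJc, h0, hx0, hsol, fun T hT hTc q hq hlim => hT ?_⟩
  obtain ⟨r, hr, ε, hε, hloc⟩ := exists_local_solution hU hf hq
  have : (𝓝[J] T).NeBot := mem_closure_iff_nhdsWithin_neBot.1 hTc
  -- Restart from a time t₁ within ε of T at which x is already close to q: the restarted solution
  -- lives beyond T.
  obtain ⟨t₁, ⟨h1, h2⟩, h3⟩ := ((hlim.eventually (closedBall_mem_nhds q hr)).and
    (mem_nhdsWithin_of_mem_nhds (Ioo_mem_nhds (show T - ε < T by linarith)
      (show T < T + ε by linarith))) |>.and self_mem_nhdsWithin).exists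
  obtain ⟨β, hβ0, hβ⟩ := hloc (x t₁) h1 t₁
  have ht₁ : t₁ ∈ Ioo (t₁ - ε) (t₁ + ε) := ⟨by linarith, by linarith⟩
  have hxβ : EqOn x β (J ∩ Ioo (t₁ - ε) (t₁ + ε)) :=
    SolvesOn.eqOn hf (hJo.inter isOpen_Ioo) (hJc.inter ordConnected_Ioo).isPreconnected
      (hsol.mono inter_subset_left) (hβ.mono inter_subset_right) ⟨h3, ht₁⟩ hβ0.symm
  obtain ⟨z, hz, hzs⟩ := hsol.union hJo isOpen_Ioo hβ hxβ
  have hg : Good (J ∪ Ioo (t₁ - ε) (t₁ + ε)) z :=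
    ⟨hJo.union isOpen_Ioo, (IsPreconnected.union t₁ h3 ht₁ hJc.isPreconnected
      ordConnected_Ioo.isPreconnected).ordConnected, Or.inl h0, (hz h0).trans hx0, hzs⟩
  exact hsub hg (Or.inr ⟨by linarith [h2.2], by linarith [h2.1]⟩)

end MaximalSolution

/-! ### The system for λ₁, λ₂, λ₃: extinction forwards, existence for all past times. -/

section DiagonalSystem

open Set Filter Topology Metric

theorem le_of_hasDerivAt_nonneg {g g' : ℝ → ℝ} {u v : ℝ} (huv : u ≤ v)
    (h : ∀ s ∈ Icc u v, HasDerivAt g (g' s) s) (h0 : ∀ s ∈ Icc u v, 0 ≤ g' s) : g u ≤ g v := by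
  refine monotoneOn_of_deriv_nonneg (convex_Icc u v)
    (fun s hs => (h s hs).continuousAt.continuousWithinAt)
    (fun s hs => (h s (interior_subset hs)).differentiableAt.differentiableWithinAt)
    (fun s hs => ?_) (left_mem_Icc.2 huv) (right_mem_Icc.2 huv) huv
  rw [(h s (interior_subset hs)).deriv]
  exact h0 s (interior_subset hs)

/-- A bounded derivative makes g Lipschitz near the end, and a Lipschitz function extends
continuously to the whole line. -/
theorem tendsto_left_end_of_bounded_deriv {g g' : ℝ → ℝ} {a v B : ℝ} {J : Set ℝ} (hav : a < v)
    (hJ : ∀ t ∈ J, a < t) (h : ∀ s ∈ Ioo a v, HasDerivAt g (g' s) s)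
    (hB : ∀ s ∈ Ioo a v, |g' s| ≤ B) : ∃ q, Tendsto g (𝓝[J] a) (𝓝 q) := by
  have hB0 : 0 ≤ B := (abs_nonneg _).trans (hB ((a + v) / 2) ⟨by linarith, by linarith⟩)
  have hlip : LipschitzOnWith B.toNNReal g (Ioo a v) :=
    (convex_Ioo a v).lipschitzOnWith_of_nnnorm_hasDerivWithin_le
      (fun s hs => (h s hs).hasDerivWithinAt) fun s hs => by
        rw [← NNReal.coe_le_coe, Real.coe_toNNReal _ hB0]; exact hB s hs
  obtain ⟨G, hG, hgG⟩ := hlip.extend_real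
  refine ⟨G a, (hG.continuous.continuousAt.tendsto.mono_left nhdsWithin_le_nhds).congr' ?_⟩
  filter_upwards [self_mem_nhdsWithin, mem_nhdsWithin_of_mem_nhds (Iio_mem_nhds hav)] with t h1 h2
  exact (hgG ⟨hJ t h1, h2⟩).symm

/-- The positive octant. -/
def octant : Set (ℝ × ℝ × ℝ) := {p | 0 < p.1 ∧ 0 < p.2.1 ∧ 0 < p.2.2}

theorem isOpen_octant : IsOpen octant :=
  (isOpen_lt continuous_const continuous_fst).inter
    ((isOpen_lt continuous_const (continuous_fst.comp continuous_snd)).inter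
      (isOpen_lt continuous_const (continuous_snd.comp continuous_snd)))

/-- The right-hand side of the coflow in diagonal form. -/
noncomputable def diagonalField (n₁ n₂ n₃ : ℝ) (p : ℝ × ℝ × ℝ) : ℝ × ℝ × ℝ :=
  (-((p.2.1 * p.2.2 + n₂ * n₃ * p.1 ^ 2) / (p.1 ^ 2 * p.2.1 ^ 2 * p.2.2 ^ 2)),
    -((p.1 * p.2.2 + n₁ * n₃ * p.2.1 ^ 2) / (p.1 ^ 2 * p.2.1 ^ 2 * p.2.2 ^ 2)),
    -((p.1 * p.2.1 + n₁ * n₂ * p.2.2 ^ 2) / (p.1 ^ 2 * p.2.1 ^ 2 * p.2.2 ^ 2)))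

theorem contDiffAt_diagonalField (n₁ n₂ n₃ : ℝ) {p : ℝ × ℝ × ℝ} (hp : p ∈ octant) :
    ContDiffAt ℝ 1 (diagonalField n₁ n₂ n₃) p := by
  obtain ⟨h1, h2, h3⟩ := hp
  have h0 : p.1 ^ 2 * p.2.1 ^ 2 * p.2.2 ^ 2 ≠ 0 := by positivity
  unfold diagonalField
  refine ContDiffAt.prodMk (ContDiffAt.neg (ContDiffAt.div ?_ ?_ h0))
    (ContDiffAt.prodMk (ContDiffAt.neg (ContDiffAt.div ?_ ?_ h0))
      (ContDiffAt.neg (ContDiffAt.div ?_ ?_ h0))) <;> fun_prop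

theorem SolvesOn.hasDerivAt_coord {n₁ n₂ n₃ : ℝ} {J : Set ℝ} {x : ℝ → ℝ × ℝ × ℝ}
    (h : SolvesOn (diagonalField n₁ n₂ n₃) octant J x) {t : ℝ} (ht : t ∈ J) :
    HasDerivAt (fun t => (x t).1) (diagonalField n₁ n₂ n₃ (x t)).1 t ∧
    HasDerivAt (fun t => (x t).2.1) (diagonalField n₁ n₂ n₃ (x t)).2.1 t ∧
    HasDerivAt (fun t => (x t).2.2) (diagonalField n₁ n₂ n₃ (x t)).2.2 t := by
  have h1 := (h t ht).2
  have h2 := (ContinuousLinearMap.snd ℝ ℝ (ℝ × ℝ)).hasFDerivAt.comp_hasDerivAt t h1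
  exact ⟨(ContinuousLinearMap.fst ℝ ℝ (ℝ × ℝ)).hasFDerivAt.comp_hasDerivAt t h1,
    (ContinuousLinearMap.fst ℝ ℝ ℝ).hasFDerivAt.comp_hasDerivAt t h2,
    (ContinuousLinearMap.snd ℝ ℝ ℝ).hasFDerivAt.comp_hasDerivAt t h2⟩

/-- The volume `λ₁λ₂λ₃` of a point of the octant. -/
def octantVolume (p : ℝ × ℝ × ℝ) : ℝ := p.1 * p.2.1 * p.2.2

/-- The mixed terms complete a square: the slack in the inequality is exactly (n₁λ₂λ₃ + n₂λ₁λ₃ +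
n₃λ₁λ₂)²/(2V²). The estimate is therefore the same for all choices of signs. -/
theorem SolvesOn.hasDerivAt_volume {n₁ n₂ n₃ : ℝ} (hn₁ : n₁ ^ 2 = 1) (hn₂ : n₂ ^ 2 = 1)
    (hn₃ : n₃ ^ 2 = 1) {J : Set ℝ} {x : ℝ → ℝ × ℝ × ℝ}
    (h : SolvesOn (diagonalField n₁ n₂ n₃) octant J x) {t : ℝ} (ht : t ∈ J) :
    ∃ v, HasDerivAt (fun t => octantVolume (x t)) v t ∧
      v ≤ -(1 / 2) * (((x t).1 * (x t).2.1) ^ 2 + ((x t).1 * (x t).2.2) ^ 2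
        + ((x t).2.1 * (x t).2.2) ^ 2) / octantVolume (x t) ^ 2 := by
  obtain ⟨d1, d2, d3⟩ := h.hasDerivAt_coord ht
  obtain ⟨p1, p2, p3⟩ := (h t ht).1
  refine ⟨_, (d1.mul d2).mul d3, ?_⟩
  simp only [diagonalField, octantVolume, Pi.mul_apply]
  generalize (x t).1 = a at *
  generalize (x t).2.1 = b at *
  generalize (x t).2.2 = c at *
  rw [← sub_nonneg]
  have : -(1 / 2) * ((a * b) ^ 2 + (a * c) ^ 2 + (b * c) ^ 2) / (a * b * c) ^ 2 -
    ((-((b * c + n₂ * n₃ * a ^ 2) / (a ^ 2 * b ^ 2 * c ^ 2)) * b +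
      a * -((a * c + n₁ * n₃ * b ^ 2) / (a ^ 2 * b ^ 2 * c ^ 2))) * c +
      a * b * -((a * b + n₁ * n₂ * c ^ 2) / (a ^ 2 * b ^ 2 * c ^ 2))) =
    (1 / 2) * (n₁ * (b * c) + n₂ * (a * c) + n₃ * (a * b)) ^ 2 / (a * b * c) ^ 2 := by
    field_simp
    linear_combination (- b ^ 2 * c ^ 2) * hn₁ - (a ^ 2 * c ^ 2) * hn₂ - (a ^ 2 * b ^ 2) * hn₃
  rw [this]
  positivity

theorem three_mul_rpow_le {a b c : ℝ} (ha : 0 < a) (hb : 0 < b) (hc : 0 < c) :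
    3 * (a * b * c) ^ (4 / 3 : ℝ) ≤ (a * b) ^ 2 + (a * c) ^ 2 + (b * c) ^ 2 := by
  have h := Real.geom_mean_le_arith_mean3_weighted (w₁ := 1 / 3) (w₂ := 1 / 3) (w₃ := 1 / 3)
    (p₁ := (a * b) ^ 2) (p₂ := (a * c) ^ 2) (p₃ := (b * c) ^ 2) (by norm_num) (by norm_num)
    (by norm_num) (by positivity) (by positivity) (by positivity) (by norm_num)
  rw [← Real.mul_rpow (by positivity) (by positivity),
    ← Real.mul_rpow (by positivity) (by positivity)] at h
  have e : (a * b) ^ 2 * (a * c) ^ 2 * (b * c) ^ 2 = (a * b * c) ^ (4 : ℝ) := by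
    rw [show (4 : ℝ) = ((4 : ℕ) : ℝ) by norm_num, Real.rpow_natCast]; ring
  rw [e, ← Real.rpow_mul (by positivity), show (4 : ℝ) * (1 / 3) = 4 / 3 by norm_num] at h
  linarith

/-- The forward time of existence is bounded in terms of the initial volume. -/
theorem SolvesOn.time_lt {n₁ n₂ n₃ : ℝ} (hn₁ : n₁ ^ 2 = 1) (hn₂ : n₂ ^ 2 = 1)
    (hn₃ : n₃ ^ 2 = 1) {t : ℝ} (ht : 0 ≤ t) {x : ℝ → ℝ × ℝ × ℝ}
    (h : SolvesOn (diagonalField n₁ n₂ n₃) octant (Icc 0 t) x) :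
    t < 2 / 5 * octantVolume (x 0) ^ (5 / 3 : ℝ) := by
  have hpos : ∀ s ∈ Icc 0 t, 0 < octantVolume (x s) := fun s hs => by
    obtain ⟨p1, p2, p3⟩ := (h s hs).1
    unfold octantVolume; positivity
  choose! v hv hv' using fun s (hs : s ∈ Icc 0 t) => h.hasDerivAt_volume hn₁ hn₂ hn₃ hs
  -- AM-GM turns the volume estimate into V' ≤ -(3/2) V^{-2/3}, that is, (V^{5/3})' ≤ -5/2.
  have hd : ∀ s ∈ Icc 0 t, HasDerivAt (fun s => -octantVolume (x s) ^ (5 / 3 : ℝ) - 5 / 2 * s)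
      (-(v s * (5 / 3) * octantVolume (x s) ^ (5 / 3 - 1 : ℝ)) - 5 / 2) s := fun s hs => by
    have h1 := ((hv s hs).rpow_const (p := 5 / 3) (Or.inl (hpos s hs).ne')).neg
    have h2 := (hasDerivAt_id s).const_mul (5 / 2 : ℝ)
    exact (h1.sub h2).congr_deriv (by simp)
  have := le_of_hasDerivAt_nonneg ht hd fun s hs => by
    have hp := hpos s hs
    obtain ⟨p1, p2, p3⟩ := (h s hs).1
    have h3 := three_mul_rpow_le p1 p2 p3
    have h4 := hv' s hs
    have h5 : v s ≤ -(3 / 2) * octantVolume (x s) ^ (-(2 / 3) : ℝ) := by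
      refine h4.trans ?_
      have e : octantVolume (x s) ^ (-(2 / 3) : ℝ) =
          octantVolume (x s) ^ (4 / 3 : ℝ) / octantVolume (x s) ^ 2 := by
        rw [← Real.rpow_natCast, ← Real.rpow_sub hp]; norm_num
      rw [e, mul_div_assoc, mul_div_assoc', mul_div_assoc', div_le_div_iff_of_pos_right (by positivity)]
      unfold octantVolume
      linarith
    have h6 : octantVolume (x s) ^ (-(2 / 3) : ℝ) * octantVolume (x s) ^ (5 / 3 - 1 : ℝ) = 1 := by
      rw [← Real.rpow_add hp]; norm_num
    have h7 : 0 < octantVolume (x s) ^ (5 / 3 - 1 : ℝ) := Real.rpow_pos_of_pos hp _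
    nlinarith
  have h8 : 0 < octantVolume (x t) ^ (5 / 3 : ℝ) :=
    Real.rpow_pos_of_pos (hpos t (right_mem_Icc.2 ht)) _
  linarith

theorem SolvesOn.volume_le {n₁ n₂ n₃ : ℝ} (hn₁ : n₁ ^ 2 = 1) (hn₂ : n₂ ^ 2 = 1)
    (hn₃ : n₃ ^ 2 = 1) {u w : ℝ} (huw : u ≤ w) {x : ℝ → ℝ × ℝ × ℝ}
    (h : SolvesOn (diagonalField n₁ n₂ n₃) octant (Icc u w) x) :
    octantVolume (x w) ≤ octantVolume (x u) := by
  choose! v hv hv' using fun s (hs : s ∈ Icc u w) => h.hasDerivAt_volume hn₁ hn₂ hn₃ hs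
  refine neg_le_neg_iff.1 (le_of_hasDerivAt_nonneg (g := fun s => -octantVolume (x s))
    (g' := fun s => -v s) huw (fun s hs => (hv s hs).neg) fun s hs => ?_)
  have := hv' s hs
  have h2 : 0 ≤ (1 / 2) * (((x s).1 * (x s).2.1) ^ 2 + ((x s).1 * (x s).2.2) ^ 2
        + ((x s).2.1 * (x s).2.2) ^ 2) / octantVolume (x s) ^ 2 := by positivity
  rw [neg_mul, neg_div] at this
  linarith

/-- Lower bound for one eigenvalue, backwards in time. -/
theorem inv_le_of_backward {n u V₀ : ℝ} (hn : n ^ 2 = 1) (hu : u ≤ 0) (hV₀ : 0 < V₀)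
    {p q : ℝ → ℝ} (hp : ∀ s ∈ Icc u 0, 0 < p s) (hq : ∀ s ∈ Icc u 0, 0 < q s)
    (hV : ∀ s ∈ Icc u 0, V₀ ≤ p s * q s)
    (hd : ∀ s ∈ Icc u 0, HasDerivAt p (-((q s + n * p s ^ 2) / (p s ^ 2 * q s ^ 2))) s) :
    (p u)⁻¹ ≤ (p 0)⁻¹ - u / V₀ ^ 2 := by
  have hn1 : -1 ≤ n := by nlinarith
  -- With q the product of the other two eigenvalues, (1/p)' = q/(p²(pq)²) + n/(pq)². The first term
  -- is positive and the second is at least -1/V₀², so this function increases.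
  have hd' : ∀ s ∈ Icc u 0, HasDerivAt (fun s => (p s)⁻¹ + s / V₀ ^ 2)
      (-(-((q s + n * p s ^ 2) / (p s ^ 2 * q s ^ 2))) / p s ^ 2 + 1 / V₀ ^ 2) s := fun s hs =>
    ((hd s hs).inv (hp s hs).ne').add ((hasDerivAt_id s).div_const _)
  have := le_of_hasDerivAt_nonneg hu hd' fun s hs => by
    have h1 := hp s hs
    have h2 := hq s hs
    have h3 := hV s hs
    have h4 : 1 / (p s * q s) ^ 2 ≤ 1 / V₀ ^ 2 := by gcongr
    have h5 : -(-((q s + n * p s ^ 2) / (p s ^ 2 * q s ^ 2))) / p s ^ 2 =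
        q s / (p s ^ 2 * (p s * q s) ^ 2) + n * (1 / (p s * q s) ^ 2) := by
      field_simp
    have h6 : 0 ≤ q s / (p s ^ 2 * (p s * q s) ^ 2) := by positivity
    have h7 : 0 < 1 / (p s * q s) ^ 2 := by positivity
    rw [h5]
    nlinarith
  simp only [zero_div, add_zero] at this
  linarith

end DiagonalSystem

section DiagonalSystem

open Set Filter Topology Metric

theorem abs_rate_le {n a b c m V₀ : ℝ} (hn : n ^ 2 = 1) (hm : 0 < m) (hV₀ : 0 < V₀) (ha : m ≤ a)
    (hb : m ≤ b) (hc : m ≤ c) (hV : V₀ ≤ a * b * c) :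
    |-((b * c + n * a ^ 2) / (a ^ 2 * b ^ 2 * c ^ 2))| ≤ 1 / (m * V₀) + 1 / (m ^ 2 * m ^ 2) := by
  have ha0 := hm.trans_le ha
  have hb0 := hm.trans_le hb
  have hc0 := hm.trans_le hc
  have hn1 : |n| = 1 := by
    rw [← sq_abs] at hn
    nlinarith [abs_nonneg n]
  have e : (b * c + n * a ^ 2) / (a ^ 2 * b ^ 2 * c ^ 2) =
      1 / (a * (a * b * c)) + n * (1 / (b ^ 2 * c ^ 2)) := by
    field_simp
  rw [abs_neg, e]
  refine (abs_add_le _ _).trans (add_le_add ?_ ?_)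
  · rw [abs_of_pos (by positivity)]
    gcongr
  · rw [abs_mul, hn1, one_mul, abs_of_pos (by positivity)]
    gcongr

/-- Backwards in time a solution of the diagonal system has a limit in the octant. -/
theorem SolvesOn.exists_tendsto_left {n₁ n₂ n₃ : ℝ} (hn₁ : n₁ ^ 2 = 1) (hn₂ : n₂ ^ 2 = 1)
    (hn₃ : n₃ ^ 2 = 1) {J : Set ℝ} {x : ℝ → ℝ × ℝ × ℝ} {a : ℝ} (ha : a < 0)
    (hJ : ∀ t ∈ J, a < t) (hIoc : Ioc a 0 ⊆ J) (haJ : a ∈ closure J)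
    (h : SolvesOn (diagonalField n₁ n₂ n₃) octant J x) :
    ∃ q ∈ octant, Tendsto x (𝓝[J] a) (𝓝 q) := by
  have hIcc : ∀ {u}, u ∈ Ioc a 0 → Icc u 0 ⊆ J := fun {u} hu s hs =>
    hIoc ⟨hu.1.trans_le hs.1, hs.2⟩
  set V₀ := octantVolume (x 0) with hV₀def
  have hpos : ∀ s ∈ J, 0 < octantVolume (x s) := fun s hs => by
    obtain ⟨p1, p2, p3⟩ := (h s hs).1
    unfold octantVolume; positivity
  have h0J : (0 : ℝ) ∈ J := hIoc ⟨ha, le_rfl⟩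
  have hV₀ : 0 < V₀ := hpos 0 h0J
  have hvol : ∀ s ∈ Ioc a 0, V₀ ≤ octantVolume (x s) := fun s hs =>
    SolvesOn.volume_le hn₁ hn₂ hn₃ hs.2 (h.mono (hIcc hs))
  obtain ⟨r1, r2, r3⟩ := (h 0 h0J).1
  have hprod : ∀ {p q : ℝ}, p ^ 2 = 1 → q ^ 2 = 1 → (p * q) ^ 2 = 1 := fun hp hq => by
    rw [mul_pow, hp, hq, one_mul]
  -- A common upper bound for the three inverses on (a, 0]; since a is finite, C⁻¹ is a positive
  -- lower bound for the λⱼ.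
  set C := ((x 0).1)⁻¹ + ((x 0).2.1)⁻¹ + ((x 0).2.2)⁻¹ - a / V₀ ^ 2 with hC
  have hC0 : 0 < C := by
    have : 0 < -a / V₀ ^ 2 := div_pos (by linarith) (by positivity)
    have e : C = ((x 0).1)⁻¹ + ((x 0).2.1)⁻¹ + ((x 0).2.2)⁻¹ + -a / V₀ ^ 2 := by rw [hC]; ring
    rw [e]; positivity
  have hCle : ∀ {y z w u : ℝ}, u ∈ Ioc a 0 → 0 < y → y⁻¹ ≤ z⁻¹ - u / V₀ ^ 2 →
      z⁻¹ ≤ ((x 0).1)⁻¹ + ((x 0).2.1)⁻¹ + ((x 0).2.2)⁻¹ → C⁻¹ ≤ y := by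
    intro y z w u hu hy h1 h2
    have : a / V₀ ^ 2 ≤ u / V₀ ^ 2 := by gcongr; exact hu.1.le
    exact inv_le_of_inv_le₀ hy (by linarith)
  have i1 : 0 < ((x 0).1)⁻¹ := by positivity
  have i2 : 0 < ((x 0).2.1)⁻¹ := by positivity
  have i3 : 0 < ((x 0).2.2)⁻¹ := by positivity
  have hlow : ∀ u ∈ Ioc a 0, C⁻¹ ≤ (x u).1 ∧ C⁻¹ ≤ (x u).2.1 ∧ C⁻¹ ≤ (x u).2.2 := by
    intro u hu
    have hs : ∀ s ∈ Icc u 0, s ∈ Ioc a 0 := fun s hs => ⟨hu.1.trans_le hs.1, hs.2⟩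
    have hm := fun s (hss : s ∈ Icc u 0) => (h s (hIcc hu hss)).1
    have hder := fun s (hss : s ∈ Icc u 0) => h.hasDerivAt_coord (hIcc hu hss)
    refine ⟨hCle (w := 0) hu (h u (hIoc hu)).1.1 (inv_le_of_backward (hprod hn₂ hn₃) hu.2 hV₀
        (p := fun s => (x s).1) (q := fun s => (x s).2.1 * (x s).2.2)
        (fun s hss => (hm s hss).1) (fun s hss => mul_pos (hm s hss).2.1 (hm s hss).2.2)
        (fun s hss => ?_) (fun s hss => (hder s hss).1.congr_deriv ?_)) (by linarith),
      hCle (w := 0) hu (h u (hIoc hu)).1.2.1 (inv_le_of_backward (hprod hn₁ hn₃) hu.2 hV₀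
        (p := fun s => (x s).2.1) (q := fun s => (x s).1 * (x s).2.2)
        (fun s hss => (hm s hss).2.1) (fun s hss => mul_pos (hm s hss).1 (hm s hss).2.2)
        (fun s hss => ?_) (fun s hss => (hder s hss).2.1.congr_deriv ?_)) (by linarith),
      hCle (w := 0) hu (h u (hIoc hu)).1.2.2 (inv_le_of_backward (hprod hn₁ hn₂) hu.2 hV₀
        (p := fun s => (x s).2.2) (q := fun s => (x s).1 * (x s).2.1)
        (fun s hss => (hm s hss).2.2) (fun s hss => mul_pos (hm s hss).1 (hm s hss).2.1)
        (fun s hss => ?_) (fun s hss => (hder s hss).2.2.congr_deriv ?_)) (by linarith)⟩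
    · have := hvol s (hs s hss); unfold octantVolume at this; linarith
    · simp only [diagonalField]; ring
    · have := hvol s (hs s hss); unfold octantVolume at this; linarith
    · simp only [diagonalField]; ring
    · have := hvol s (hs s hss); unfold octantVolume at this; linarith
    · simp only [diagonalField]; ring
  have hm : 0 < C⁻¹ := inv_pos.2 hC0
  have hsub : ∀ s ∈ Ioo a 0, s ∈ Ioc a 0 := fun s hs => ⟨hs.1, hs.2.le⟩
  have hv : ∀ s ∈ Ioo a 0, V₀ ≤ (x s).1 * (x s).2.1 * (x s).2.2 := fun s hs => hvol s (hsub s hs)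
  obtain ⟨q1, hq1⟩ := tendsto_left_end_of_bounded_deriv ha hJ
    (fun s hs => (h.hasDerivAt_coord (hIoc (hsub s hs))).1) fun s hs => by
      obtain ⟨l1, l2, l3⟩ := hlow s (hsub s hs)
      exact abs_rate_le (hprod hn₂ hn₃) hm hV₀ l1 l2 l3 (hv s hs)
  obtain ⟨q2, hq2⟩ := tendsto_left_end_of_bounded_deriv ha hJ
    (fun s hs => (h.hasDerivAt_coord (hIoc (hsub s hs))).2.1) fun s hs => by
      obtain ⟨l1, l2, l3⟩ := hlow s (hsub s hs)
      have := abs_rate_le (hprod hn₁ hn₃) hm hV₀ l2 l1 l3 ((hv s hs).trans_eq (by ring))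
      rwa [mul_comm ((x s).2.1 ^ 2)] at this
  obtain ⟨q3, hq3⟩ := tendsto_left_end_of_bounded_deriv ha hJ
    (fun s hs => (h.hasDerivAt_coord (hIoc (hsub s hs))).2.2) fun s hs => by
      obtain ⟨l1, l2, l3⟩ := hlow s (hsub s hs)
      have := abs_rate_le (hprod hn₁ hn₂) hm hV₀ l3 l1 l2 ((hv s hs).trans_eq (by ring))
      rwa [mul_assoc ((x s).2.2 ^ 2), mul_comm ((x s).2.2 ^ 2)] at this
  have : (𝓝[J] a).NeBot := mem_closure_iff_nhdsWithin_neBot.1 haJ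
  have hev : ∀ᶠ s in 𝓝[J] a, s ∈ Ioc a 0 := by
    filter_upwards [self_mem_nhdsWithin, mem_nhdsWithin_of_mem_nhds (Iio_mem_nhds ha)] with t h1 h2
    exact ⟨hJ t h1, (show t < 0 from h2).le⟩
  refine ⟨(q1, q2, q3), ⟨?_, ?_, ?_⟩, hq1.prodMk_nhds (hq2.prodMk_nhds hq3)⟩
  · exact hm.trans_le (ge_of_tendsto hq1 (hev.mono fun s hs => (hlow s hs).1))
  · exact hm.trans_le (ge_of_tendsto hq2 (hev.mono fun s hs => (hlow s hs).2.1))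
  · exact hm.trans_le (ge_of_tendsto hq3 (hev.mono fun s hs => (hlow s hs).2.2))

/-- The maximal solution of the diagonal system is ancient, with finite extinction time. -/
theorem exists_ancient_diagonal_solution {n₁ n₂ n₃ : ℝ} (hn₁ : n₁ ^ 2 = 1) (hn₂ : n₂ ^ 2 = 1)
    (hn₃ : n₃ ^ 2 = 1) {p : ℝ × ℝ × ℝ} (hp : p ∈ octant) :
    ∃ (T : ℝ) (x : ℝ → ℝ × ℝ × ℝ), 0 < T ∧ T ≤ 2 / 5 * octantVolume p ^ (5 / 3 : ℝ) ∧ x 0 = p ∧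
      SolvesOn (diagonalField n₁ n₂ n₃) octant (Iio T) x ∧
      ∀ q ∈ octant, ¬ Tendsto x (𝓝[<] T) (𝓝 q) := by
  obtain ⟨J, x, hJo, hJc, h0, hx0, hsol, hlim⟩ := exists_maximal_solution isOpen_octant
    (fun p hp => contDiffAt_diagonalField n₁ n₂ n₃ hp) hp
  -- If a past time were missing, J would have a finite left end, where the solution has a limit in
  -- the octant; that contradicts maximality.
  have hbelow : ∀ c ≤ 0, c ∈ J := by
    intro c hc
    by_contra hcJ
    have hbd : ∀ t ∈ J, c < t := fun t ht => by
      by_contra hct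
      exact hcJ (hJc.out ht h0 ⟨not_lt.1 hct, hc⟩)
    have hbb : BddBelow J := ⟨c, fun t ht => (hbd t ht).le⟩
    have haJ : sInf J ∉ J := fun hmem => by
      obtain ⟨ε, hε, hball⟩ := Metric.isOpen_iff.1 hJo _ hmem
      have : sInf J - ε / 2 ∈ J := hball (by
        rw [Metric.mem_ball, Real.dist_eq, show sInf J - ε / 2 - sInf J = -(ε / 2) by ring, abs_neg,
          abs_of_pos (by linarith)]
        linarith)
      linarith [csInf_le hbb this]
    have hcl : sInf J ∈ closure J := csInf_mem_closure ⟨0, h0⟩ hbb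
    have hJlt : ∀ t ∈ J, sInf J < t := fun t ht =>
      lt_of_le_of_ne (csInf_le hbb ht) fun h => haJ (h ▸ ht)
    have hIoc : Ioc (sInf J) 0 ⊆ J := fun t ht => by
      obtain ⟨u, hu, hut⟩ := exists_lt_of_csInf_lt ⟨0, h0⟩ ht.1
      exact hJc.out hu h0 ⟨hut.le, ht.2⟩
    obtain ⟨q, hq, hqlim⟩ := SolvesOn.exists_tendsto_left hn₁ hn₂ hn₃ (hJlt 0 h0) hJlt hIoc hcl hsol
    exact hlim _ haJ hcl q hq hqlim
  have hlt : ∀ t ∈ J, 0 ≤ t → t < 2 / 5 * octantVolume p ^ (5 / 3 : ℝ) := fun t ht h => by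
    rw [← hx0]
    exact (hsol.mono (hJc.out h0 ht)).time_lt hn₁ hn₂ hn₃ h
  have hpV : 0 ≤ 2 / 5 * octantVolume p ^ (5 / 3 : ℝ) := (hlt 0 h0 le_rfl).le
  have hle : ∀ t ∈ J, t ≤ 2 / 5 * octantVolume p ^ (5 / 3 : ℝ) := fun t ht => by
    rcases le_total 0 t with h | h
    · exact (hlt t ht h).le
    · linarith
  have hba : BddAbove J := ⟨_, hle⟩
  have hTJ : sSup J ∉ J := fun hmem => by
    obtain ⟨ε, hε, hball⟩ := Metric.isOpen_iff.1 hJo _ hmem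
    have : sSup J + ε / 2 ∈ J := hball (by
      rw [Metric.mem_ball, Real.dist_eq, show sSup J + ε / 2 - sSup J = ε / 2 by ring,
        abs_of_pos (by linarith)]
      linarith)
    linarith [le_csSup hba this]
  have hJeq : J = Iio (sSup J) := by
    ext t
    constructor
    · exact fun ht => lt_of_le_of_ne (le_csSup hba ht) fun h => hTJ (h ▸ ht)
    · intro ht
      obtain ⟨u, hu, htu⟩ := exists_lt_of_lt_csSup ⟨0, h0⟩ ht
      rcases le_total t 0 with h | h
      · exact hbelow t h
      · exact hJc.out h0 hu ⟨h, htu.le⟩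
  have hT0 : 0 < sSup J := by
    have := h0
    rw [hJeq] at this
    exact this
  refine ⟨sSup J, x, hT0, csSup_le ⟨0, h0⟩ hle, hx0, hJeq ▸ hsol, fun q hq h => ?_⟩
  refine hlim _ hTJ (csSup_mem_closure ⟨0, h0⟩ hba) q hq ?_
  rwa [hJeq, csSup_Iio]

end DiagonalSystem

/-! ### Reduction of an arbitrary coflow solution to an ordinary differential equation. -/

theorem contDiff_pf : ContDiff ℝ 1 pf := by
  unfold pf
  fun_prop

theorem contDiff_pfAdj : ContDiff ℝ 1 pfAdj := by
  refine contDiff_pi.2 fun i => ?_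
  fin_cases i <;> simp only [pfAdj] <;> dsimp <;> fun_prop

theorem contDiff_pfPolar_left (μ : Fin 15 → ℝ) : ContDiff ℝ 1 fun s => pfPolar s μ := by
  refine contDiff_pi.2 fun i => ?_
  fin_cases i <;> simp only [pfPolar] <;> dsimp <;> fun_prop

namespace Heisenberg

theorem contDiffAt_reducedField (r₀ : ℝ) (μ : Fin 15 → ℝ) {s : Fin 15 → ℝ} (hs : 0 < pf s) :
    ContDiffAt ℝ 1 (reducedField r₀ μ) s := by
  have h1 : ContDiffAt ℝ 1 pf s := contDiff_pf.contDiffAt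
  have h2 : ContDiffAt ℝ 1 (fun s => pfPolar (pfAdj s) μ) s :=
    ((contDiff_pfPolar_left μ).comp contDiff_pfAdj).contDiffAt
  have h3 : ContDiffAt ℝ 1 (fun s : Fin 15 → ℝ => ∑ i, s i * μ i) s := by fun_prop
  unfold reducedField
  exact (contDiffAt_const.div (h1.sqrt hs.ne') (Real.sqrt_pos.2 hs).ne').smul
    (contDiffAt_const.sub ((h3.div h1 hs.ne').smul h2))

theorem laplacian_eq_of_sameG2 {b b' : Module.Basis (Fin 7) ℝ Heisenberg} (h : SameG2 b b') :
    laplacian b' = laplacian b := by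
  funext α
  simp only [laplacian, codiff, h.hodge]

variable {a : Module.Basis (Fin 7) ℝ Heisenberg} {r₀ m₁ m₂ m₃ : ℝ} {ψ₀ : Forms Heisenberg}
  {J : Set ℝ} {ψ ψ' : ℝ → Forms Heisenberg}

theorem IsLaplacianCoflow.exists_isDiagonalFrame (h : IsLaplacianCoflow ψ₀ J ψ) {t : ℝ}
    (ht : t ∈ J) : ∃ E r ν₁ ν₂ ν₃, IsDiagonalFrame E r ν₁ ν₂ ν₃ ∧ ψ t = hodge E (modelG2 E) ∧
      ∀ ℓ : Module.Dual ℝ (Forms Heisenberg),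
        HasDerivAt (fun s => ℓ (ψ s)) (ℓ (-laplacian E (hodge E (modelG2 E)))) t := by
  obtain ⟨φ, b, hφ, hψ, hd, hder⟩ := h.solves t ht
  have hφ' : φ = modelG2 b := hφ
  subst hφ'
  rw [hψ] at hd hder
  obtain ⟨E, r, ν₁, ν₂, ν₃, hs, hE⟩ := Heisenberg.exists_isDiagonalFrame b hd
  have hm : hodge E (modelG2 E) = hodge b (modelG2 b) := by rw [hs.hodge, hs.model]
  refine ⟨E, r, ν₁, ν₂, ν₃, hE, by rw [hψ, hm], fun ℓ => ?_⟩
  rw [hm, laplacian_eq_of_sameG2 hs]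
  exact hder ℓ

/-- A linear image of `ψ` that annihilates the Laplacian is constant along the coflow. -/
theorem IsLaplacianCoflow.map_eq (h : IsLaplacianCoflow ψ₀ J ψ) (hJ : IsOpen J)
    (hJc : J.OrdConnected) (h0 : 0 ∈ J) (L : Forms Heisenberg →ₗ[ℝ] Forms Heisenberg)
    (hL : ∀ t ∈ J, ∀ E r ν₁ ν₂ ν₃, IsDiagonalFrame E r ν₁ ν₂ ν₃ → ψ t = hodge E (modelG2 E) →
      L (laplacian E (hodge E (modelG2 E))) = 0) {t : ℝ} (ht : t ∈ J) : L (ψ t) = L ψ₀ := by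
  rw [← sub_eq_zero, ← Module.forall_dual_apply_eq_zero_iff ℝ]
  intro ℓ
  have hd : ∀ u ∈ J, HasDerivAt (fun s => (ℓ ∘ₗ L) (ψ s)) 0 u := by
    intro u hu
    obtain ⟨E, r, ν₁, ν₂, ν₃, hE, hψ, hder⟩ := h.exists_isDiagonalFrame hu
    have := hder (ℓ ∘ₗ L)
    rwa [map_neg, LinearMap.comp_apply, hL u hu E r ν₁ ν₂ ν₃ hE hψ, map_zero, neg_zero] at this
  have hc := hJ.is_const_of_deriv_eq_zero hJc.isPreconnected
    (fun u hu => (hd u hu).differentiableAt.differentiableWithinAt) (fun u hu => (hd u hu).deriv)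
    ht h0
  simp only [LinearMap.comp_apply, h.initial] at hc
  rw [map_sub, hc, sub_self]

/-- Two conservation laws are used in turn. The Laplacian has no central component, so ι_{e₇}ψ is
constant and ρ̂ keeps its direction. Knowing this, the Laplacian is orthogonal by type to ι_vρ̂, so
ψ ∧ ι_vρ̂ is constant and the central covector keeps its direction too. -/
theorem IsLaplacianCoflow.exists_fourForm (ha : IsDiagonalFrame a r₀ m₁ m₂ m₃)
    (h : IsLaplacianCoflow (hodge a (modelG2 a)) J ψ) (hJ : IsOpen J) (hJc : J.OrdConnected)
    (h0 : 0 ∈ J) {t : ℝ} (ht : t ∈ J) :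
    ∃ s, 0 < pf s ∧ ψ t = fourForm a s + rhoHat a * coframe a 6 ∧
      ∀ ℓ : Module.Dual ℝ (Forms Heisenberg), HasDerivAt (fun s => ℓ (ψ s))
        (ℓ (fourForm a (reducedField r₀ (diagCoeff m₁ m₂ m₃) s))) t := by
  have hr₀ := ha.pos
  have hρ : ∀ t ∈ J, ∀ E r ν₁ ν₂ ν₃, IsDiagonalFrame E r ν₁ ν₂ ν₃ → ψ t = hodge E (modelG2 E) →
      rhoHat E = (r₀ / r) • rhoHat a := by
    intro t ht E r ν₁ ν₂ ν₃ hE hψ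
    have hι := h.map_eq hJ hJc h0 (interiorProd center) (fun t ht E r ν₁ ν₂ ν₃ hE hψ => by
      rw [hE.laplacian_hodge_modelG2]
      simp only [map_add, map_neg, map_smul, mul_assoc, interiorProd_coframe_mul,
        interiorProd_coframe, center_coord hE.center, Fin.reduceEq, if_false, zero_smul, zero_sub,
        map_zero, mul_zero, neg_zero, add_zero, smul_zero]) ht
    rw [hψ, interiorProd_center_hodge_modelG2 hE.center,
      interiorProd_center_hodge_modelG2 ha.center, neg_smul, neg_smul, neg_inj] at hι
    rw [div_eq_inv_mul, mul_smul, ← hι, smul_smul, inv_mul_cancel₀ hE.pos.ne', one_smul]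
  have hmul : ∀ v, ∀ t ∈ J, ψ t * interiorProd v (rhoHat a) =
      hodge a (modelG2 a) * interiorProd v (rhoHat a) := by
    intro v t ht
    refine h.map_eq hJ hJc h0 (LinearMap.mulRight ℝ (interiorProd v (rhoHat a)))
      (fun t ht E r ν₁ ν₂ ν₃ hE hψ => ?_) ht
    have hρ' : rhoHat a = (r / r₀) • rhoHat E := by
      rw [hρ t ht E r ν₁ ν₂ ν₃ hE hψ, smul_smul, div_mul_div_cancel₀ hr₀.ne',
        div_self hE.pos.ne', one_smul]
    rw [LinearMap.mulRight_apply, hE.laplacian_hodge_modelG2, hρ', map_smul, mul_smul_comm,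
      smul_mul_assoc, diagonalFourForm_mul_interiorProd_rhoHat, smul_zero, smul_zero]
  obtain ⟨E, r, ν₁, ν₂, ν₃, hE, hψ, hder⟩ := h.exists_isDiagonalFrame ht
  have hρE := hρ t ht E r ν₁ ν₂ ν₃ hE hψ
  have h6 := coframe_six_eq hr₀ hE.pos ha.center hE.center hρE fun v => by rw [← hψ, hmul v t ht]
  obtain ⟨s, hs, h1, h2⟩ := exists_reducedField ha hE hρE h6
  exact ⟨s, hs, hψ.trans h1, fun ℓ => h2 ▸ hder ℓ⟩

/-- The Laplacian coflow of a diagonal `G₂` structure reduces to an ordinary differential equation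
for the coefficients of `½ ω²`. -/
theorem IsLaplacianCoflow.exists_solvesOn (ha : IsDiagonalFrame a r₀ m₁ m₂ m₃)
    (h : IsLaplacianCoflow (hodge a (modelG2 a)) J ψ) (hJ : IsOpen J) (hJc : J.OrdConnected)
    (h0 : 0 ∈ J) : ∃ s, SolvesOn (reducedField r₀ (diagCoeff m₁ m₂ m₃)) {s | 0 < pf s} J s ∧
      ∀ t ∈ J, ψ t = fourForm a (s t) + rhoHat a * coframe a 6 := by
  obtain ⟨S, hS⟩ := exists_fourForm_leftInverse a
  refine ⟨fun t => S (ψ t - rhoHat a * coframe a 6), fun t ht => ?_, fun t ht => ?_⟩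
  · obtain ⟨s, hs, hψ, hder⟩ := h.exists_fourForm ha hJ hJc h0 ht
    have hst : S (ψ t - rhoHat a * coframe a 6) = s := by rw [hψ, add_sub_cancel_right, hS]
    dsimp only
    rw [hst]
    refine ⟨hs, hasDerivAt_pi.2 fun i => ?_⟩
    have := (hder (LinearMap.proj i ∘ₗ S)).sub_const (S (rhoHat a * coframe a 6) i)
    simp only [LinearMap.comp_apply, LinearMap.proj_apply, hS] at this
    simpa only [map_sub, Pi.sub_apply] using this
  · obtain ⟨s, hs, hψ, -⟩ := h.exists_fourForm ha hJ hJc h0 ht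
    simp only
    rw [hψ, add_sub_cancel_right, hS]

/-- The reduced vector field is C¹ where the Pfaffian is positive, so the coefficient curves are
determined by their common initial value. -/
theorem IsLaplacianCoflow.eqOn (ha : IsDiagonalFrame a r₀ m₁ m₂ m₃)
    (h : IsLaplacianCoflow (hodge a (modelG2 a)) J ψ)
    (h' : IsLaplacianCoflow (hodge a (modelG2 a)) J ψ') (hJ : IsOpen J) (hJc : J.OrdConnected)
    (h0 : 0 ∈ J) : Set.EqOn ψ ψ' J := by
  obtain ⟨s, hs, hψ⟩ := h.exists_solvesOn ha hJ hJc h0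
  obtain ⟨s', hs', hψ'⟩ := h'.exists_solvesOn ha hJ hJc h0
  have hss : s 0 = s' 0 := fourForm_injective a (add_right_cancel
    (((hψ 0 h0).symm.trans (h.initial.trans h'.initial.symm)).trans (hψ' 0 h0)))
  have heq := SolvesOn.eqOn (fun p hp => contDiffAt_reducedField _ _ hp) hJ hJc.isPreconnected
    hs hs' h0 hss
  intro t ht
  rw [hψ t ht, hψ' t ht, heq ht]

end Heisenberg

/-! ### From the diagonal system to the coflow. -/

section Scaling

variable {V : Type*} [AddCommGroup V] [Module ℝ V]

theorem exists_basis_scaled (b : Module.Basis (Fin 7) ℝ V) {κ : Fin 7 → ℝ} (hκ : ∀ i, κ i ≠ 0) :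
    ∃ b' : Module.Basis (Fin 7) ℝ V, (∀ i, b' i = (κ i)⁻¹ • b i) ∧
      ∀ i, b'.coord i = κ i • b.coord i := by
  refine exists_basis_of_dual b (fun i => (κ i)⁻¹ • b i) (fun i => κ i • b.coord i) fun i j => ?_
  rw [LinearMap.smul_apply, map_smul, coord_basis]
  by_cases h : i = j
  · subst h; simp [hκ]
  · simp [h, Ne.symm h]

end Scaling

namespace Heisenberg

variable {a : Module.Basis (Fin 7) ℝ Heisenberg} {r₀ m₁ m₂ m₃ : ℝ}

/-- The Hodge dual of the `G₂` form with rescaled fundamental form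
`u₁ a¹² + u₂ a³⁴ + u₃ a⁵⁶`. -/
noncomputable def diagonalPsi (a : Module.Basis (Fin 7) ℝ Heisenberg) (u₁ u₂ u₃ : ℝ) :
    Forms Heisenberg :=
  (u₂ * u₃) • (coframe a 2 * coframe a 3 * coframe a 4 * coframe a 5)
    + (u₁ * u₃) • (coframe a 0 * coframe a 1 * coframe a 4 * coframe a 5)
    + (u₁ * u₂) • (coframe a 0 * coframe a 1 * coframe a 2 * coframe a 3)
    + rhoHat a * coframe a 6

theorem IsDiagonalFrame.exists_scaled (ha : IsDiagonalFrame a r₀ m₁ m₂ m₃) {u₁ u₂ u₃ : ℝ}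
    (hu₁ : 0 < u₁) (hu₂ : 0 < u₂) (hu₃ : 0 < u₃) :
    ∃ (E : Module.Basis (Fin 7) ℝ Heisenberg) (r : ℝ),
      IsDiagonalFrame E r (m₁ / u₁) (m₂ / u₂) (m₃ / u₃) ∧
      hodge E (modelG2 E) = diagonalPsi a u₁ u₂ u₃ ∧
      laplacian E (hodge E (modelG2 E)) = (r₀ ^ 2 / (u₁ * u₂ * u₃)) •
        ((((m₂ / u₂) ^ 2 + (m₃ / u₃) ^ 2 + m₁ / u₁ * (m₂ / u₂ + m₃ / u₃)) * (u₂ * u₃)) •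
            (coframe a 2 * coframe a 3 * coframe a 4 * coframe a 5)
          + (((m₁ / u₁) ^ 2 + (m₃ / u₃) ^ 2 + m₂ / u₂ * (m₁ / u₁ + m₃ / u₃)) * (u₁ * u₃)) •
            (coframe a 0 * coframe a 1 * coframe a 4 * coframe a 5)
          + (((m₁ / u₁) ^ 2 + (m₂ / u₂) ^ 2 + m₃ / u₃ * (m₁ / u₁ + m₂ / u₂)) * (u₁ * u₂)) •
            (coframe a 0 * coframe a 1 * coframe a 2 * coframe a 3)) := by
  obtain ⟨hm₁, hm₂, hm₃⟩ := ha.ne_zero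
  have hr₀ := ha.pos
  obtain ⟨q₁, hq₁, rfl⟩ : ∃ q, 0 < q ∧ u₁ = q * q :=
    ⟨√u₁, Real.sqrt_pos.2 hu₁, (Real.mul_self_sqrt hu₁.le).symm⟩
  obtain ⟨q₂, hq₂, rfl⟩ : ∃ q, 0 < q ∧ u₂ = q * q :=
    ⟨√u₂, Real.sqrt_pos.2 hu₂, (Real.mul_self_sqrt hu₂.le).symm⟩
  obtain ⟨q₃, hq₃, rfl⟩ : ∃ q, 0 < q ∧ u₃ = q * q :=
    ⟨√u₃, Real.sqrt_pos.2 hu₃, (Real.mul_self_sqrt hu₃.le).symm⟩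
  -- Scaling each plane by √uⱼ multiplies ρ̂ by √(u₁u₂u₃); the last covector is divided by the same
  -- factor, so ρ̂ ∧ a⁶ is unchanged.
  have hκ : ∀ i, (![q₁, q₁, q₂, q₂, q₃, q₃, (q₁ * q₂ * q₃)⁻¹] : Fin 7 → ℝ) i ≠ 0 := by
    intro i
    fin_cases i <;> simp [hq₁.ne', hq₂.ne', hq₃.ne']
  obtain ⟨E, hE, hEc⟩ := exists_basis_scaled a hκ
  have hc : ∀ i, coframe E i = (![q₁, q₁, q₂, q₂, q₃, q₃, (q₁ * q₂ * q₃)⁻¹] : Fin 7 → ℝ) i •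
      coframe a i := fun i => by simp only [coframe, oneForm, hEc, map_smul]
  have hdiag : IsDiagonalFrame E (r₀ * (q₁ * q₂ * q₃)⁻¹) (m₁ / (q₁ * q₁)) (m₂ / (q₂ * q₂))
      (m₃ / (q₃ * q₃)) := by
    refine ⟨by positivity, ?_, ?_, by positivity, by positivity, by positivity⟩
    · rw [hE, ha.center, smul_smul]
      simp only [Matrix.cons_val]
      rw [mul_assoc, mul_inv_cancel₀ (by positivity), mul_one]
    · rw [ha.de7]
      simp only [hc, Matrix.cons_val, smul_mul_smul_comm, smul_smul]
      rw [div_mul_cancel₀ _ (by positivity), div_mul_cancel₀ _ (by positivity),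
        div_mul_cancel₀ _ (by positivity)]
  refine ⟨E, _, hdiag, ?_, ?_⟩
  · rw [hodge_modelG2, diagonalPsi, rhoHat]
    simp only [hc, Matrix.cons_val, add_mul, neg_mul, smul_mul_assoc, mul_smul_comm, smul_smul,
      smul_add, smul_neg]
    match_scalars <;> field_simp
  · rw [hdiag.laplacian_hodge_modelG2]
    simp only [hc, Matrix.cons_val, smul_mul_assoc, mul_smul_comm, smul_smul]
    match_scalars <;> field_simp

end Heisenberg

section CoflowSolutions

open Set Filter Topology

namespace Heisenberg

/-- The e²³⁴⁵ coefficient of the coflow equation, for uⱼ = λⱼ/pⱼ and mⱼ = nⱼP/(r₀pⱼ). The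
normalisation P²p₁p₂p₃ = 1 removes all constants; the other two coefficients follow by permuting
indices. -/
theorem diagonal_rate_eq {n₁ n₂ n₃ r₀ P p₁ p₂ p₃ l₁ l₂ l₃ : ℝ} (hn₂ : n₂ ^ 2 = 1)
    (hn₃ : n₃ ^ 2 = 1) (hr₀ : 0 < r₀) (hp₁ : 0 < p₁) (hp₂ : 0 < p₂) (hp₃ : 0 < p₃)
    (hl₁ : 0 < l₁) (hl₂ : 0 < l₂) (hl₃ : 0 < l₃) (hP : P ^ 2 * (p₁ * p₂ * p₃) = 1) :
    -((l₁ * l₃ + n₁ * n₃ * l₂ ^ 2) / (l₁ ^ 2 * l₂ ^ 2 * l₃ ^ 2)) / p₂ * (l₃ / p₃)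
      + l₂ / p₂ * (-((l₁ * l₂ + n₁ * n₂ * l₃ ^ 2) / (l₁ ^ 2 * l₂ ^ 2 * l₃ ^ 2)) / p₃) =
    -(r₀ ^ 2 / (l₁ / p₁ * (l₂ / p₂) * (l₃ / p₃)) *
      (((n₂ * P / (r₀ * p₂) / (l₂ / p₂)) ^ 2 + (n₃ * P / (r₀ * p₃) / (l₃ / p₃)) ^ 2
        + n₁ * P / (r₀ * p₁) / (l₁ / p₁) *
          (n₂ * P / (r₀ * p₂) / (l₂ / p₂) + n₃ * P / (r₀ * p₃) / (l₃ / p₃)))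
        * (l₂ / p₂ * (l₃ / p₃)))) := by
  have h1 : r₀ ^ 2 / (l₁ / p₁ * (l₂ / p₂) * (l₃ / p₃)) *
      (((n₂ * P / (r₀ * p₂) / (l₂ / p₂)) ^ 2 + (n₃ * P / (r₀ * p₃) / (l₃ / p₃)) ^ 2
        + n₁ * P / (r₀ * p₁) / (l₁ / p₁) *
          (n₂ * P / (r₀ * p₂) / (l₂ / p₂) + n₃ * P / (r₀ * p₃) / (l₃ / p₃)))
        * (l₂ / p₂ * (l₃ / p₃))) =
      (P ^ 2 * (p₁ * p₂ * p₃)) * (((n₂ ^ 2 / l₂ ^ 2 + n₃ ^ 2 / l₃ ^ 2 + n₁ * n₂ / (l₁ * l₂)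
        + n₁ * n₃ / (l₁ * l₃)) / (l₁ * p₂ * p₃))) := by
    field_simp
    ring
  rw [h1, hP, hn₂, hn₃]
  field_simp
  ring

variable {a : Module.Basis (Fin 7) ℝ Heisenberg} {r₀ n₁ n₂ n₃ P : ℝ} {p : ℝ × ℝ × ℝ} {T : ℝ}
  {x : ℝ → ℝ × ℝ × ℝ}

theorem diagonalPsi_one : diagonalPsi a 1 1 1 = hodge a (modelG2 a) := by
  rw [hodge_modelG2_eq, kaehlerForm_sq, diagonalPsi]
  module

/-- A solution of the diagonal system gives a solution of the Laplacian coflow. -/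
theorem isLaplacianCoflow_diagonalPsi (hn₁ : n₁ ^ 2 = 1) (hn₂ : n₂ ^ 2 = 1) (hn₃ : n₃ ^ 2 = 1)
    (hp : p ∈ octant) (hP : P ^ 2 * (p.1 * p.2.1 * p.2.2) = 1)
    (ha : IsDiagonalFrame a r₀ (n₁ * P / (r₀ * p.1)) (n₂ * P / (r₀ * p.2.1))
      (n₃ * P / (r₀ * p.2.2)))
    (h0 : x 0 = p) (hx : SolvesOn (diagonalField n₁ n₂ n₃) octant (Iio T) x) :
    IsLaplacianCoflow (hodge a (modelG2 a)) (Iio T)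
      (fun t => diagonalPsi a ((x t).1 / p.1) ((x t).2.1 / p.2.1) ((x t).2.2 / p.2.2)) := by
  obtain ⟨hp₁, hp₂, hp₃⟩ := hp
  have hr₀ := ha.pos
  refine ⟨?_, fun t ht => ?_⟩
  · rw [h0, div_self hp₁.ne', div_self hp₂.ne', div_self hp₃.ne', diagonalPsi_one]
  · obtain ⟨hl₁, hl₂, hl₃⟩ := (hx t ht).1
    obtain ⟨d1, d2, d3⟩ := hx.hasDerivAt_coord ht
    obtain ⟨E, r, hE, hψ, hlap⟩ := ha.exists_scaled (div_pos hl₁ hp₁) (div_pos hl₂ hp₂)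
      (div_pos hl₃ hp₃)
    refine ⟨modelG2 E, E, rfl, hψ.symm, ?_, fun ℓ => ?_⟩
    · rw [← hψ, hE.d_hodge_modelG2]
    · rw [← hψ, hlap]
      simp only [diagonalPsi, map_add, map_neg, map_smul, smul_eq_mul]
      have e1 := d1.div_const p.1
      have e2 := d2.div_const p.2.1
      have e3 := d3.div_const p.2.2
      refine (((((e2.mul e3).mul_const _).add ((e1.mul e3).mul_const _)).add
        ((e1.mul e2).mul_const _)).add_const _).congr_deriv ?_
      have k1 := diagonal_rate_eq (P := P) (n₁ := n₁) hn₂ hn₃ hr₀ hp₁ hp₂ hp₃ hl₁ hl₂ hl₃ hP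
      have k2 := diagonal_rate_eq (P := P) (n₁ := n₂) hn₁ hn₃ hr₀ hp₂ hp₁ hp₃ hl₂ hl₁ hl₃
        (by linear_combination hP)
      have k3 := diagonal_rate_eq (P := P) (n₁ := n₃) hn₁ hn₂ hr₀ hp₃ hp₁ hp₂ hl₃ hl₁ hl₂
        (by linear_combination hP)
      simp only [diagonalField]
      generalize ℓ (coframe a 2 * coframe a 3 * coframe a 4 * coframe a 5) = A
      generalize ℓ (coframe a 0 * coframe a 1 * coframe a 4 * coframe a 5) = B
      generalize ℓ (coframe a 0 * coframe a 1 * coframe a 2 * coframe a 3) = C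
      linear_combination A * k1 + B * k2 + C * k3

end Heisenberg

/-- From u₁² = (u₁u₃)(u₁u₂)/(u₂u₃): limits of ½ω² give limits of ω. -/
theorem tendsto_sqrt_of_mul {l : Filter ℝ} {u₁ u₂ u₃ : ℝ → ℝ} {α β γ : ℝ}
    (hα : 0 < α) (hu₁ : ∀ᶠ t in l, 0 < u₁ t) (hu₂ : ∀ᶠ t in l, 0 < u₂ t)
    (hu₃ : ∀ᶠ t in l, 0 < u₃ t) (h1 : Tendsto (fun t => u₂ t * u₃ t) l (𝓝 α))
    (h2 : Tendsto (fun t => u₁ t * u₃ t) l (𝓝 β)) (h3 : Tendsto (fun t => u₁ t * u₂ t) l (𝓝 γ)) :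
    Tendsto u₁ l (𝓝 (Real.sqrt (β * γ / α))) := by
  refine ((h2.mul h3).div h1 hα.ne').sqrt.congr' ?_
  filter_upwards [hu₁, hu₂, hu₃] with t k1 k2 k3
  simp only [Pi.div_apply]
  rw [show u₁ t * u₃ t * (u₁ t * u₂ t) / (u₂ t * u₃ t) = u₁ t ^ 2 by field_simp,
    Real.sqrt_sq k1.le]

namespace Heisenberg

variable {a : Module.Basis (Fin 7) ℝ Heisenberg} {r₀ n₁ n₂ n₃ P : ℝ} {p : ℝ × ℝ × ℝ} {T : ℝ}
  {x : ℝ → ℝ × ℝ × ℝ}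

theorem IsLaplacianCoflow.mono {ψ₀ : Forms Heisenberg} {J J' : Set ℝ} {ψ : ℝ → Forms Heisenberg}
    (h : IsLaplacianCoflow ψ₀ J ψ) (hJ : J' ⊆ J) : IsLaplacianCoflow ψ₀ J' ψ :=
  ⟨h.initial, fun t ht => h.solves t (hJ ht)⟩

theorem diagonalPsi_eq_fourForm (u₁ u₂ u₃ : ℝ) : diagonalPsi a u₁ u₂ u₃ =
    fourForm a (diagCoeff (u₂ * u₃) (u₁ * u₃) (u₁ * u₂)) + rhoHat a * coframe a 6 := by
  simp [diagonalPsi, fourForm_apply, diagCoeff]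

/-- A solution defined at T agrees with the diagonal one before T and is a continuous coefficient
curve at T with positive Pfaffian. This forces x to converge in the octant, which is excluded. -/
theorem isMaximalLaplacianCoflow_diagonalPsi (hn₁ : n₁ ^ 2 = 1) (hn₂ : n₂ ^ 2 = 1)
    (hn₃ : n₃ ^ 2 = 1) (hp : p ∈ octant) (hP : P ^ 2 * (p.1 * p.2.1 * p.2.2) = 1)
    (ha : IsDiagonalFrame a r₀ (n₁ * P / (r₀ * p.1)) (n₂ * P / (r₀ * p.2.1))
      (n₃ * P / (r₀ * p.2.2)))
    (h0 : x 0 = p) (hx : SolvesOn (diagonalField n₁ n₂ n₃) octant (Iio T) x) (hT : 0 < T)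
    (hlim : ∀ q ∈ octant, ¬Tendsto x (𝓝[<] T) (𝓝 q)) :
    IsMaximalLaplacianCoflow (hodge a (modelG2 a)) (Iio T)
      (fun t => diagonalPsi a ((x t).1 / p.1) ((x t).2.1 / p.2.1) ((x t).2.2 / p.2.2)) := by
  have hsol := isLaplacianCoflow_diagonalPsi hn₁ hn₂ hn₃ hp hP ha h0 hx
  refine ⟨hsol, fun J' ψ' hJ hJc h0J h' => ?_⟩
  have hTJ : T ∉ J' := by
    intro hTJ
    obtain ⟨s, hs, hψ⟩ := h'.exists_solvesOn ha hJ hJc h0J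
    have heq := (h'.mono inter_subset_left).eqOn ha (hsol.mono (inter_subset_right (s := J')))
      (hJ.inter isOpen_Iio) (hJc.inter ordConnected_Iio) ⟨h0J, hT⟩
    have hmem : ∀ᶠ t in 𝓝[<] T, t ∈ J' ∩ Iio T :=
      inter_mem (nhdsWithin_le_nhds (hJ.mem_nhds hTJ)) self_mem_nhdsWithin
    have hst : ∀ᶠ t in 𝓝[<] T, s t = diagCoeff ((x t).2.1 / p.2.1 * ((x t).2.2 / p.2.2))
        ((x t).1 / p.1 * ((x t).2.2 / p.2.2)) ((x t).1 / p.1 * ((x t).2.1 / p.2.1)) := by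
      filter_upwards [hmem] with t ht
      have h := heq ht
      simp only [diagonalPsi_eq_fourForm] at h
      rw [hψ t ht.1] at h
      exact fourForm_injective a (add_right_cancel h)
    have hpos : ∀ᶠ t in 𝓝[<] T,
        0 < (x t).1 / p.1 ∧ 0 < (x t).2.1 / p.2.1 ∧ 0 < (x t).2.2 / p.2.2 := by
      filter_upwards [hmem] with t ht
      obtain ⟨k1, k2, k3⟩ := (hx t ht.2).1
      exact ⟨div_pos k1 hp.1, div_pos k2 hp.2.1, div_pos k3 hp.2.2⟩
    have hcont : Tendsto s (𝓝[<] T) (𝓝 (s T)) :=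
      (hs T hTJ).2.continuousAt.tendsto.mono_left nhdsWithin_le_nhds
    have hcoord : ∀ i, Tendsto (fun t => s t i) (𝓝[<] T) (𝓝 (s T i)) := fun i =>
      (continuous_apply i).continuousAt.tendsto.comp hcont
    have h1 := (hcoord 0).congr' (f₂ := fun t => (x t).2.1 / p.2.1 * ((x t).2.2 / p.2.2))
      (hst.mono fun t ht => by rw [ht]; rfl)
    have h2 := (hcoord 9).congr' (f₂ := fun t => (x t).1 / p.1 * ((x t).2.2 / p.2.2))
      (hst.mono fun t ht => by rw [ht]; rfl)
    have h3 := (hcoord 14).congr' (f₂ := fun t => (x t).1 / p.1 * ((x t).2.1 / p.2.1))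
      (hst.mono fun t ht => by rw [ht]; rfl)
    -- The diagonal shape passes to the limit. The three entries are limits of positive functions
    -- and have nonzero product, so they are positive.
    have hpf : pf (s T) = s T 0 * s T 9 * s T 14 := by
      refine tendsto_nhds_unique (contDiff_pf.continuous.continuousAt.tendsto.comp hcont)
        ((((hcoord 0).mul (hcoord 9)).mul (hcoord 14)).congr' (hst.mono fun t ht => ?_))
      simp [ht, pf, diagCoeff, mul_assoc]
    have hsT : 0 < s T 0 * s T 9 * s T 14 := hpf ▸ (hs T hTJ).1
    have k1 : 0 ≤ s T 0 := ge_of_tendsto h1 (hpos.mono fun t ht => (mul_pos ht.2.1 ht.2.2).le)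
    have k2 : 0 ≤ s T 9 := ge_of_tendsto h2 (hpos.mono fun t ht => (mul_pos ht.1 ht.2.2).le)
    have k3 : 0 ≤ s T 14 := ge_of_tendsto h3 (hpos.mono fun t ht => (mul_pos ht.1 ht.2.1).le)
    replace k1 : 0 < s T 0 := k1.lt_of_ne' fun h => by simp [h] at hsT
    replace k2 : 0 < s T 9 := k2.lt_of_ne' fun h => by simp [h] at hsT
    replace k3 : 0 < s T 14 := k3.lt_of_ne' fun h => by simp [h] at hsT
    have p1 := hpos.mono fun t ht => ht.1
    have p2 := hpos.mono fun t ht => ht.2.1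
    have p3 := hpos.mono fun t ht => ht.2.2
    have l1 := (tendsto_sqrt_of_mul k1 p1 p2 p3 h1 h2 h3).mul_const p.1
    have l2 := (tendsto_sqrt_of_mul k2 p2 p1 p3 h2 h1
      (h3.congr fun t => mul_comm _ _)).mul_const p.2.1
    have l3 := (tendsto_sqrt_of_mul k3 p3 p1 p2 h3 (h1.congr fun t => mul_comm _ _)
      (h2.congr fun t => mul_comm _ _)).mul_const p.2.2
    obtain ⟨q1, q2, q3⟩ := hp
    refine hlim (_, _, _) ⟨?_, ?_, ?_⟩ ((l1.prodMk_nhds (l2.prodMk_nhds l3)).congr fun t => ?_)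
    · exact mul_pos (Real.sqrt_pos.2 (by positivity)) q1
    · exact mul_pos (Real.sqrt_pos.2 (by positivity)) q2
    · exact mul_pos (Real.sqrt_pos.2 (by positivity)) q3
    · simp only [div_mul_cancel₀ _ q1.ne', div_mul_cancel₀ _ q2.ne', div_mul_cancel₀ _ q3.ne']
  have hsub : J' ⊆ Iio T := by
    intro u hu
    by_contra hTu
    exact hTJ (hJc.out h0J hu ⟨hT.le, not_lt.1 hTu⟩)
  exact ⟨hsub, h'.eqOn ha (hsol.mono hsub) hJ hJc h0J⟩

end Heisenberg

/-! ### Norms, the unit form η, and the normalisation constants. -/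

section Norm

variable {V : Type*} [AddCommGroup V] [Module ℝ V] (b : Module.Basis (Fin 7) ℝ V)

theorem frameMetric_basis (i : Fin 7) (y : V) : frameMetric b (b i) y = b.coord i y := by
  simp only [frameMetric, coord_basis, ite_mul, one_mul, zero_mul, Finset.sum_ite_eq,
    Finset.mem_univ, if_true]

theorem vol6_mul_coframe_six : vol6 b * coframe b 6 = vol b := rfl

theorem hodge_smul_vol (c : ℝ) : hodge b (c • vol b) = algebraMap ℝ (Forms V) c := by
  simp only [hodge, vol, map_smul, contraction_mul_apply, contraction_coframe,
    mul_assoc, MulOpposite.unop_smul, LinearMap.smul_apply, interiorProd_coframe_mul,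
    interiorProd_coframe, coord_basis, Fin.reduceEq, if_true, if_false, one_smul, zero_smul,
    mul_zero, map_zero, mul_one, map_one, sub_zero]
  rw [Algebra.algebraMap_eq_smul_one]

theorem formNorm_smul_vol6 (c : ℝ) : formNorm b (c • vol6 b) = |c| := by
  have h : formInner b (c • vol6 b) (c • vol6 b) = c ^ 2 := by
    simp only [formInner, vol6, map_smul, contraction_mul_apply, contraction_coframe,
      mul_assoc, MulOpposite.unop_smul, LinearMap.smul_apply, interiorProd_coframe_mul,
      interiorProd_coframe, coord_basis, Fin.reduceEq, if_true, if_false, one_smul, zero_smul,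
      mul_zero, map_zero, mul_one, map_one, sub_zero, smul_eq_mul]
    ring
  rw [formNorm, h, Real.sqrt_sq_eq_abs]

theorem SameG2.formNorm {b b' : Module.Basis (Fin 7) ℝ V} (h : SameG2 b b') :
    formNorm b' = formNorm b := by
  funext α
  simp only [_root_.formNorm, formInner, h.contraction]

theorem interiorProd_six_modelG2 : interiorProd (b 6) (modelG2 b) = kaehlerForm b := by
  simp only [modelG2, kaehlerForm, map_add, map_sub, mul_assoc, interiorProd_coframe_mul,
    interiorProd_coframe, coord_basis, Fin.reduceEq, if_true, if_false, zero_smul, zero_sub,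
    sub_zero, map_zero, mul_zero, neg_zero, mul_neg, neg_neg, map_one, mul_one, add_zero]

end Norm

namespace Heisenberg

variable {a b : Module.Basis (Fin 7) ℝ Heisenberg} {r₀ m₁ m₂ m₃ : ℝ}

theorem unitCenter_eq (hs : SameG2 b a) (hr : 0 < r₀) (hc : center = r₀ • a 6) :
    unitCenter b = a 6 := by
  have h : frameMetric a center center = r₀ ^ 2 := by
    simp [frameMetric, center_coord hc, sq]
  rw [unitCenter, ← hs.metric, h, Real.sqrt_sq hr.le, hc, smul_smul, inv_mul_cancel₀ hr.ne',
    one_smul]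

theorem eta_eq (hs : SameG2 b a) (hr : 0 < r₀) (hc : center = r₀ • a 6) : eta b = a.coord 6 := by
  refine LinearMap.ext fun y => ?_
  rw [← frameMetric_basis, hs.metric, ← unitCenter_eq hs hr hc]
  simp [eta, frameMetric]

theorem d_coframe_six (hc : center = r₀ • a 6) : d (coframe a 6) = r₀ • de7 := by
  rw [d_eq, interiorProd_coframe, center_coord hc, if_pos rfl, Algebra.algebraMap_eq_smul_one,
    mul_smul_comm, mul_one]

/-- The normalisation of the diagonal frame. -/
theorem IsDiagonalFrame.exists_normalisation (ha : IsDiagonalFrame a r₀ m₁ m₂ m₃) :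
    ∃ n₁ n₂ n₃ P : ℝ, ∃ p ∈ octant, (n₁ = 1 ∨ n₁ = -1) ∧ (n₂ = 1 ∨ n₂ = -1) ∧
      (n₃ = 1 ∨ n₃ = -1) ∧ 0 < P ∧ P ^ 2 * (p.1 * p.2.1 * p.2.2) = 1 ∧
      m₁ = n₁ * P / (r₀ * p.1) ∧ m₂ = n₂ * P / (r₀ * p.2.1) ∧ m₃ = n₃ * P / (r₀ * p.2.2) ∧
      |r₀ ^ 3 * (m₁ * m₂ * m₃)| = P ^ 5 := by
  obtain ⟨hm₁, hm₂, hm₃⟩ := ha.ne_zero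
  have hr₀ := ha.pos
  have hD : 0 < |r₀ ^ 3 * (m₁ * m₂ * m₃)| := by positivity
  set D := |r₀ ^ 3 * (m₁ * m₂ * m₃)| with hDdef
  have hDe : D = r₀ ^ 3 * (|m₁| * |m₂| * |m₃|) := by
    rw [hDdef, abs_mul, abs_mul, abs_mul, abs_of_pos (by positivity : 0 < r₀ ^ 3)]
  -- The fifth root is forced: pⱼ = P/(r₀|mⱼ|) gives P²p₁p₂p₃ = P⁵/D, which must be 1. In the
  -- theorem D is δ₀.
  obtain ⟨P, hP, hP5⟩ : ∃ P : ℝ, 0 < P ∧ P ^ 5 = D :=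
    ⟨D ^ (1 / 5 : ℝ), by positivity, by
      rw [← Real.rpow_natCast, ← Real.rpow_mul hD.le]; norm_num⟩
  have hsign : ∀ m : ℝ, m ≠ 0 → m / |m| = 1 ∨ m / |m| = -1 := by
    intro m hm
    rcases hm.lt_or_gt with h | h
    · right; rw [abs_of_neg h, div_neg, div_self hm]
    · left; rw [abs_of_pos h, div_self hm]
  have hmeq : ∀ m : ℝ, m ≠ 0 → m = m / |m| * P / (r₀ * (P / (r₀ * |m|))) := by
    intro m hm
    have : |m| ≠ 0 := abs_ne_zero.2 hm
    field_simp
  refine ⟨m₁ / |m₁|, m₂ / |m₂|, m₃ / |m₃|, P,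
    (P / (r₀ * |m₁|), P / (r₀ * |m₂|), P / (r₀ * |m₃|)), ⟨?_, ?_, ?_⟩, hsign _ hm₁, hsign _ hm₂,
    hsign _ hm₃, hP, ?_, hmeq _ hm₁, hmeq _ hm₂, hmeq _ hm₃, hP5.symm⟩
  · show 0 < P / (r₀ * |m₁|)
    positivity
  · show 0 < P / (r₀ * |m₂|)
    positivity
  · show 0 < P / (r₀ * |m₃|)
    positivity
  · show P ^ 2 * (P / (r₀ * |m₁|) * (P / (r₀ * |m₂|)) * (P / (r₀ * |m₃|))) = 1
    have : P ^ 2 * (P / (r₀ * |m₁|) * (P / (r₀ * |m₂|)) * (P / (r₀ * |m₃|))) = P ^ 5 / D := by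
      rw [hDe]
      field_simp
    rw [this, hP5, div_self hD.ne']

/-- Both sides are multiples of P^{-10/3}, so the claim is (2/5)·6^{1/3} < 4; the crude 6^{1/3} ≤ 6
is enough. -/
theorem existence_time_bound {T V P : ℝ} (hP : 0 < P) (hV : P ^ 2 * V = 1)
    (hT : T ≤ 2 / 5 * V ^ (5 / 3 : ℝ)) : T < 4 / (6 * (P ^ 5) ^ 2) ^ (1 / 3 : ℝ) := by
  refine hT.trans_lt ?_
  have hV' : V = (P ^ 2)⁻¹ := eq_inv_of_mul_eq_one_right hV
  have h1 : V ^ (5 / 3 : ℝ) = (P ^ (10 / 3 : ℝ))⁻¹ := by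
    rw [hV', Real.inv_rpow (by positivity), ← Real.rpow_natCast, ← Real.rpow_mul hP.le]
    norm_num
  have h2 : (6 * (P ^ 5) ^ 2) ^ (1 / 3 : ℝ) = 6 ^ (1 / 3 : ℝ) * P ^ (10 / 3 : ℝ) := by
    rw [Real.mul_rpow (by norm_num) (by positivity), ← pow_mul, ← Real.rpow_natCast,
      ← Real.rpow_mul hP.le]
    norm_num
  have h3 : (6 : ℝ) ^ (1 / 3 : ℝ) ≤ 6 := by
    conv_rhs => rw [← Real.rpow_one 6]
    exact Real.rpow_le_rpow_of_exponent_le (by norm_num) (by norm_num)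
  have h4 : 0 < P ^ (10 / 3 : ℝ) := by positivity
  have h5 : (0 : ℝ) < 6 ^ (1 / 3 : ℝ) := by positivity
  rw [h1, h2, lt_div_iff₀ (by positivity)]
  calc 2 / 5 * (P ^ (10 / 3 : ℝ))⁻¹ * (6 ^ (1 / 3 : ℝ) * P ^ (10 / 3 : ℝ))
      = 2 / 5 * 6 ^ (1 / 3 : ℝ) := by field_simp
    _ < 4 := by linarith

end Heisenberg

end CoflowSolutions

/-! ### The normalised frame and the final assembly. -/

namespace Heisenberg

variable {a : Module.Basis (Fin 7) ℝ Heisenberg} {r₀ : ℝ}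

theorem exists_normalised_frame (hr : 0 < r₀) (hc : center = r₀ • a 6) {q₁ q₂ q₃ : ℝ}
    (hq₁ : 0 < q₁) (hq₂ : 0 < q₂) (hq₃ : 0 < q₃) : ∃ F : Module.Basis (Fin 7) ℝ Heisenberg,
      (F 0 = q₁ • a 0 ∧ F 1 = q₁ • a 1 ∧ F 2 = q₂ • a 2 ∧ F 3 = q₂ • a 3 ∧ F 4 = q₃ • a 4 ∧
        F 5 = q₃ • a 5 ∧ F 6 = center) ∧
      coframe a 0 = q₁ • coframe F 0 ∧ coframe a 1 = q₁ • coframe F 1 ∧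
      coframe a 2 = q₂ • coframe F 2 ∧ coframe a 3 = q₂ • coframe F 3 ∧
      coframe a 4 = q₃ • coframe F 4 ∧ coframe a 5 = q₃ • coframe F 5 := by
  have hκ : ∀ i, (![q₁⁻¹, q₁⁻¹, q₂⁻¹, q₂⁻¹, q₃⁻¹, q₃⁻¹, r₀⁻¹] : Fin 7 → ℝ) i ≠ 0 := by
    intro i
    fin_cases i <;> simp [hq₁.ne', hq₂.ne', hq₃.ne', hr.ne']
  obtain ⟨F, hF, hFc⟩ := exists_basis_scaled a hκ
  have h : ∀ i, coframe a i =
      (![q₁⁻¹, q₁⁻¹, q₂⁻¹, q₂⁻¹, q₃⁻¹, q₃⁻¹, r₀⁻¹] : Fin 7 → ℝ)⁻¹ i • coframe F i := fun i => by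
    simp only [coframe, oneForm, hFc, map_smul, smul_smul, Pi.inv_apply]
    rw [inv_mul_cancel₀ (hκ i), one_smul]
  refine ⟨F, ?_, ?_⟩
  · simp only [hF, Matrix.cons_val, inv_inv, hc, and_self]
  · simp only [h, Pi.inv_apply, Matrix.cons_val, inv_inv, and_self]

theorem IsMaximalLaplacianCoflow.congr {ψ₀ : Forms Heisenberg} {J : Set ℝ}
    {ψ ψ' : ℝ → Forms Heisenberg} (h : IsMaximalLaplacianCoflow ψ₀ J ψ) (hJ : IsOpen J)
    (h0 : 0 ∈ J) (he : Set.EqOn ψ' ψ J) : IsMaximalLaplacianCoflow ψ₀ J ψ' := by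
  refine ⟨⟨by rw [he h0, h.coflow.initial], fun t ht => ?_⟩, fun J' χ hJ' hJc h0' hχ => ?_⟩
  · obtain ⟨φ, b, hφ, hψ, hd, hder⟩ := h.coflow.solves t ht
    rw [he ht]
    exact ⟨φ, b, hφ, hψ, hd, fun ℓ => (hder ℓ).congr_of_eventuallyEq
      (Filter.eventuallyEq_of_mem (hJ.mem_nhds ht) fun s hs => congrArg ℓ (he hs))⟩
  · obtain ⟨hsub, heq⟩ := h.maximal J' χ hJ' hJc h0' hχ
    exact ⟨hsub, fun t ht => (heq ht).trans (he (hsub ht)).symm⟩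

theorem pfAdj_diagCoeff (u₁ u₂ u₃ : ℝ) :
    pfAdj (diagCoeff u₁ u₂ u₃) = diagCoeff (u₂ * u₃) (u₁ * u₃) (u₁ * u₂) := by
  funext i
  fin_cases i <;> simp [pfAdj, diagCoeff]

theorem pf_diagCoeff (u₁ u₂ u₃ : ℝ) : pf (diagCoeff u₁ u₂ u₃) = u₁ * u₂ * u₃ := by
  simp [pf, diagCoeff, mul_assoc]

theorem frameMetric_smul_smul (b : Module.Basis (Fin 7) ℝ Heisenberg) (i j : Fin 7) (c c' : ℝ) :
    frameMetric b (c • b i) (c' • b j) = c * c' * if i = j then 1 else 0 := by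
  simp only [frameMetric, map_smul, coord_basis, smul_eq_mul]
  by_cases h : i = j
  · subst h; simp
  · simp [h]

end Heisenberg

theorem theorem4p2 (φ₀ : Forms Heisenberg) (b : Module.Basis (Fin 7) ℝ Heisenberg)
    (hφ₀ : IsG2Frame φ₀ b) (hcoclosed : Heisenberg.d (hodge b φ₀) = 0) :
    let ψ₀ : Forms Heisenberg := hodge b φ₀
    let η : Forms Heisenberg := oneForm (Heisenberg.eta b)
    let dη : Forms Heisenberg := Heisenberg.d η
    let ω₀ : Forms Heisenberg := interiorProd (Heisenberg.unitCenter b) φ₀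
    let δ₀ : ℝ := formNorm b (dη ^ 3) / 6
    ∃ (T : ℝ) (F : Module.Basis (Fin 7) ℝ Heisenberg) (n₁ n₂ n₃ : ℝ) (l₁ l₂ l₃ ε : ℝ → ℝ),
      let f : Fin 7 → Forms Heisenberg := coframe F
      let ω : ℝ → Forms Heisenberg := fun t =>
        l₁ t • (f 0 * f 1) + l₂ t • (f 2 * f 3) + l₃ t • (f 4 * f 5)
      let ρhat : ℝ → Forms Heisenberg := fun t =>
        Real.sqrt (l₁ t * l₂ t * l₃ t) •
          (-(f 1 * f 3 * f 5) + f 0 * f 2 * f 5 + f 0 * f 3 * f 4 + f 1 * f 2 * f 4)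
      let ψ : ℝ → Forms Heisenberg := fun t =>
        (1 / 2 : ℝ) • ω t ^ 2 + (1 / ε t) • (ρhat t * η)
      -- `f₁, …, f₆` is a frame of `Ker η`; its dual forms are extended by zero on the centre
      F 6 = Heisenberg.center ∧ (∀ i : Fin 7, i ≠ 6 → Heisenberg.eta b (F i) = 0) ∧
      -- the frame is `g₀`-orthogonal, normalised by `λⱼ(0)`
      (∀ i j : Fin 7, i ≠ j → frameMetric b (F i) (F j) = 0) ∧
      (frameMetric b (F 0) (F 0) = l₁ 0 ∧ frameMetric b (F 1) (F 1) = l₁ 0 ∧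
        frameMetric b (F 2) (F 2) = l₂ 0 ∧ frameMetric b (F 3) (F 3) = l₂ 0 ∧
        frameMetric b (F 4) (F 4) = l₃ 0 ∧ frameMetric b (F 5) (F 5) = l₃ 0) ∧
      -- the signs
      ((n₁ = 1 ∨ n₁ = -1) ∧ (n₂ = 1 ∨ n₂ = -1) ∧ (n₃ = 1 ∨ n₃ = -1)) ∧
      dη = (1 / Real.sqrt (l₁ 0 * l₂ 0 * l₃ 0)) •
        (n₁ • (f 0 * f 1) + n₂ • (f 2 * f 3) + n₃ • (f 4 * f 5)) ∧
      -- the initial data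
      ω 0 = ω₀ ∧
      (interiorProd (F 1) (interiorProd (F 0) ω₀) = algebraMap ℝ (Forms Heisenberg) (l₁ 0) ∧
        interiorProd (F 3) (interiorProd (F 2) ω₀) = algebraMap ℝ (Forms Heisenberg) (l₂ 0) ∧
        interiorProd (F 5) (interiorProd (F 4) ω₀) = algebraMap ℝ (Forms Heisenberg) (l₃ 0)) ∧
      -- the ODE system, and `6 ε_t² = *₀(ω(t)³)`
      (∀ t < T, 0 < l₁ t ∧ 0 < l₂ t ∧ 0 < l₃ t ∧
        HasDerivAt l₁ (-((l₂ t * l₃ t + n₂ * n₃ * l₁ t ^ 2) /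
          (l₁ t ^ 2 * l₂ t ^ 2 * l₃ t ^ 2))) t ∧
        HasDerivAt l₂ (-((l₁ t * l₃ t + n₁ * n₃ * l₂ t ^ 2) /
          (l₁ t ^ 2 * l₂ t ^ 2 * l₃ t ^ 2))) t ∧
        HasDerivAt l₃ (-((l₁ t * l₂ t + n₁ * n₂ * l₃ t ^ 2) /
          (l₁ t ^ 2 * l₂ t ^ 2 * l₃ t ^ 2))) t ∧
        0 < ε t ∧
        algebraMap ℝ (Forms Heisenberg) (6 * ε t ^ 2) = hodge b (ω t ^ 3 * η)) ∧
      -- `ψ` is the solution, its maximal interval of existence is `(-∞, T)`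
      Heisenberg.IsMaximalLaplacianCoflow ψ₀ (Set.Iio T) ψ ∧
      0 < T ∧ T < 4 / (6 * δ₀ ^ 2) ^ (1 / 3 : ℝ) := by
  intro ψ₀ η dη ω₀ δ₀
  have hφ : φ₀ = modelG2 b := hφ₀
  obtain ⟨a, r₀, m₁, m₂, m₃, hs, ha⟩ :=
    Heisenberg.exists_isDiagonalFrame b (by rw [← hφ]; exact hcoclosed)
  have hr₀ := ha.pos
  have hx₀ := Heisenberg.unitCenter_eq hs hr₀ ha.center
  have hη : η = coframe a 6 := congrArg oneForm (Heisenberg.eta_eq hs hr₀ ha.center)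
  have hdη : dη = r₀ • Heisenberg.de7 := by
    rw [← Heisenberg.d_coframe_six ha.center, ← hη]
  have hω₀ : ω₀ = kaehlerForm a := by
    rw [← interiorProd_six_modelG2, hs.model, ← hφ, ← hx₀]
  have hψ₀ : ψ₀ = hodge a (modelG2 a) := by
    rw [hs.hodge, hs.model, ← hφ]
  obtain ⟨n₁, n₂, n₃, P, ⟨p₁, p₂, p₃⟩, hp, hn₁, hn₂, hn₃, hP, hPV, hm₁, hm₂, hm₃, hD⟩ :=
    ha.exists_normalisation
  have hδ₀ : δ₀ = P ^ 5 := by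
    have h : dη ^ 3 = (6 * (r₀ ^ 3 * (m₁ * m₂ * m₃))) • vol6 a := by
      rw [hdη, smul_pow, ha.de7_cube, smul_smul]
      congr 1
      ring
    show formNorm b (dη ^ 3) / 6 = _
    rw [← hs.formNorm, h, formNorm_smul_vol6, abs_mul, hD, abs_of_pos (by norm_num)]
    ring
  have hsq : ∀ {n : ℝ}, n = 1 ∨ n = -1 → n ^ 2 = 1 := by
    rintro n (rfl | rfl) <;> norm_num
  obtain ⟨T, x, hT, hTle, hx0, hx, hlim⟩ :=
    exists_ancient_diagonal_solution (hsq hn₁) (hsq hn₂) (hsq hn₃) hp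
  have hmax := Heisenberg.isMaximalLaplacianCoflow_diagonalPsi (hsq hn₁) (hsq hn₂) (hsq hn₃) hp hPV
    (by rw [← hm₁, ← hm₂, ← hm₃]; exact ha) hx0 hx hT hlim
  obtain ⟨hp₁, hp₂, hp₃⟩ := id hp
  simp only at hp₁ hp₂ hp₃ hPV hm₁ hm₂ hm₃ hmax
  -- The pⱼ are the initial values λⱼ(0); their square roots are the lengths of the frame vectors of
  -- F.
  obtain ⟨q₁, hq₁, rfl⟩ : ∃ q, 0 < q ∧ p₁ = q * q :=
    ⟨√p₁, Real.sqrt_pos.2 hp₁, (Real.mul_self_sqrt hp₁.le).symm⟩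
  obtain ⟨q₂, hq₂, rfl⟩ : ∃ q, 0 < q ∧ p₂ = q * q :=
    ⟨√p₂, Real.sqrt_pos.2 hp₂, (Real.mul_self_sqrt hp₂.le).symm⟩
  obtain ⟨q₃, hq₃, rfl⟩ : ∃ q, 0 < q ∧ p₃ = q * q :=
    ⟨√p₃, Real.sqrt_pos.2 hp₃, (Real.mul_self_sqrt hp₃.le).symm⟩
  obtain ⟨F, ⟨F0, F1, F2, F3, F4, F5, F6⟩, c0, c1, c2, c3, c4, c5⟩ :=
    Heisenberg.exists_normalised_frame hr₀ ha.center hq₁ hq₂ hq₃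
  have hq : Real.sqrt (q₁ * q₁ * (q₂ * q₂) * (q₃ * q₃)) = q₁ * q₂ * q₃ := by
    rw [show q₁ * q₁ * (q₂ * q₂) * (q₃ * q₃) = (q₁ * q₂ * q₃) ^ 2 by ring,
      Real.sqrt_sq (by positivity)]
  have hPq : P = 1 / (q₁ * q₂ * q₃) := by
    rw [eq_div_iff (by positivity)]
    have h : (P * (q₁ * q₂ * q₃)) ^ 2 = 1 := by rw [← hPV]; ring
    exact (pow_eq_one_iff_of_nonneg (by positivity) two_ne_zero).1 h
  -- This ε is √(λ₁λ₂λ₃) divided by its initial value. Dividing ρ̂(t) by it leaves the constant form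
  -- `rhoHat a`, as the conservation of ρ̂ ∧ η requires.
  refine ⟨T, F, n₁, n₂, n₃, fun t => (x t).1, fun t => (x t).2.1, fun t => (x t).2.2,
    fun t => Real.sqrt ((x t).1 * (x t).2.1 * (x t).2.2) / (q₁ * q₂ * q₃), ?_⟩
  intro f ω ρhat ψ
  have hω : ∀ t, ω t = twoForm a (Heisenberg.diagCoeff ((x t).1 / (q₁ * q₁))
      ((x t).2.1 / (q₂ * q₂)) ((x t).2.2 / (q₃ * q₃))) := by
    intro t
    simp only [ω, f, twoForm, Heisenberg.diagCoeff, c0, c1, c2, c3, c4, c5, Matrix.cons_val,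
      smul_mul_smul_comm, smul_smul, zero_mul, zero_smul, add_zero]
    match_scalars <;> field_simp
  have hρ : rhoHat a = (q₁ * q₂ * q₃) •
      (-(f 1 * f 3 * f 5) + f 0 * f 2 * f 5 + f 0 * f 3 * f 4 + f 1 * f 2 * f 4) := by
    simp only [f, rhoHat, c0, c1, c2, c3, c4, c5, smul_mul_smul_comm]
    module
  have hpos : ∀ t < T, 0 < (x t).1 ∧ 0 < (x t).2.1 ∧ 0 < (x t).2.2 := fun t ht => (hx t ht).1
  have hψ : ∀ t < T, ψ t = Heisenberg.diagonalPsi a ((x t).1 / (q₁ * q₁))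
      ((x t).2.1 / (q₂ * q₂)) ((x t).2.2 / (q₃ * q₃)) := by
    intro t ht
    obtain ⟨l1, l2, l3⟩ := hpos t ht
    have hv : 0 < Real.sqrt ((x t).1 * (x t).2.1 * (x t).2.2) := Real.sqrt_pos.2 (by positivity)
    rw [Heisenberg.diagonalPsi_eq_fourForm, ← Heisenberg.pfAdj_diagCoeff, hρ]
    simp only [ψ, ρhat, hω, twoForm_sq, hη, smul_mul_assoc, smul_smul]
    congr 2
    · norm_num
    · field_simp
  refine ⟨F6, ?_, ?_, ?_, ⟨hn₁, hn₂, hn₃⟩, ?_, ?_, ?_, fun t ht => ?_, ?_, hT, ?_⟩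
  · intro i hi
    rw [Heisenberg.eta_eq hs hr₀ ha.center]
    fin_cases i <;> simp_all [coord_basis]
  · have hF : ∀ i, ∃ c : ℝ, F i = c • a i := by
      intro i
      fin_cases i
      exacts [⟨_, F0⟩, ⟨_, F1⟩, ⟨_, F2⟩, ⟨_, F3⟩, ⟨_, F4⟩, ⟨_, F5⟩, ⟨_, F6.trans ha.center⟩]
    intro i j hij
    obtain ⟨c, hc⟩ := hF i
    obtain ⟨c', hc'⟩ := hF j
    rw [← hs.metric, hc, hc', Heisenberg.frameMetric_smul_smul, if_neg hij, mul_zero]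
  · simp only [← hs.metric, F0, F1, F2, F3, F4, F5, Heisenberg.frameMetric_smul_smul, if_true,
      mul_one, hx0, and_self]
  · simp only [hx0, hq, f]
    rw [hdη, ha.de7, c0, c1, c2, c3, c4, c5, hm₁, hm₂, hm₃, hPq]
    simp only [smul_mul_smul_comm]
    match_scalars <;> field_simp
  · rw [hω, hω₀, hx0]
    simp [twoForm, Heisenberg.diagCoeff, kaehlerForm, hq₁.ne', hq₂.ne', hq₃.ne']
  · rw [hω₀, F0, F1, F2, F3, F4, F5]
    simp only [hx0, kaehlerForm, map_add, map_neg, map_smul, interiorProd_coframe_mul,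
      interiorProd_coframe, coord_basis, Fin.reduceEq, if_true, if_false, zero_smul, sub_zero,
      zero_sub, map_zero, mul_zero, smul_eq_mul, mul_one, add_zero, zero_add,
      Algebra.algebraMap_eq_smul_one, mul_smul_comm, smul_smul, neg_zero, smul_zero, and_self]
  · obtain ⟨l1, l2, l3⟩ := hpos t ht
    obtain ⟨d1, d2, d3⟩ := hx.hasDerivAt_coord ht
    refine ⟨l1, l2, l3, d1, d2, d3, div_pos (Real.sqrt_pos.2 (by positivity)) (by positivity), ?_⟩
    rw [hω, twoForm_cube, hη, Heisenberg.pf_diagCoeff, smul_mul_assoc, vol6_mul_coframe_six,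
      ← hs.hodge, hodge_smul_vol, div_pow, Real.sq_sqrt (by positivity)]
    congr 1
    field_simp
  · rw [hψ₀]
    -- The two expressions for ψ are identified only for t < T, where the λⱼ are positive; hence the
    -- transfer along equality on the interval.
    exact hmax.congr isOpen_Iio hT hψ
  · rw [hδ₀]
    exact Heisenberg.existence_time_bound hP hPV hTle
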